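/- Let $K$ be a field and let $H$ be a Hopf algebra over $K$ with bijective antipode $S$. A braiding on a vector space $A$ is an invertible $\sigma\in\mathrm{End}(A\otimes A)$ with $\sigma_1\sigma_2\sigma_1=\sigma_2\sigma_1\sigma_2$ on $A^{\otimes 3}$, where $\sigma_1=\sigma\otimes\mathrm{id}$ and $\sigma_2=\mathrm{id}\otimes\sigma$. For an algebra $(A,m,1)$, the pair $(A,\sigma)$ is a *YB algebra* if $\sigma(m\otimes\mathrm{id})=(\mathrm{id}\otimes m)\sigma_1\sigma_2$, $\sigma(\mathrm{id}\otimes m)=(m\otimes\mathrm{id})\sigma_2\sigma_1$, $\sigma(1\otimes a)=a\otimes 1$ and $\sigma(a\otimes 1)=1\otimes a$. For a coalgebra $(C,\Delta,\varepsilon)$, the pair $(C,\sigma)$ is a *YB coalgebra* if $\sigma_1\sigma_2(\Delta\otimes\mathrm{id})=(\mathrm{id}\otimes\Delta)\sigma$, $\sigma_2\sigma_1(\mathrm{id}\otimes\Delta)=(\Delta\otimes\mathrm{id})\sigma$, $(\mathrm{id}\otimes\varepsilon)\sigma=\varepsilon\otimes\mathrm{id}$ and $(\varepsilon\otimes\mathrm{id})\sigma=\mathrm{id}\otimes\varepsilon$.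 The natural braiding of a left Yetter-Drinfel'd module $V$ over $H$ is $v\otimes w\mapsto\sum v_{(-1)}\cdot w\otimes v_{(0)}$. Let $M$ be a Hopf bimodule over $H$, that is, an $H$-bimodule and $H$-bicomodule whose coactions $\delta_L:M\to H\otimes M$ and $\delta_R:M\to M\otimes H$ are morphisms of $H$-bimodules. Put $M^{\square 1}=M$, $M^{\square k}=M^{\square(k-1)}\,\square\, M=\mathrm{Ker}(\delta_R\otimes\mathrm{id}-\mathrm{id}\otimes\delta_L)\subseteq M^{\square (k-1)}\otimes M$, and $T^c_H(M)=H\oplus M\oplus\bigoplus_{k\ge 2}M^{\square k}$. The cotensor Hopf algebra is $T=T^c_H(M)$ with the following structure. The counit is $\varepsilon_H$ on $H$ and zero on the other summands. The coproduct is $\Delta_H$ on $H$, and on $M^{\square k}$ it is the deconcatenation $$m_1\otimes\cdots\otimes m_k\mapsto \delta_L(m_1)\otimes m_2\otimes\cdots\otimes m_k+\sum_{0<r<k}(m_1\otimes\cdots\otimes m_r)\otimes(m_{r+1}\otimes\cdots\otimes m_k)+m_1\otimes\cdots\otimes m_{k-1}\otimes\delta_R(m_k).$$ The unit is that of $H$,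 and the product is the homomorphism of coalgebras $T\otimes T\to T$ whose component in $H$ is $x\otimes y\mapsto x_0y_0$ and whose component in $M$ is $x\otimes y\mapsto x_0\cdot y_1+x_1\cdot y_0$, where $x_0\in H$ and $x_1\in M$ denote the components of $x$. Let $S_H(M)$ be the subalgebra of $T$ generated by $H$ and $M$. Then this structure exists and makes $T$ a Hopf algebra, the inclusion $i:H\to T$ and the projection $\pi:T\to H$ are bialgebra maps, $S_H(M)$ is a sub-Hopf algebra of $T$ containing $i(H)$, and the following holds both for $A=T^c_H(M)$ and for $A=S_H(M)$, with $i$ and $\pi$ (co)restricted accordingly. The right coinvariants $B=\{a\in A:\sum a_{(1)}\otimes\pi(a_{(2)})=a\otimes 1\}$ form a left Yetter-Drinfel'd module over $H$ with the action $h\cdot b=\sum i(h_{(1)})\,b\,i(S(h_{(2)}))$ and the coaction $b\mapsto\sum\pi(b_{(1)})\otimes b_{(2)}$, and the map $B\otimes H\to A$, $b\otimes h\mapsto b\,i(h)$, is bijective. Moreover: 1. $A$ is a YB algebra with the braiding that corresponds under $B\otimes H\cong A$ to the natural braiding of the tensor product $B\otimes H$ of Yetter-Drinfel'd modules, where $H$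 carries the action $x\cdot h=\sum x_{(1)}hS(x_{(2)})$ and the coaction $h\mapsto\sum h_{(1)}\otimes h_{(2)}$; 2. $A$ is a YB coalgebra with the braiding that corresponds under $B\otimes H\cong A$ to the natural braiding of the tensor product $B\otimes H$ of Yetter-Drinfel'd modules, where $H$ carries the action $x\cdot h=xh$ and the coaction $h\mapsto\sum h_{(1)}S(h_{(3)})\otimes h_{(2)}$. -/

import Mathlib

open scoped TensorProduct DirectSum

universe u v w

noncomputable section

namespace YangBaxter

/-! ## Braidings, YB algebras and YB coalgebras -/

section Braiding

variable {K V : Type*} [CommRing K] [AddCommGroup V] [Module K V]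

/-- `σ ⊗ id` on `(V ⊗ V) ⊗ V`. -/
def braid₁ (σ : V ⊗[K] V →ₗ[K] V ⊗[K] V) : (V ⊗[K] V) ⊗[K] V →ₗ[K] (V ⊗[K] V) ⊗[K] V :=
  σ.rTensor V

/-- `id ⊗ σ` on `(V ⊗ V) ⊗ V`. -/
def braid₂ (σ : V ⊗[K] V →ₗ[K] V ⊗[K] V) : (V ⊗[K] V) ⊗[K] V →ₗ[K] (V ⊗[K] V) ⊗[K] V :=
  (TensorProduct.assoc K V V V).symm.toLinearMap ∘ₗ σ.lTensor V ∘ₗ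
    (TensorProduct.assoc K V V V).toLinearMap

/-- A braiding on `V`: an invertible solution of the quantum Yang-Baxter equation on `V ⊗ V ⊗ V`. -/
structure IsBraiding (σ : V ⊗[K] V →ₗ[K] V ⊗[K] V) : Prop where
  bijective : Function.Bijective σ
  yang_baxter : braid₁ σ ∘ₗ braid₂ σ ∘ₗ braid₁ σ = braid₂ σ ∘ₗ braid₁ σ ∘ₗ braid₂ σ

end Braiding

/-- `(A, σ)` is a Yang-Baxter algebra. -/
structure IsYBAlgebra {K A : Type*} [CommRing K] [Ring A] [Algebra K A]
    (σ : A ⊗[K] A →ₗ[K] A ⊗[K] A) : Prop where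
  braiding : IsBraiding σ
  /-- `σ (m ⊗ id) = (id ⊗ m) σ₁ σ₂` -/
  mul_left : σ ∘ₗ (LinearMap.mul' K A).rTensor A =
    (LinearMap.mul' K A).lTensor A ∘ₗ (TensorProduct.assoc K A A A).toLinearMap ∘ₗ
      braid₁ σ ∘ₗ braid₂ σ
  /-- `σ (id ⊗ m) = (m ⊗ id) σ₂ σ₁` -/
  mul_right : σ ∘ₗ (LinearMap.mul' K A).lTensor A ∘ₗ (TensorProduct.assoc K A A A).toLinearMap =
    (LinearMap.mul' K A).rTensor A ∘ₗ braid₂ σ ∘ₗ braid₁ σ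
  one_left : ∀ a : A, σ (1 ⊗ₜ[K] a) = a ⊗ₜ[K] 1
  one_right : ∀ a : A, σ (a ⊗ₜ[K] 1) = 1 ⊗ₜ[K] a

/-- `(C, σ)` is a Yang-Baxter coalgebra. -/
structure IsYBCoalgebra {K C : Type*} [CommRing K] [AddCommGroup C] [Module K C] [Coalgebra K C]
    (σ : C ⊗[K] C →ₗ[K] C ⊗[K] C) : Prop where
  braiding : IsBraiding σ
  /-- `σ₁ σ₂ (Δ ⊗ id) = (id ⊗ Δ) σ` -/
  comul_left : braid₁ σ ∘ₗ braid₂ σ ∘ₗ (Coalgebra.comul (R := K) (A := C)).rTensor C =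
    (TensorProduct.assoc K C C C).symm.toLinearMap ∘ₗ
      (Coalgebra.comul (R := K) (A := C)).lTensor C ∘ₗ σ
  /-- `σ₂ σ₁ (id ⊗ Δ) = (Δ ⊗ id) σ` -/
  comul_right : braid₂ σ ∘ₗ braid₁ σ ∘ₗ (TensorProduct.assoc K C C C).symm.toLinearMap ∘ₗ
      (Coalgebra.comul (R := K) (A := C)).lTensor C =
    (Coalgebra.comul (R := K) (A := C)).rTensor C ∘ₗ σ
  /-- `(id ⊗ ε) σ = ε ⊗ id` -/
  counit_left : ∀ x y : C, TensorProduct.rid K C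
    ((Coalgebra.counit (R := K) (A := C)).lTensor C (σ (x ⊗ₜ[K] y))) =
      Coalgebra.counit (R := K) x • y
  /-- `(ε ⊗ id) σ = id ⊗ ε` -/
  counit_right : ∀ x y : C, TensorProduct.lid K C
    ((Coalgebra.counit (R := K) (A := C)).rTensor C (σ (x ⊗ₜ[K] y))) =
      Coalgebra.counit (R := K) y • x

/-! ## Yetter-Drinfel'd modules -/

section YetterDrinfeld

variable {K H V W : Type*} [CommRing K] [Ring H] [HopfAlgebra K H]
  [AddCommGroup V] [Module K V] [AddCommGroup W] [Module K W]

/-- `V` with the action `α` and the coaction `ρ` is a left Yetter-Drinfel'd module over `H`. -/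
structure IsYetterDrinfeld (α : H ⊗[K] V →ₗ[K] V) (ρ : V →ₗ[K] H ⊗[K] V) : Prop where
  one_act : ∀ v : V, α (1 ⊗ₜ[K] v) = v
  mul_act : ∀ (g h : H) (v : V), α ((g * h) ⊗ₜ[K] v) = α (g ⊗ₜ[K] α (h ⊗ₜ[K] v))
  counit_coact : ∀ v : V,
    TensorProduct.lid K V ((Coalgebra.counit (R := K) (A := H)).rTensor V (ρ v)) = v
  coassoc : (TensorProduct.assoc K H H V).toLinearMap ∘ₗ
      (Coalgebra.comul (R := K) (A := H)).rTensor V ∘ₗ ρ = ρ.lTensor H ∘ₗ ρ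
  /-- `∑ h₁ v₍₋₁₎ ⊗ h₂ · v₍₀₎ = ∑ (h₁ · v)₍₋₁₎ h₂ ⊗ (h₁ · v)₍₀₎` -/
  compat :
    TensorProduct.map (LinearMap.mul' K H) α ∘ₗ
        (TensorProduct.tensorTensorTensorComm K H H H V).toLinearMap ∘ₗ
        TensorProduct.map (Coalgebra.comul (R := K) (A := H)) ρ =
      (LinearMap.mul' K H).rTensor V ∘ₗ (TensorProduct.rightComm K H V H).toLinearMap ∘ₗ
        (ρ ∘ₗ α).rTensor H ∘ₗ (TensorProduct.rightComm K H H V).toLinearMap ∘ₗ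
        (Coalgebra.comul (R := K) (A := H)).rTensor V

/-- The natural braiding `v ⊗ w ↦ ∑ v₍₋₁₎ · w ⊗ v₍₀₎` of a Yetter-Drinfel'd module. -/
def naturalBraiding (α : H ⊗[K] V →ₗ[K] V) (ρ : V →ₗ[K] H ⊗[K] V) :
    V ⊗[K] V →ₗ[K] V ⊗[K] V :=
  α.rTensor V ∘ₗ (TensorProduct.rightComm K H V V).toLinearMap ∘ₗ ρ.rTensor V

/-- The tensor product action `h · (v ⊗ w) = ∑ h₁ · v ⊗ h₂ · w`. -/
def tensorAction (α : H ⊗[K] V →ₗ[K] V) (β : H ⊗[K] W →ₗ[K] W) :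
    H ⊗[K] (V ⊗[K] W) →ₗ[K] V ⊗[K] W :=
  TensorProduct.map α β ∘ₗ (TensorProduct.tensorTensorTensorComm K H H V W).toLinearMap ∘ₗ
    (Coalgebra.comul (R := K) (A := H)).rTensor (V ⊗[K] W)

/-- The tensor product coaction `v ⊗ w ↦ ∑ v₍₋₁₎ w₍₋₁₎ ⊗ (v₍₀₎ ⊗ w₍₀₎)`. -/
def tensorCoaction (ρ : V →ₗ[K] H ⊗[K] V) (θ : W →ₗ[K] H ⊗[K] W) :
    V ⊗[K] W →ₗ[K] H ⊗[K] (V ⊗[K] W) :=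
  (LinearMap.mul' K H).rTensor (V ⊗[K] W) ∘ₗ
    (TensorProduct.tensorTensorTensorComm K H V H W).toLinearMap ∘ₗ TensorProduct.map ρ θ

end YetterDrinfeld

/-! ## Hopf algebras with a projection, and Radford's biproduct -/

section Biproduct

variable {K H A : Type*} [CommRing K] [Ring H] [HopfAlgebra K H] [Ring A] [HopfAlgebra K A]

/-- The left adjoint action `h · a = ∑ i(h₁) a i(S(h₂))` along `i : H → A`. -/
def adjointAction (i : H →ₗ[K] A) : H ⊗[K] A →ₗ[K] A :=
  LinearMap.mul' K A ∘ₗ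
    TensorProduct.map (LinearMap.mul' K A ∘ₗ i.rTensor A) (i ∘ₗ HopfAlgebra.antipode K) ∘ₗ
    (TensorProduct.rightComm K H H A).toLinearMap ∘ₗ
    (Coalgebra.comul (R := K) (A := H)).rTensor A

/-- The coadjoint coaction `h ↦ ∑ h₁ S(h₃) ⊗ h₂` of `H` on itself. -/
def coadjointCoaction (K H : Type*) [CommRing K] [Ring H] [HopfAlgebra K H] : H →ₗ[K] H ⊗[K] H :=
  (LinearMap.mul' K H ∘ₗ (HopfAlgebra.antipode K).lTensor H).rTensor H ∘ₗ
    (TensorProduct.rightComm K H H H).toLinearMap ∘ₗ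
    (Coalgebra.comul (R := K) (A := H)).rTensor H ∘ₗ Coalgebra.comul

/-- The left coaction `a ↦ ∑ π(a₁) ⊗ a₂` of `H` on `A`. -/
def leftCoaction (p : A →ₗ[K] H) : A →ₗ[K] H ⊗[K] A :=
  p.rTensor A ∘ₗ Coalgebra.comul

/-- The right coinvariants `B = {a | ∑ a₁ ⊗ π(a₂) = a ⊗ 1}` of `A`. -/
def rightCoinvariants (p : A →ₗ[K] H) : Submodule K A :=
  LinearMap.eqLocus (p.lTensor A ∘ₗ Coalgebra.comul) ((TensorProduct.mk K A H).flip 1)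

/-- Radford's map `B ⊗ H → A`, `b ⊗ h ↦ b i(h)`. -/
def radfordMap (i : H →ₗ[K] A) (p : A →ₗ[K] H) : rightCoinvariants p ⊗[K] H →ₗ[K] A :=
  LinearMap.mul' K A ∘ₗ TensorProduct.map (rightCoinvariants p).subtype i

/-- For bialgebra maps `i : H → A` and `p : A → H` with `p ∘ i = id`: the right coinvariants `B`
form a Yetter-Drinfel'd module under the left adjoint action and the left coaction restricted from
`A`, the map `B ⊗ H → A` is bijective, and `A` is

* a YB algebra for the braiding corresponding to the natural braiding of the tensor product of the
  Yetter-Drinfel'd modules `B` and `H`, where `H` carries the adjoint action and the coaction `Δ`;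
* a YB coalgebra for the braiding corresponding to the natural braiding of the tensor product of
  the Yetter-Drinfel'd modules `B` and `H`, where `H` carries left multiplication and the coadjoint
  coaction.

`αB`, `ρB`, `σ` and `τ` are uniquely determined by the equations they have to satisfy. -/
def IsBiproductYB (i : H →ₗ[K] A) (p : A →ₗ[K] H) : Prop :=
  Function.Bijective (radfordMap i p) ∧
  ∃ (αB : H ⊗[K] rightCoinvariants p →ₗ[K] rightCoinvariants p)
    (ρB : rightCoinvariants p →ₗ[K] H ⊗[K] rightCoinvariants p),
    (rightCoinvariants p).subtype ∘ₗ αB =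
      adjointAction i ∘ₗ (rightCoinvariants p).subtype.lTensor H ∧
    (rightCoinvariants p).subtype.lTensor H ∘ₗ ρB =
      leftCoaction p ∘ₗ (rightCoinvariants p).subtype ∧
    IsYetterDrinfeld αB ρB ∧
    (∃ σ : A ⊗[K] A →ₗ[K] A ⊗[K] A,
      σ ∘ₗ TensorProduct.map (radfordMap i p) (radfordMap i p) =
        TensorProduct.map (radfordMap i p) (radfordMap i p) ∘ₗ
          naturalBraiding (tensorAction αB (adjointAction (LinearMap.id : H →ₗ[K] H)))
            (tensorCoaction ρB (Coalgebra.comul (R := K) (A := H))) ∧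
      IsYBAlgebra σ) ∧
    (∃ τ : A ⊗[K] A →ₗ[K] A ⊗[K] A,
      τ ∘ₗ TensorProduct.map (radfordMap i p) (radfordMap i p) =
        TensorProduct.map (radfordMap i p) (radfordMap i p) ∘ₗ
          naturalBraiding (tensorAction αB (LinearMap.mul' K H))
            (tensorCoaction ρB (coadjointCoaction K H)) ∧
      IsYBCoalgebra τ)

end Biproduct

/-! ## Hopf bimodules -/

section Bimodule

variable (K H M : Type*) [CommRing K] [Ring H] [HopfAlgebra K H] [AddCommGroup M] [Module K M]

/-- The left action `h ⊗ m ↦ h m`. -/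
def leftAct [Module H M] [IsScalarTower K H M] : H ⊗[K] M →ₗ[K] M :=
  TensorProduct.lift (Algebra.lsmul K K M : H →ₐ[K] Module.End K M).toLinearMap

/-- The right action `m ⊗ h ↦ m h`. -/
def rightAct [Module Hᵐᵒᵖ M] [IsScalarTower K Hᵐᵒᵖ M] : M ⊗[K] H →ₗ[K] M :=
  TensorProduct.lift (((Algebra.lsmul K K M : Hᵐᵒᵖ →ₐ[K] Module.End K M).toLinearMap ∘ₗ
    (MulOpposite.opLinearEquiv K : H ≃ₗ[K] Hᵐᵒᵖ).toLinearMap).flip)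

/-- An `H`-bimodule `M` together with the coactions of a Hopf bimodule: `δL` and `δR` make `M` an
`H`-bicomodule, and they are morphisms of `H`-bimodules for the diagonal actions of `H` on `H ⊗ M`
and `M ⊗ H`. -/
structure HopfBimodule [Module H M] [IsScalarTower K H M] [Module Hᵐᵒᵖ M]
    [IsScalarTower K Hᵐᵒᵖ M] [SMulCommClass H Hᵐᵒᵖ M] where
  /-- the left coaction -/
  δL : M →ₗ[K] H ⊗[K] M
  /-- the right coaction -/
  δR : M →ₗ[K] M ⊗[K] H
  coassoc_left : (TensorProduct.assoc K H H M).toLinearMap ∘ₗ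
    (Coalgebra.comul (R := K) (A := H)).rTensor M ∘ₗ δL = δL.lTensor H ∘ₗ δL
  counit_left : ∀ m : M,
    TensorProduct.lid K M ((Coalgebra.counit (R := K) (A := H)).rTensor M (δL m)) = m
  coassoc_right : (TensorProduct.assoc K M H H).toLinearMap ∘ₗ δR.rTensor H ∘ₗ δR =
    (Coalgebra.comul (R := K) (A := H)).lTensor M ∘ₗ δR
  counit_right : ∀ m : M,
    TensorProduct.rid K M ((Coalgebra.counit (R := K) (A := H)).lTensor M (δR m)) = m
  comm : (TensorProduct.assoc K H M H).toLinearMap ∘ₗ δL.rTensor H ∘ₗ δR = δR.lTensor H ∘ₗ δL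
  /-- `δL (h m) = ∑ h₁ m₍₋₁₎ ⊗ h₂ m₍₀₎` -/
  δL_leftAct : δL ∘ₗ leftAct K H M =
    TensorProduct.map (LinearMap.mul' K H) (leftAct K H M) ∘ₗ
      (TensorProduct.tensorTensorTensorComm K H H H M).toLinearMap ∘ₗ
      TensorProduct.map (Coalgebra.comul (R := K) (A := H)) δL
  /-- `δL (m h) = ∑ m₍₋₁₎ h₁ ⊗ m₍₀₎ h₂` -/
  δL_rightAct : δL ∘ₗ rightAct K H M =
    TensorProduct.map (LinearMap.mul' K H) (rightAct K H M) ∘ₗ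
      (TensorProduct.tensorTensorTensorComm K H M H H).toLinearMap ∘ₗ
      TensorProduct.map δL (Coalgebra.comul (R := K) (A := H))
  /-- `δR (h m) = ∑ h₁ m₍₀₎ ⊗ h₂ m₍₁₎` -/
  δR_leftAct : δR ∘ₗ leftAct K H M =
    TensorProduct.map (leftAct K H M) (LinearMap.mul' K H) ∘ₗ
      (TensorProduct.tensorTensorTensorComm K H H M H).toLinearMap ∘ₗ
      TensorProduct.map (Coalgebra.comul (R := K) (A := H)) δR
  /-- `δR (m h) = ∑ m₍₀₎ h₁ ⊗ m₍₁₎ h₂` -/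
  δR_rightAct : δR ∘ₗ rightAct K H M =
    TensorProduct.map (rightAct K H M) (LinearMap.mul' K H) ∘ₗ
      (TensorProduct.tensorTensorTensorComm K M H H H).toLinearMap ∘ₗ
      TensorProduct.map δR (Coalgebra.comul (R := K) (A := H))

end Bimodule

/-! ## Tensor powers -/

section TensorPower

variable (K : Type*) [CommRing K] (M : Type*) [AddCommGroup M] [Module K M]

/-- The tensor power `M^{⊗ (n+1)} = (M ⊗ ⋯) ⊗ M`. -/
def TPow : ℕ → ModuleCat K
  | 0 => ModuleCat.of K M
  | n + 1 => ModuleCat.of K (TPow n ⊗[K] M)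

/-- `M^{⊗ 1} = M`. -/
def TPow.zeroEquiv : TPow K M 0 ≃ₗ[K] M := LinearEquiv.refl K M

/-- `M^{⊗ (n+2)} = M^{⊗ (n+1)} ⊗ M`. -/
def TPow.succEquiv (n : ℕ) : TPow K M (n + 1) ≃ₗ[K] TPow K M n ⊗[K] M :=
  LinearEquiv.refl K (TPow K M n ⊗[K] M)

/-- The sum of the positive tensor powers of `M`. -/
abbrev PosTensor : Type _ := ⨁ n : ℕ, TPow K M n

/-- `w ⊗ m ↦ w ⊗ m`, `M^{⊗ (n+1)} ⊗ M → M^{⊗ (n+2)}` on the sum of the positive tensor powers. -/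
def PosTensor.append : PosTensor K M ⊗[K] M →ₗ[K] PosTensor K M :=
  TensorProduct.lift <| DirectSum.toModule K ℕ (M →ₗ[K] PosTensor K M) fun n =>
    TensorProduct.curry
      (DirectSum.lof K ℕ (fun k => TPow K M k) (n + 1) ∘ₗ (TPow.succEquiv K M n).symm.toLinearMap)

end TensorPower

/-! ## The cotensor Hopf algebra -/

namespace HopfBimodule

variable {K H M : Type*} [Field K] [Ring H] [HopfAlgebra K H] [AddCommGroup M] [Module K M]
  [Module H M] [IsScalarTower K H M] [Module Hᵐᵒᵖ M] [IsScalarTower K Hᵐᵒᵖ M]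
  [SMulCommClass H Hᵐᵒᵖ M]

/-- The right coaction `id ⊗ δR` on the last factor of `M^{⊗ (n+1)}`. -/
def rightCoact (X : HopfBimodule K H M) : (n : ℕ) → (TPow K M n →ₗ[K] TPow K M n ⊗[K] H)
  | 0 => (TPow.zeroEquiv K M).symm.toLinearMap.rTensor H ∘ₗ X.δR ∘ₗ
      (TPow.zeroEquiv K M).toLinearMap
  | n + 1 => (TPow.succEquiv K M n).symm.toLinearMap.rTensor H ∘ₗ
      (TensorProduct.assoc K (TPow K M n) M H).symm.toLinearMap ∘ₗ
      X.δR.lTensor (TPow K M n) ∘ₗ (TPow.succEquiv K M n).toLinearMap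

/-- The iterated cotensor product `M^{□ (n+1)}` as a subspace of `M^{⊗ (n+1)}`:
`M^{□ 1} = M`, and `M^{□ (n+2)}` is the kernel of `δR ⊗ id - id ⊗ δL` on `M^{□ (n+1)} ⊗ M`. -/
def cotensorPow (X : HopfBimodule K H M) : (n : ℕ) → Submodule K (TPow K M n)
  | 0 => ⊤
  | n + 1 => Submodule.comap (TPow.succEquiv K M n).toLinearMap
      (LinearMap.range ((X.cotensorPow n).subtype.rTensor M) ⊓
        LinearMap.ker ((TensorProduct.assoc K (TPow K M n) H M).toLinearMap ∘ₗ
          (X.rightCoact n).rTensor M - X.δL.lTensor (TPow K M n)))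

/-- The space `T^c_H(M) = H ⊕ M ⊕ M^{□ 2} ⊕ M^{□ 3} ⊕ ⋯`. -/
abbrev Cotensor (X : HopfBimodule K H M) : Type _ := H × ⨁ n : ℕ, X.cotensorPow n

/-- The space `H ⊕ M ⊕ M^{⊗ 2} ⊕ M^{⊗ 3} ⊕ ⋯` that contains `T^c_H(M)`. -/
abbrev Ambient (_ : HopfBimodule K H M) : Type _ := H × PosTensor K M

/-- The inclusion of `T^c_H(M)` into `H ⊕ M ⊕ M^{⊗ 2} ⊕ ⋯`. -/
def incl (X : HopfBimodule K H M) : X.Cotensor →ₗ[K] X.Ambient :=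
  LinearMap.prodMap LinearMap.id (DirectSum.lmap fun n => (X.cotensorPow n).subtype)

/-- All terms but the last one of the deconcatenation of `m₁ ⊗ ⋯ ⊗ mₙ₊₁`, that is
`δL(m₁) ⊗ m₂ ⊗ ⋯ ⊗ mₙ₊₁ + ∑_{1 ≤ k ≤ n} (m₁ ⊗ ⋯ ⊗ mₖ) ⊗ (mₖ₊₁ ⊗ ⋯ ⊗ mₙ₊₁)`. -/
def deconcatLeft (X : HopfBimodule K H M) :
    (n : ℕ) → (TPow K M n →ₗ[K] X.Ambient ⊗[K] PosTensor K M)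
  | 0 => TensorProduct.map (LinearMap.inl K H (PosTensor K M))
        (DirectSum.lof K ℕ (fun k => TPow K M k) 0 ∘ₗ (TPow.zeroEquiv K M).symm.toLinearMap) ∘ₗ
      X.δL ∘ₗ (TPow.zeroEquiv K M).toLinearMap
  | n + 1 =>
    ((PosTensor.append K M).lTensor X.Ambient ∘ₗ
        (TensorProduct.assoc K X.Ambient (PosTensor K M) M).toLinearMap ∘ₗ
        (X.deconcatLeft n).rTensor M +
      TensorProduct.map
        (LinearMap.inr K H (PosTensor K M) ∘ₗ DirectSum.lof K ℕ (fun k => TPow K M k) n)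
        (DirectSum.lof K ℕ (fun k => TPow K M k) 0 ∘ₗ (TPow.zeroEquiv K M).symm.toLinearMap)) ∘ₗ
    (TPow.succEquiv K M n).toLinearMap

/-- The map on `H ⊕ M ⊕ M^{⊗ 2} ⊕ ⋯` whose restriction to `T^c_H(M)` is the coproduct:
`Δ` on `H`, and on `M^{⊗ (n+1)}` it sends `m₁ ⊗ ⋯ ⊗ mₙ₊₁` to
`δL(m₁) ⊗ m₂ ⊗ ⋯ ⊗ mₙ₊₁ + ∑_{1 ≤ k ≤ n} (m₁ ⊗ ⋯ ⊗ mₖ) ⊗ (mₖ₊₁ ⊗ ⋯ ⊗ mₙ₊₁)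
  + m₁ ⊗ ⋯ ⊗ mₙ ⊗ δR(mₙ₊₁)`. -/
def deconcat (X : HopfBimodule K H M) : X.Ambient →ₗ[K] X.Ambient ⊗[K] X.Ambient :=
  LinearMap.coprod
    (TensorProduct.map (LinearMap.inl K H (PosTensor K M)) (LinearMap.inl K H (PosTensor K M)) ∘ₗ
      Coalgebra.comul)
    (DirectSum.toModule K ℕ (X.Ambient ⊗[K] X.Ambient) fun n =>
      (LinearMap.inr K H (PosTensor K M)).lTensor X.Ambient ∘ₗ X.deconcatLeft n +
      TensorProduct.map
        (LinearMap.inr K H (PosTensor K M) ∘ₗ DirectSum.lof K ℕ (fun k => TPow K M k) n)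
        (LinearMap.inl K H (PosTensor K M)) ∘ₗ X.rightCoact n)

/-- The component in `M` of an element of `T^c_H(M)`. -/
def degOne (X : HopfBimodule K H M) : X.Cotensor →ₗ[K] M :=
  (TPow.zeroEquiv K M).toLinearMap ∘ₗ (X.cotensorPow 0).subtype ∘ₗ
    DirectSum.component K ℕ (fun n => X.cotensorPow n) 0 ∘ₗ LinearMap.snd K H _

/-- The inclusion of `M` into `T^c_H(M)`. -/
def ofM (X : HopfBimodule K H M) : M →ₗ[K] X.Cotensor :=
  LinearMap.inr K H _ ∘ₗ DirectSum.lof K ℕ (fun n => X.cotensorPow n) 0 ∘ₗ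
    LinearMap.codRestrict (X.cotensorPow 0) (TPow.zeroEquiv K M).symm.toLinearMap
      (fun _ => by rw [cotensorPow]; exact Submodule.mem_top)

/-- The identification `e` of the space underlying the Hopf algebra `T` with `T^c_H(M)` makes `T`
the cotensor Hopf algebra: the coproduct is deconcatenation, the counit is that of `H` on the
component in `H`, the unit is that of `H`, and the product is the homomorphism of coalgebras
`T ⊗ T → T` whose component in `H` is the product of `H` on the components in `H`, and whose
component in `M` is given by the actions of `H` on `M`. (That the product of `T` is a homomorphism
of coalgebras is part of `T` being a Hopf algebra; by the universal property of the cotensor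
coalgebra it is determined by its components in `H` and in `M`.) -/
structure IsCotensorHopfAlgebra (X : HopfBimodule K H M) {T : Type*} [Ring T] [HopfAlgebra K T]
    (e : T ≃ₗ[K] X.Cotensor) : Prop where
  comul : ∀ x : T,
    TensorProduct.map (X.incl ∘ₗ e.toLinearMap) (X.incl ∘ₗ e.toLinearMap)
      (Coalgebra.comul (R := K) x) = X.deconcat (X.incl (e x))
  counit : ∀ x : T, Coalgebra.counit (R := K) x = Coalgebra.counit (R := K) (e x).1
  one : e 1 = (1, 0)
  mul_fst : ∀ x y : T, (e (x * y)).1 = (e x).1 * (e y).1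
  mul_degOne : ∀ x y : T, X.degOne (e (x * y)) =
    (e x).1 • X.degOne (e y) + MulOpposite.op (e y).1 • X.degOne (e x)

/-- The subalgebra of `T = T^c_H(M)` generated by `H` and `M`. -/
def generatedSubalgebra (X : HopfBimodule K H M) {T : Type*} [Ring T] [HopfAlgebra K T]
    (e : T ≃ₗ[K] X.Cotensor) : Subalgebra K T :=
  Algebra.adjoin K (Set.range (fun h : H => e.symm (h, 0)) ∪
    Set.range (fun m : M => e.symm (X.ofM m)))

/-- The injective homomorphism of bialgebras `j : S → T` identifies the Hopf algebra `S` with the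
sub-Hopf algebra `S_H(M)` of `T = T^c_H(M)` generated by `H` and `M`. -/
def IsGeneratedHopfAlgebra (X : HopfBimodule K H M) {T : Type*} [Ring T] [HopfAlgebra K T]
    (e : T ≃ₗ[K] X.Cotensor) {S : Type*} [Ring S] [HopfAlgebra K S] (j : S →ₐc[K] T) : Prop :=
  Function.Injective j ∧ Set.range j = (X.generatedSubalgebra e : Set T)

end HopfBimodule

end YangBaxter

end

/-! The theorem separates into a statement about any Hopf algebra `A` with bialgebra maps `i : H →
A`, `p : A → H`, `p ∘ i = id`, and a construction that supplies two such algebras.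

For the first, Radford's map `B ⊗ H → A` carries both Yetter-Drinfel'd structures on `B ⊗ H` to
structures that can be written down on `A` itself. The first becomes the adjoint action with the
coaction `a ↦ p(a₁) ⊗ a₂`, for which `A` is an algebra in the category of Yetter-Drinfel'd modules.
The second becomes left multiplication with the coaction `a ↦ p(a₁) S(p(a₃)) ⊗ a₂`, for which `A` is
a coalgebra in that category. In such a category the axioms of a YB algebra or YB coalgebra are the
hexagon identities together with naturality of the braiding along the product or the coproduct
(`IsYetterDrinfeld.isYBAlgebra`, `IsYetterDrinfeld.isYBCoalgebra`), and bijectivity of the antipode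
makes the braiding invertible. The Sweedler computations are done in convolution algebras, where `i
∘ p` and `i ∘ S ∘ p` are mutually inverse and the identities reduce to cancellations. The outcome is
`isBiproductYB`.

For the second, deconcatenation is defined on `H ⊕ M ⊕ M^{⊗ 2} ⊕ ⋯`. It need not be coassociative
there; the obstruction at each junction of two factors is the cotensor condition
(`coassocDefect_append`), so it becomes coassociative on the cotensor powers, which it preserves.
The resulting coalgebra is universal among filtered coalgebras: a coalgebra map to `H` and a
compatible map to `M` that vanishes in filtration degree zero lift to a coalgebra map
(`IsCotensorCoalgebra.exists_lift`), and coalgebra maps into it are determined by these components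
(`IsCotensorCoalgebra.hom_ext`). Existence gives the product, uniqueness the unit and associativity
laws. The antipode comes from Takeuchi's argument: the identity agrees with `i ∘ p` in degree zero,
so `1 - id * (i ∘ S ∘ p)` is locally nilpotent for convolution and the identity is a convolution
unit. The same nilpotency restricts to the subalgebra generated by `H` and `M`, which is a
sub-bialgebra containing `i(H)`; hence it is a Hopf algebra with a projection as well. -/

noncomputable section

namespace YangBaxter

/-! ### The natural braiding of a Yetter-Drinfel'd module -/

section Crossing

variable {K H V W V' W' : Type*} [CommRing K] [Ring H] [HopfAlgebra K H]
  [AddCommGroup V] [Module K V] [AddCommGroup W] [Module K W]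
  [AddCommGroup V'] [Module K V'] [AddCommGroup W'] [Module K W']

/-- `v ⊗ w ↦ ∑ v₍₋₁₎ · w ⊗ v₍₀₎` for an action on `W` and a coaction on `V`. -/
def crossing (α : H ⊗[K] W →ₗ[K] W) (ρ : V →ₗ[K] H ⊗[K] V) : V ⊗[K] W →ₗ[K] W ⊗[K] V :=
  α.rTensor V ∘ₗ (TensorProduct.rightComm K H V W).toLinearMap ∘ₗ ρ.rTensor W

theorem naturalBraiding_eq_crossing (α : H ⊗[K] V →ₗ[K] V) (ρ : V →ₗ[K] H ⊗[K] V) :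
    naturalBraiding α ρ = crossing α ρ := rfl

/-- `h ↦ h · w`. -/
def actOn (α : H ⊗[K] W →ₗ[K] W) (w : W) : H →ₗ[K] W := α ∘ₗ (TensorProduct.mk K H W).flip w

@[simp]
theorem actOn_apply (α : H ⊗[K] W →ₗ[K] W) (w : W) (h : H) : actOn α w h = α (h ⊗ₜ w) := rfl

/-- Fixing `w` makes the crossing a linear function of `ρ v`, so later proofs expand `ρ v` into pure
tensors instead of choosing Sweedler components. -/
theorem crossing_tmul (α : H ⊗[K] W →ₗ[K] W) (ρ : V →ₗ[K] H ⊗[K] V) (v : V) (w : W) :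
    crossing α ρ (v ⊗ₜ w) = (actOn α w).rTensor V (ρ v) := by
  simp only [crossing, LinearMap.comp_apply, LinearMap.rTensor_tmul]
  induction ρ v using TensorProduct.induction_on with
  | zero => simp
  | tmul h x => simp
  | add x y hx hy => simp_all [TensorProduct.add_tmul]

/-- Only the action matters on the factor that is acted upon, so linearity over `H` is the whole
requirement on `f`. Separating this half of naturality from the other allows maps such as the
multiplication `V ⊗ V → V`. -/
theorem crossing_naturality_right {α : H ⊗[K] W →ₗ[K] W} {α' : H ⊗[K] W' →ₗ[K] W'}
    {f : W →ₗ[K] W'} (hf : f ∘ₗ α = α' ∘ₗ f.lTensor H) (ρ : V →ₗ[K] H ⊗[K] V) :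
    crossing α' ρ ∘ₗ f.lTensor V = f.rTensor V ∘ₗ crossing α ρ := by
  ext v w
  simp only [TensorProduct.AlgebraTensorModule.curry_apply, LinearMap.restrictScalars_self,
    TensorProduct.curry_apply, LinearMap.comp_apply, LinearMap.lTensor_tmul, crossing_tmul]
  rw [← LinearMap.comp_apply (f.rTensor V), ← LinearMap.rTensor_comp]
  congr 2
  ext h
  simpa using! (LinearMap.congr_fun hf (h ⊗ₜ w)).symm

theorem crossing_naturality_left (α : H ⊗[K] W →ₗ[K] W) {ρ : V →ₗ[K] H ⊗[K] V}
    {ρ' : V' →ₗ[K] H ⊗[K] V'} {f : V →ₗ[K] V'} (hf : ρ' ∘ₗ f = f.lTensor H ∘ₗ ρ) :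
    crossing α ρ' ∘ₗ f.rTensor W = f.lTensor W ∘ₗ crossing α ρ := by
  ext v w
  simp only [TensorProduct.AlgebraTensorModule.curry_apply, LinearMap.restrictScalars_self,
    TensorProduct.curry_apply, LinearMap.comp_apply, LinearMap.rTensor_tmul, crossing_tmul]
  rw [← LinearMap.comp_apply ρ', hf, LinearMap.comp_apply, ← LinearMap.comp_apply _ (f.lTensor H),
    LinearMap.rTensor_comp_lTensor, ← LinearMap.comp_apply (f.lTensor W),
    LinearMap.lTensor_comp_rTensor]

/-- A morphism of modules and comodules intertwines the natural braidings. -/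
theorem naturalBraiding_naturality {α : H ⊗[K] V →ₗ[K] V} {α' : H ⊗[K] V' →ₗ[K] V'}
    {ρ : V →ₗ[K] H ⊗[K] V} {ρ' : V' →ₗ[K] H ⊗[K] V'} {f : V →ₗ[K] V'}
    (hα : f ∘ₗ α = α' ∘ₗ f.lTensor H) (hρ : ρ' ∘ₗ f = f.lTensor H ∘ₗ ρ) :
    naturalBraiding α' ρ' ∘ₗ TensorProduct.map f f =
      TensorProduct.map f f ∘ₗ naturalBraiding α ρ := by
  -- `f ⊗ f` is factored in both orders, so that the two halves of naturality apply one after the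
  -- other. The intermediate crossing has the action of `V` and the coaction of `V'`.
  have h1 : TensorProduct.map f f = f.lTensor V' ∘ₗ f.rTensor V :=
    (LinearMap.lTensor_comp_rTensor _ _ _).symm
  have h2 : TensorProduct.map f f = f.rTensor V' ∘ₗ f.lTensor V :=
    (LinearMap.rTensor_comp_lTensor _ _ _).symm
  rw [naturalBraiding_eq_crossing, naturalBraiding_eq_crossing]
  nth_rewrite 1 [h1]
  rw [h2, ← LinearMap.comp_assoc, crossing_naturality_right hα, LinearMap.comp_assoc,
    crossing_naturality_left _ hρ, LinearMap.comp_assoc]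

/-- The hexagon identity `(id ⊗ c) (c ⊗ id) = c` for the tensor product action. -/
theorem braid₂_braid₁ {α : H ⊗[K] V →ₗ[K] V} {ρ : V →ₗ[K] H ⊗[K] V}
    (hρ : (TensorProduct.assoc K H H V).toLinearMap ∘ₗ
      (Coalgebra.comul (R := K) (A := H)).rTensor V ∘ₗ ρ = ρ.lTensor H ∘ₗ ρ) :
    braid₂ (naturalBraiding α ρ) ∘ₗ braid₁ (naturalBraiding α ρ) =
      crossing (tensorAction α α) ρ ∘ₗ (TensorProduct.assoc K V V V).toLinearMap := by
  ext u v w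
  simp only [TensorProduct.AlgebraTensorModule.curry_apply, LinearMap.restrictScalars_self,
    TensorProduct.curry_apply, LinearMap.comp_apply, braid₁, braid₂, LinearMap.rTensor_tmul,
    naturalBraiding_eq_crossing, LinearEquiv.coe_coe, TensorProduct.assoc_tmul]
  rw [crossing_tmul, crossing_tmul]
  -- Moving `u` past `v` and then past `w` applies the coaction twice; coassociativity replaces this
  -- by the coproduct of a single coefficient, which is the tensor product action on `v ⊗ w`.
  have key : ∀ z : H ⊗[K] V,
      (TensorProduct.assoc K V V V).symm ((crossing α ρ).lTensor V
        ((TensorProduct.assoc K V V V) ((actOn α v).rTensor V z ⊗ₜ w))) =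
      (TensorProduct.assoc K V V V).symm
        (TensorProduct.map (actOn α v) ((actOn α w).rTensor V) (ρ.lTensor H z)) := by
    intro z
    induction z using TensorProduct.induction_on with
    | zero => simp
    | tmul h x => simp [crossing_tmul]
    | add x y hx hy => simp_all [TensorProduct.add_tmul]
  rw [key, ← LinearMap.comp_apply (ρ.lTensor H) ρ, ← hρ]
  simp only [LinearMap.comp_apply, LinearEquiv.coe_coe]
  induction ρ u using TensorProduct.induction_on with
  | zero => simp
  | tmul h x =>
    simp only [LinearMap.rTensor_tmul, actOn_apply, tensorAction, LinearMap.comp_apply,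
      LinearEquiv.coe_coe]
    induction (Coalgebra.comul (R := K) h) using TensorProduct.induction_on with
    | zero => simp
    | tmul h x => simp
    | add x y hx hy => simp_all [TensorProduct.add_tmul]
  | add x y hx hy => simp_all

/-- The hexagon identity `(c ⊗ id) (id ⊗ c) = c` for the tensor product coaction. -/
theorem braid₁_braid₂ {α : H ⊗[K] V →ₗ[K] V} {ρ : V →ₗ[K] H ⊗[K] V}
    (hα : ∀ (g h : H) (v : V), α ((g * h) ⊗ₜ[K] v) = α (g ⊗ₜ[K] α (h ⊗ₜ[K] v))) :
    braid₁ (naturalBraiding α ρ) ∘ₗ braid₂ (naturalBraiding α ρ) =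
      (TensorProduct.assoc K V V V).symm.toLinearMap ∘ₗ crossing α (tensorCoaction ρ ρ) := by
  ext u v w
  simp only [TensorProduct.AlgebraTensorModule.curry_apply, LinearMap.restrictScalars_self,
    TensorProduct.curry_apply, LinearMap.comp_apply, braid₁, braid₂, LinearMap.lTensor_tmul,
    naturalBraiding_eq_crossing, LinearEquiv.coe_coe, TensorProduct.assoc_tmul]
  rw [crossing_tmul, crossing_tmul]
  simp only [tensorCoaction, LinearMap.comp_apply, LinearEquiv.coe_coe, TensorProduct.map_tmul]
  induction ρ v using TensorProduct.induction_on with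
  | zero => simp
  | tmul h x =>
    simp only [LinearMap.rTensor_tmul, actOn_apply, TensorProduct.assoc_symm_tmul, crossing_tmul]
    induction ρ u using TensorProduct.induction_on with
    | zero => simp
    | tmul h x => simp [hα]
    | add x y hx hy => simp_all [TensorProduct.add_tmul]
  | add x y hx hy => simp_all [TensorProduct.tmul_add]

variable {α : H ⊗[K] V →ₗ[K] V} {ρ : V →ₗ[K] H ⊗[K] V}

/-- The natural braiding of a Yetter-Drinfel'd module is a morphism of modules. -/
theorem IsYetterDrinfeld.naturalBraiding_comp_tensorAction (h : IsYetterDrinfeld α ρ) :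
    naturalBraiding α ρ ∘ₗ tensorAction α α =
      tensorAction α α ∘ₗ (naturalBraiding α ρ).lTensor H := by
  ext g v w
  have hc := LinearMap.congr_fun h.compat (g ⊗ₜ v)
  simp only [LinearMap.comp_apply, TensorProduct.map_tmul, LinearMap.rTensor_tmul,
    LinearEquiv.coe_coe] at hc
  have h1 : ∀ z : H ⊗[K] H, naturalBraiding α ρ (TensorProduct.map α α
      (TensorProduct.tensorTensorTensorComm K H H V V (z ⊗ₜ (v ⊗ₜ w)))) =
      (actOn α w).rTensor V ((LinearMap.mul' K H).rTensor V (TensorProduct.rightComm K H V H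
        ((ρ ∘ₗ α).rTensor H (TensorProduct.rightComm K H H V (z ⊗ₜ v))))) := by
    intro z
    induction z using TensorProduct.induction_on with
    | zero => simp
    | tmul a b =>
      simp only [TensorProduct.tensorTensorTensorComm_tmul, TensorProduct.map_tmul,
        naturalBraiding_eq_crossing, crossing_tmul, TensorProduct.rightComm_tmul,
        LinearMap.rTensor_tmul, LinearMap.comp_apply]
      induction ρ (α (a ⊗ₜ v)) using TensorProduct.induction_on with
      | zero => simp
      | tmul c x => simp [h.mul_act]
      | add x y hx hy => simp_all [TensorProduct.add_tmul]
    | add x y hx hy => simp_all [TensorProduct.add_tmul]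
  simp only [TensorProduct.AlgebraTensorModule.curry_apply, LinearMap.restrictScalars_self,
    TensorProduct.curry_apply, LinearMap.comp_apply, tensorAction, LinearMap.lTensor_tmul,
    LinearMap.rTensor_tmul, LinearEquiv.coe_coe]
  rw [h1, ← hc, naturalBraiding_eq_crossing, crossing_tmul]
  induction ρ v using TensorProduct.induction_on with
  | zero => simp
  | tmul c x =>
    simp only [LinearMap.rTensor_tmul, actOn_apply]
    induction (Coalgebra.comul (R := K) g) using TensorProduct.induction_on with
    | zero => simp
    | tmul a b => simp [h.mul_act]
    | add x y hx hy => simp_all [TensorProduct.add_tmul]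
  | add x y hx hy => simp_all [TensorProduct.tmul_add]

/-- On each side two neighbouring crossings combine, by the hexagon identity, into the crossing of
the first factor past `V ⊗ V`. The remaining braiding of these two factors is `H`-linear, so
naturality slides it through. -/
theorem IsYetterDrinfeld.yang_baxter (h : IsYetterDrinfeld α ρ) :
    braid₁ (naturalBraiding α ρ) ∘ₗ braid₂ (naturalBraiding α ρ) ∘ₗ
        braid₁ (naturalBraiding α ρ) =
      braid₂ (naturalBraiding α ρ) ∘ₗ braid₁ (naturalBraiding α ρ) ∘ₗ
        braid₂ (naturalBraiding α ρ) := by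
  rw [braid₂_braid₁ h.coassoc]
  conv_rhs => rw [← LinearMap.comp_assoc, braid₂_braid₁ h.coassoc]
  rw [← LinearMap.comp_assoc, braid₁, ← crossing_naturality_right
    h.naturalBraiding_comp_tensorAction, braid₂]
  ext u v w
  simp

/-- If `∑ g(h₂) f(h₁) = ε(h)`, then twisting the action by `f` and by `g` gives crossings that are
inverse to each other up to flips. -/
theorem crossing_comm_crossing (h : IsYetterDrinfeld α ρ) {f g : H →ₗ[K] H}
    (hfg : ∀ x : H, LinearMap.mul' K H (TensorProduct.comm K H H
      (TensorProduct.map f g (Coalgebra.comul (R := K) x))) =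
        algebraMap K H (Coalgebra.counit (R := K) x)) (v w : V) :
    crossing (α ∘ₗ g.rTensor V) ρ (TensorProduct.comm K V V
      (crossing (α ∘ₗ f.rTensor V) ρ (v ⊗ₜ w))) = w ⊗ₜ v := by
  have key : ∀ z : H ⊗[K] V, crossing (α ∘ₗ g.rTensor V) ρ (TensorProduct.comm K V V
      ((actOn (α ∘ₗ f.rTensor V) w).rTensor V z)) =
      (actOn α w ∘ₗ LinearMap.mul' K H ∘ₗ (TensorProduct.comm K H H).toLinearMap ∘ₗ
        TensorProduct.map f g).rTensor V ((TensorProduct.assoc K H H V).symm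
          (ρ.lTensor H z)) := by
    intro z
    induction z using TensorProduct.induction_on with
    | zero => simp
    | tmul a x =>
      simp only [LinearMap.rTensor_tmul, TensorProduct.comm_tmul, crossing_tmul,
        LinearMap.lTensor_tmul]
      induction ρ x using TensorProduct.induction_on with
      | zero => simp
      | tmul b y => simp [h.mul_act]
      | add x y hx hy => simp_all [TensorProduct.tmul_add]
    | add x y hx hy => simp_all
  rw [crossing_tmul, key, ← LinearMap.comp_apply (ρ.lTensor H), ← h.coassoc]
  simp only [LinearMap.comp_apply, LinearEquiv.coe_coe, LinearEquiv.symm_apply_apply]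
  rw [← LinearMap.comp_apply _ (LinearMap.rTensor V _), ← LinearMap.rTensor_comp]
  have h2 : (actOn α w ∘ₗ LinearMap.mul' K H ∘ₗ (TensorProduct.comm K H H).toLinearMap ∘ₗ
        TensorProduct.map f g) ∘ₗ Coalgebra.comul (R := K) =
      LinearMap.toSpanSingleton K V w ∘ₗ Coalgebra.counit (R := K) := by
    ext x
    simp only [LinearMap.comp_apply, LinearEquiv.coe_coe, hfg, actOn_apply,
      LinearMap.toSpanSingleton_apply, Algebra.algebraMap_eq_smul_one]
    rw [← TensorProduct.smul_tmul', map_smul, h.one_act]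
  rw [h2]
  have h3 := h.counit_coact v
  have h4 : ∀ z : H ⊗[K] V,
      (LinearMap.toSpanSingleton K V w ∘ₗ Coalgebra.counit (R := K)).rTensor V z =
      w ⊗ₜ TensorProduct.lid K V ((Coalgebra.counit (R := K) (A := H)).rTensor V z) := by
    intro z
    induction z using TensorProduct.induction_on with
    | zero => simp
    | tmul a x => simp [TensorProduct.smul_tmul']
    | add x y hx hy => simp_all [TensorProduct.tmul_add]
  rw [h4, h3]

/-- The inverse is `w ⊗ v ↦ ∑ v₍₀₎ ⊗ S⁻¹(v₍₋₁₎) · w`. Both composites reduce to `∑ S⁻¹(h₂) h₁ = ε(h)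
= ∑ h₂ S⁻¹(h₁)`, which follow from the antipode axioms because `S` is injective and reverses
products. -/
theorem IsYetterDrinfeld.bijective_naturalBraiding (h : IsYetterDrinfeld α ρ)
    (hS : Function.Bijective (HopfAlgebra.antipode K : H →ₗ[K] H)) :
    Function.Bijective (naturalBraiding α ρ) := by
  let e : H ≃ₗ[K] H := LinearEquiv.ofBijective (HopfAlgebra.antipode K) hS
  have he : ∀ x, HopfAlgebra.antipode K (e.symm x) = x := e.apply_symm_apply
  have h1 : ∀ x : H, LinearMap.mul' K H (TensorProduct.comm K H H
      (TensorProduct.map LinearMap.id e.symm.toLinearMap (Coalgebra.comul (R := K) x))) =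
        algebraMap K H (Coalgebra.counit (R := K) x) := by
    intro x
    apply hS.1
    rw [Algebra.algebraMap_eq_smul_one, map_smul, HopfAlgebra.antipode_one,
      ← Algebra.algebraMap_eq_smul_one, ← HopfAlgebra.mul_antipode_rTensor_comul_apply]
    induction (Coalgebra.comul (R := K) x) using TensorProduct.induction_on with
    | zero => simp
    | tmul a b => simp [HopfAlgebra.antipode_mul_antidistrib, he]
    | add x y hx hy => simp only [map_add, hx, hy]
  have h2 : ∀ x : H, LinearMap.mul' K H (TensorProduct.comm K H H
      (TensorProduct.map e.symm.toLinearMap LinearMap.id (Coalgebra.comul (R := K) x))) =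
        algebraMap K H (Coalgebra.counit (R := K) x) := by
    intro x
    apply hS.1
    rw [Algebra.algebraMap_eq_smul_one, map_smul, HopfAlgebra.antipode_one,
      ← Algebra.algebraMap_eq_smul_one, ← HopfAlgebra.mul_antipode_lTensor_comul_apply]
    induction (Coalgebra.comul (R := K) x) using TensorProduct.induction_on with
    | zero => simp
    | tmul a b => simp [HopfAlgebra.antipode_mul_antidistrib, he]
    | add x y hx hy => simp only [map_add, hx, hy]
  have hid : naturalBraiding α ρ = crossing (α ∘ₗ (LinearMap.id : H →ₗ[K] H).rTensor V) ρ := by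
    rw [LinearMap.rTensor_id, LinearMap.comp_id, naturalBraiding_eq_crossing]
  rw [hid]
  let c := crossing (α ∘ₗ e.symm.toLinearMap.rTensor V) ρ
  let F := TensorProduct.comm K V V
  refine Function.bijective_iff_has_inverse.mpr ⟨fun t => F (c (F t)), fun t => ?_, fun t => ?_⟩
  · induction t using TensorProduct.induction_on with
    | zero => simp
    | tmul v w => simp only [c, F, crossing_comm_crossing h h1, TensorProduct.comm_tmul]
    | add x y hx hy => simp_all only [map_add]
  · induction t using TensorProduct.induction_on with
    | zero => simp
    | tmul v w =>
      simp only [c, F, TensorProduct.comm_tmul]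
      exact crossing_comm_crossing h h2 w v
    | add x y hx hy => simp_all only [map_add]

theorem IsYetterDrinfeld.isBraiding (h : IsYetterDrinfeld α ρ)
    (hS : Function.Bijective (HopfAlgebra.antipode K : H →ₗ[K] H)) :
    IsBraiding (naturalBraiding α ρ) :=
  ⟨h.bijective_naturalBraiding hS, h.yang_baxter⟩

end Crossing

/-! ### Algebras and coalgebras in the category of Yetter-Drinfel'd modules -/

section YBStructures

variable {K H A : Type*} [CommRing K] [Ring H] [HopfAlgebra K H]

/-- An algebra in the category of Yetter-Drinfel'd modules is a YB algebra. -/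
theorem IsYetterDrinfeld.isYBAlgebra [Ring A] [Algebra K A] {α : H ⊗[K] A →ₗ[K] A}
    {ρ : A →ₗ[K] H ⊗[K] A} (h : IsYetterDrinfeld α ρ)
    (hS : Function.Bijective (HopfAlgebra.antipode K : H →ₗ[K] H))
    (act_one : ∀ g : H, α (g ⊗ₜ 1) = Coalgebra.counit (R := K) g • (1 : A))
    (act_mul : LinearMap.mul' K A ∘ₗ tensorAction α α = α ∘ₗ (LinearMap.mul' K A).lTensor H)
    (coact_one : ρ 1 = 1 ⊗ₜ 1)
    (coact_mul : ρ ∘ₗ LinearMap.mul' K A = (LinearMap.mul' K A).lTensor H ∘ₗ tensorCoaction ρ ρ) :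
    IsYBAlgebra (naturalBraiding α ρ) where
  braiding := h.isBraiding hS
  mul_left := by
    -- The hexagon identity turns `σ₁ σ₂` into the crossing for the coaction of `A ⊗ A`; what
    -- remains is naturality along the multiplication, which is colinear. In `mul_right` the
    -- multiplication is used as a linear map in the same way.
    rw [braid₁_braid₂ h.mul_act, naturalBraiding_eq_crossing, crossing_naturality_left _ coact_mul]
    ext
    simp
  mul_right := by
    rw [braid₂_braid₁ h.coassoc, naturalBraiding_eq_crossing, ← LinearMap.comp_assoc,
      crossing_naturality_right act_mul, LinearMap.comp_assoc]
  one_left a := by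
    rw [naturalBraiding_eq_crossing, crossing_tmul, coact_one]
    simp [h.one_act]
  one_right a := by
    rw [naturalBraiding_eq_crossing, crossing_tmul]
    have h1 : ∀ z : H ⊗[K] A, (actOn α 1).rTensor A z =
        1 ⊗ₜ TensorProduct.lid K A ((Coalgebra.counit (R := K) (A := H)).rTensor A z) := by
      intro z
      induction z using TensorProduct.induction_on with
      | zero => simp
      | tmul a x => simp [act_one, TensorProduct.smul_tmul]
      | add x y hx hy => simp_all [TensorProduct.tmul_add]
    rw [h1, h.counit_coact]

/-- A coalgebra in the category of Yetter-Drinfel'd modules is a YB coalgebra. -/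
theorem IsYetterDrinfeld.isYBCoalgebra [AddCommGroup A] [Module K A] [Coalgebra K A]
    {α : H ⊗[K] A →ₗ[K] A} {ρ : A →ₗ[K] H ⊗[K] A} (h : IsYetterDrinfeld α ρ)
    (hS : Function.Bijective (HopfAlgebra.antipode K : H →ₗ[K] H))
    (counit_act : ∀ (g : H) (a : A), Coalgebra.counit (R := K) (α (g ⊗ₜ a)) =
      Coalgebra.counit (R := K) g * Coalgebra.counit (R := K) a)
    (comul_act : Coalgebra.comul (R := K) ∘ₗ α =
      tensorAction α α ∘ₗ (Coalgebra.comul (R := K) (A := A)).lTensor H)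
    (coact_counit : ∀ a : A, TensorProduct.rid K H
      ((Coalgebra.counit (R := K) (A := A)).lTensor H (ρ a)) =
        Coalgebra.counit (R := K) a • (1 : H))
    (coact_comul : tensorCoaction ρ ρ ∘ₗ Coalgebra.comul (R := K) =
      (Coalgebra.comul (R := K) (A := A)).lTensor H ∘ₗ ρ) :
    IsYBCoalgebra (naturalBraiding α ρ) where
  braiding := h.isBraiding hS
  comul_left := by
    -- Dual to the algebra case: naturality is applied along the coproduct.
    rw [← LinearMap.comp_assoc, braid₁_braid₂ h.mul_act, naturalBraiding_eq_crossing,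
      LinearMap.comp_assoc, crossing_naturality_left _ coact_comul]
  comul_right := by
    rw [← LinearMap.comp_assoc, braid₂_braid₁ h.coassoc, naturalBraiding_eq_crossing,
      ← crossing_naturality_right comul_act]
    ext
    simp
  counit_left x y := by
    rw [naturalBraiding_eq_crossing, crossing_tmul]
    have h1 : ∀ z : H ⊗[K] A, TensorProduct.rid K A ((Coalgebra.counit (R := K) (A := A)).lTensor A
        ((actOn α y).rTensor A z)) = α (TensorProduct.rid K H
          ((Coalgebra.counit (R := K) (A := A)).lTensor H z) ⊗ₜ y) := by
      intro z
      induction z using TensorProduct.induction_on with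
      | zero => simp
      | tmul a x =>
        simp only [LinearMap.rTensor_tmul, actOn_apply, LinearMap.lTensor_tmul,
          TensorProduct.rid_tmul]
        rw [← TensorProduct.smul_tmul', map_smul]
      | add x y hx hy => simp_all [TensorProduct.add_tmul]
    rw [h1, coact_counit, ← TensorProduct.smul_tmul', map_smul, h.one_act]
  counit_right x y := by
    rw [naturalBraiding_eq_crossing, crossing_tmul]
    have h1 : ∀ z : H ⊗[K] A, TensorProduct.lid K A ((Coalgebra.counit (R := K) (A := A)).rTensor A
        ((actOn α y).rTensor A z)) = Coalgebra.counit (R := K) y •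
          TensorProduct.lid K A ((Coalgebra.counit (R := K) (A := H)).rTensor A z) := by
      intro z
      induction z using TensorProduct.induction_on with
      | zero => simp
      | tmul a x => simp [counit_act, smul_smul, mul_comm]
      | add x y hx hy => simp_all
    rw [h1, h.counit_coact]

end YBStructures

end YangBaxter

namespace YangBaxter

open WithConv

/-! ### Convolution algebras as a calculus for Sweedler sums -/

section Convolution

variable {K C D R R' : Type*} [CommRing K] [AddCommGroup C] [Module K C] [Coalgebra K C]
  [AddCommGroup D] [Module K D] [Coalgebra K D]
  [Ring R] [Algebra K R] [Ring R'] [Algebra K R']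

/-- This converts a Sweedler sum into a product in the convolution algebra, given its shape on pure
tensors. After the conversion, associativity and inverses of a ring replace the handling of indices.
-/
theorem apply_comul_eq_conv {f g : WithConv (C →ₗ[K] R)} {F : C ⊗[K] C →ₗ[K] R}
    (h : ∀ a b, F (a ⊗ₜ b) = f a * g b) (c : C) : F (Coalgebra.comul c) = (f * g) c := by
  have hF : F = LinearMap.mul' K R ∘ₗ TensorProduct.map f.ofConv g.ofConv :=
    TensorProduct.ext' fun a b => by simpa using h a b
  rw [hF, LinearMap.convMul_apply, LinearMap.comp_apply]

theorem apply_comul_comul_eq_conv {f g k : WithConv (C →ₗ[K] R)} {F : (C ⊗[K] C) ⊗[K] C →ₗ[K] R}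
    (h : ∀ a b d, F ((a ⊗ₜ b) ⊗ₜ d) = f a * g b * k d) (c : C) :
    F ((Coalgebra.comul (R := K)).rTensor C (Coalgebra.comul c)) = (f * g * k) c := by
  rw [← LinearMap.comp_apply F]
  refine apply_comul_eq_conv (fun a b => ?_) c
  simp only [LinearMap.comp_apply, LinearMap.rTensor_tmul]
  rw [LinearMap.convMul_apply]
  induction (Coalgebra.comul (R := K) a) using TensorProduct.induction_on with
  | zero => simp
  | tmul x y => simpa using h x y b
  | add x y hx hy => simp_all [TensorProduct.add_tmul, add_mul]

/-- `L` has to respect only the products `f a * g b`, so multiplication by a fixed element is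
allowed as well as algebra homomorphisms. -/
theorem map_conv {f g : WithConv (C →ₗ[K] R)} {f' g' : WithConv (C →ₗ[K] R')} (L : R →ₗ[K] R')
    (h : ∀ a b, L (f a * g b) = f' a * g' b) (c : C) : L ((f * g) c) = (f' * g') c := by
  rw [LinearMap.convMul_apply, ← LinearMap.comp_apply L, ← LinearMap.comp_apply (L ∘ₗ _)]
  exact apply_comul_eq_conv (by simpa using h) c

theorem map_conv₃ {f g k : WithConv (C →ₗ[K] R)} {f' g' k' : WithConv (C →ₗ[K] R')}
    (L : R →ₗ[K] R') (h : ∀ a b d, L (f a * g b * k d) = f' a * g' b * k' d) (c : C) :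
    L ((f * g * k) c) = (f' * g' * k') c := by
  have h1 : ∀ c, (f * g * k) c = (LinearMap.mul' K R ∘ₗ
    TensorProduct.map (LinearMap.mul' K R ∘ₗ TensorProduct.map f.ofConv g.ofConv) k.ofConv)
    ((Coalgebra.comul (R := K)).rTensor C (Coalgebra.comul c)) :=
    fun c => (apply_comul_comul_eq_conv (by simp) c).symm
  rw [h1, ← LinearMap.comp_apply L]
  exact apply_comul_comul_eq_conv (by simpa using h) c

/-- The map `c ↦ ε(c) x`. -/
def convConst (K C : Type*) {R : Type*} [CommRing K] [AddCommGroup C] [Module K C] [Coalgebra K C]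
    [Ring R] [Algebra K R] (x : R) : WithConv (C →ₗ[K] R) :=
  toConv ((Coalgebra.counit (R := K) (A := C)).smulRight x)

theorem convConst_apply (x : R) (c : C) :
    convConst K C x c = Coalgebra.counit (R := K) c • x := rfl

@[simp]
theorem convConst_one : convConst K C (1 : R) = 1 := by
  ext c
  simp [convConst, Algebra.algebraMap_eq_smul_one]

theorem mul_convConst_apply (f : WithConv (C →ₗ[K] R)) (x : R) (c : C) :
    (f * convConst K C x) c = f c * x := by
  conv_rhs => rw [← mul_one f]
  refine (map_conv (LinearMap.mulRight K x) (fun a b => ?_) c).symm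
  simp [convConst_apply, Algebra.algebraMap_eq_smul_one]

theorem convConst_mul_apply (f : WithConv (C →ₗ[K] R)) (x : R) (c : C) :
    (convConst K C x * f) c = x * f c := by
  conv_rhs => rw [← one_mul f]
  refine (map_conv (LinearMap.mulLeft K x) (fun a b => ?_) c).symm
  simp [convConst_apply, Algebra.algebraMap_eq_smul_one]

theorem convConst_mul (x y : R) : convConst K C (x * y) = convConst K C x * convConst K C y := by
  ext c
  rw [mul_convConst_apply]
  simp [convConst]

/-- Constants `ε(·) x` are how a fixed element is placed between two legs of a coproduct. They can
be moved past `f` without any cocommutativity, as the counit absorbs their leg. -/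
theorem conv_commute {f : WithConv (C →ₗ[K] R)} {x : R} (hf : ∀ c, f c * x = x * f c) :
    f * convConst K C x = convConst K C x * f := by
  ext c
  rw [mul_convConst_apply, convConst_mul_apply, hf]

end Convolution

section Antipode

variable {K H C R : Type*} [CommRing K] [Ring H] [HopfAlgebra K H] [Ring R] [Algebra K R]
  [AddCommGroup C] [Module K C] [Coalgebra K C]

/-- `f` as an element of the convolution algebra of maps `C → R`, for a map `p : C → H`. -/
def convAlong (p : C →ₗc[K] H) (f : H →ₐ[K] R) : WithConv (C →ₗ[K] R) :=
  toConv (f.toLinearMap ∘ₗ (p : C →ₗ[K] H))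

/-- The convolution inverse of `f ∘ p`. -/
def convAlongInv (p : C →ₗc[K] H) (f : H →ₐ[K] R) : WithConv (C →ₗ[K] R) :=
  toConv (f.toLinearMap ∘ₗ HopfAlgebra.antipode K ∘ₗ (p : C →ₗ[K] H))

variable (p : C →ₗc[K] H) (f : H →ₐ[K] R)

@[simp]
theorem convAlong_apply (c : C) : convAlong p f c = f (p c) := rfl

@[simp]
theorem convAlongInv_apply (c : C) : convAlongInv p f c = f (HopfAlgebra.antipode K (p c)) := rfl

/-- `p` takes the coproduct of `C` to that of `H`, and `f` takes the antipode axiom of `H` to `R`.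
-/
theorem convAlong_mul_inv : convAlong p f * convAlongInv p f = 1 := by
  ext c
  have h1 : f ((LinearMap.mul' K H ∘ₗ (HopfAlgebra.antipode K).lTensor H)
      (TensorProduct.map (p : C →ₗ[K] H) (p : C →ₗ[K] H) (Coalgebra.comul (R := K) c))) =
      f (algebraMap K H (Coalgebra.counit (R := K) (p c))) := by
    rw [CoalgHomClass.map_comp_comul_apply p c]
    simp
  rw [← apply_comul_eq_conv (F := f.toLinearMap ∘ₗ (LinearMap.mul' K H ∘ₗ
    (HopfAlgebra.antipode K).lTensor H) ∘ₗ TensorProduct.map (p : C →ₗ[K] H) (p : C →ₗ[K] H))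
    (fun a b => by simp) c]
  simp

theorem convAlongInv_mul : convAlongInv p f * convAlong p f = 1 := by
  ext c
  have h1 : f ((LinearMap.mul' K H ∘ₗ (HopfAlgebra.antipode K).rTensor H)
      (TensorProduct.map (p : C →ₗ[K] H) (p : C →ₗ[K] H) (Coalgebra.comul (R := K) c))) =
      f (algebraMap K H (Coalgebra.counit (R := K) (p c))) := by
    rw [CoalgHomClass.map_comp_comul_apply p c]
    simp
  rw [← apply_comul_eq_conv (F := f.toLinearMap ∘ₗ (LinearMap.mul' K H ∘ₗ
    (HopfAlgebra.antipode K).rTensor H) ∘ₗ TensorProduct.map (p : C →ₗ[K] H) (p : C →ₗ[K] H))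
    (fun a b => by simp) c]
  simp

theorem convAlong_mul_inv_cancel (x : WithConv (C →ₗ[K] R)) :
    convAlong p f * (convAlongInv p f * x) = x := by
  rw [← mul_assoc, convAlong_mul_inv, one_mul]

theorem convAlongInv_mul_cancel (x : WithConv (C →ₗ[K] R)) :
    convAlongInv p f * (convAlong p f * x) = x := by
  rw [← mul_assoc, convAlongInv_mul, one_mul]

/-- Inverses in a monoid are unique and reverse products. Applied to a factorization of a coproduct
or of a coaction, this stands in for the anticomultiplicativity of the antipode. -/
theorem convAlongInv_eq {f g k : H →ₐ[K] R} (h : convAlong p f = convAlong p g * convAlong p k) :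
    convAlongInv p f = convAlongInv p k * convAlongInv p g := by
  refine left_inv_eq_right_inv (convAlongInv_mul p f) ?_
  rw [h, mul_assoc, convAlong_mul_inv_cancel, convAlong_mul_inv]

end Antipode

/-! ### Two Yetter-Drinfel'd structures on a Hopf algebra with a projection -/

section Projection

variable {K H A : Type*} [CommRing K] [Ring H] [HopfAlgebra K H] [Ring A] [HopfAlgebra K A]
  (i : H →ₐc[K] A) (p : A →ₐc[K] H)

/-- `a ↦ ∑ π(a₁) ⊗ a₂` as a homomorphism of algebras. -/
def leftCoactionHom : A →ₐ[K] H ⊗[K] A :=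
  (Algebra.TensorProduct.map (p : A →ₐ[K] H) (AlgHom.id K A)).comp (Bialgebra.comulAlgHom K A)

theorem leftCoactionHom_apply (a : A) : leftCoactionHom p a = leftCoaction (p : A →ₗ[K] H) a := rfl

/-- `a ↦ ∑ a₁ ⊗ π(a₂)` as a homomorphism of algebras. -/
def rightCoactionHom : A →ₐ[K] A ⊗[K] H :=
  (Algebra.TensorProduct.map (AlgHom.id K A) (p : A →ₐ[K] H)).comp (Bialgebra.comulAlgHom K A)

theorem rightCoactionHom_apply (a : A) :
    rightCoactionHom p a = (p : A →ₗ[K] H).lTensor A (Coalgebra.comul a) := rfl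

/-- Seen in the convolution algebra of maps `H → A`, the adjoint action conjugates the constant `a`
by `i`. -/
theorem adjointAction_tmul (h : H) (a : A) :
    adjointAction (i : H →ₗ[K] A) (h ⊗ₜ a) =
      (convAlong (CoalgHom.id K H) (i : H →ₐ[K] A) * convConst K H a *
        convAlongInv (CoalgHom.id K H) (i : H →ₐ[K] A)) h := by
  refine apply_comul_eq_conv (F := LinearMap.mul' K A ∘ₗ
    TensorProduct.map (LinearMap.mul' K A ∘ₗ (i : H →ₗ[K] A).rTensor A)
      ((i : H →ₗ[K] A) ∘ₗ HopfAlgebra.antipode K) ∘ₗ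
    (TensorProduct.rightComm K H H A).toLinearMap ∘ₗ
    (TensorProduct.mk K (H ⊗[K] H) A).flip a) (fun x y => ?_) h
  rw [mul_convConst_apply]
  simp

/-- The action `h · a = i(h) a`. -/
def mulAction (i : H →ₗ[K] A) : H ⊗[K] A →ₗ[K] A := LinearMap.mul' K A ∘ₗ i.rTensor A

/-- The left coaction `a ↦ ∑ π(a₁) S(π(a₃)) ⊗ a₂`. -/
def conjCoaction : A →ₗ[K] H ⊗[K] A :=
  (convAlong (p : A →ₗc[K] H) (Algebra.TensorProduct.includeLeft : H →ₐ[K] H ⊗[K] A) *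
    toConv (Algebra.TensorProduct.includeRight : A →ₐ[K] H ⊗[K] A).toLinearMap *
    convAlongInv (p : A →ₗc[K] H) (Algebra.TensorProduct.includeLeft : H →ₐ[K] H ⊗[K] A)).ofConv

end Projection

end YangBaxter

namespace YangBaxter

open WithConv Algebra.TensorProduct

section Projection

variable {K H A : Type*} [CommRing K] [Ring H] [HopfAlgebra K H] [Ring A] [HopfAlgebra K A]
  {i : H →ₐc[K] A} {p : A →ₐc[K] H}

theorem leftCoactionHom_conv :
    toConv (leftCoactionHom p).toLinearMap =
      convAlong (p : A →ₗc[K] H) (includeLeft : H →ₐ[K] H ⊗[K] A) *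
        toConv (includeRight : A →ₐ[K] H ⊗[K] A).toLinearMap := by
  ext a
  refine apply_comul_eq_conv
    (F := ((Algebra.TensorProduct.map (p : A →ₐ[K] H) (AlgHom.id K A))).toLinearMap)
    (fun x y => ?_) a
  simp

/-- On the image of `i` the coaction is `i(h) ↦ ∑ h₁ ⊗ i(h₂)`, because `i` is a coalgebra map and `p
∘ i = id`. -/
theorem leftCoactionHom_comp_conv (hp : ∀ h, p (i h) = h) :
    convAlong (.id K H) ((leftCoactionHom p).comp (i : H →ₐ[K] A)) =
      convAlong (.id K H) (includeLeft : H →ₐ[K] H ⊗[K] A) *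
        convAlong (.id K H) ((includeRight : A →ₐ[K] H ⊗[K] A).comp (i : H →ₐ[K] A)) := by
  ext h
  have h1 : convAlong (.id K H) ((leftCoactionHom p).comp (i : H →ₐ[K] A)) h =
    leftCoactionHom p (i h) := rfl
  rw [h1, leftCoactionHom_apply, leftCoaction, LinearMap.comp_apply,
    ← CoalgHomClass.map_comp_comul_apply i h, ← LinearMap.comp_apply]
  refine apply_comul_eq_conv (fun x y => ?_) h
  simp [hp]

theorem rightCoactionHom_comp_conv (hp : ∀ h, p (i h) = h) :
    convAlong (.id K H) ((rightCoactionHom p).comp (i : H →ₐ[K] A)) =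
      convAlong (.id K H) ((includeLeft : A →ₐ[K] A ⊗[K] H).comp (i : H →ₐ[K] A)) *
        convAlong (.id K H) (includeRight : H →ₐ[K] A ⊗[K] H) := by
  ext h
  have h1 : convAlong (.id K H) ((rightCoactionHom p).comp (i : H →ₐ[K] A)) h =
    rightCoactionHom p (i h) := rfl
  rw [h1, rightCoactionHom_apply, ← CoalgHomClass.map_comp_comul_apply i h,
    ← LinearMap.comp_apply]
  refine apply_comul_eq_conv (fun x y => ?_) h
  simp [hp]

theorem actOn_adjointAction (a : A) :
    toConv (actOn (adjointAction (i : H →ₗ[K] A)) a) =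
      convAlong (.id K H) (i : H →ₐ[K] A) * convConst K H a *
        convAlongInv (.id K H) (i : H →ₐ[K] A) := by
  ext h
  exact adjointAction_tmul i h a

theorem lTensor_mul'_tensorCoaction (ρ : A →ₗ[K] H ⊗[K] A) (a b : A) :
    (LinearMap.mul' K A).lTensor H (tensorCoaction ρ ρ (a ⊗ₜ b)) = ρ a * ρ b := by
  simp only [tensorCoaction, LinearMap.comp_apply, TensorProduct.map_tmul]
  induction ρ a using TensorProduct.induction_on with
  | zero => simp
  | tmul h x =>
    induction ρ b using TensorProduct.induction_on with
    | zero => simp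
    | tmul h x => simp
    | add x y hx hy => simp_all [mul_add, TensorProduct.tmul_add]
  | add x y hx hy => simp_all [add_mul, TensorProduct.add_tmul]

theorem leftCoaction_coassoc :
    (TensorProduct.assoc K H H A).toLinearMap ∘ₗ
      (Coalgebra.comul (R := K) (A := H)).rTensor A ∘ₗ leftCoaction (p : A →ₗ[K] H) =
      (leftCoaction (p : A →ₗ[K] H)).lTensor H ∘ₗ leftCoaction (p : A →ₗ[K] H) := by
  have h1 : (leftCoaction (p : A →ₗ[K] H)).lTensor H ∘ₗ (p : A →ₗ[K] H).rTensor A =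
      TensorProduct.map (p : A →ₗ[K] H) ((p : A →ₗ[K] H).rTensor A) ∘ₗ
        (Coalgebra.comul (R := K)).lTensor A := by
    ext a b
    simp [leftCoaction]
  have h2 : (Coalgebra.comul (R := K) (A := H)).rTensor A ∘ₗ (p : A →ₗ[K] H).rTensor A =
      (TensorProduct.map (p : A →ₗ[K] H) (p : A →ₗ[K] H)).rTensor A ∘ₗ
        (Coalgebra.comul (R := K) (A := A)).rTensor A := by
    rw [← LinearMap.rTensor_comp, ← LinearMap.rTensor_comp]
    congr 1
    exact (CoalgHomClass.map_comp_comul p).symm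
  ext a
  have h3 := Coalgebra.coassoc_apply (R := K) a
  have h4 := LinearMap.congr_fun h1 (Coalgebra.comul (R := K) a)
  have h5 := LinearMap.congr_fun h2 (Coalgebra.comul (R := K) a)
  simp only [LinearMap.comp_apply] at h4 h5
  conv_lhs => simp only [leftCoaction, LinearMap.comp_apply]
  have h6 : leftCoaction (p : A →ₗ[K] H) a =
    (p : A →ₗ[K] H).rTensor A (Coalgebra.comul (R := K) a) := rfl
  rw [LinearMap.comp_apply, h6, h4, h5, ← h3]
  induction (Coalgebra.comul (R := K)).rTensor A (Coalgebra.comul (R := K) a)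
    using TensorProduct.induction_on with
  | zero => simp
  | tmul x y =>
    induction x using TensorProduct.induction_on with
    | zero => simp
    | tmul x z => simp
    | add x y hx hy => simp_all [TensorProduct.add_tmul]
  | add x y hx hy => simp_all

/-- The coaction is an algebra homomorphism, so it sends `h · v` to the conjugate of the coaction of
`v` by `J = ι₁ * ι₂`, where `ι₁` is `h ↦ h ⊗ 1` and `ι₂` is `h ↦ 1 ⊗ i(h)`. The extra factor of `H`
on the right of the compatibility axiom is a further `ι₁`, and `J⁻¹ * ι₁ = ι₂⁻¹`. Only a conjugation
by `ι₂` is left, that is, the adjoint action on the second factor. -/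
theorem isYetterDrinfeld_adjointAction (hp : ∀ h, p (i h) = h) :
    IsYetterDrinfeld (adjointAction (i : H →ₗ[K] A)) (leftCoaction (p : A →ₗ[K] H)) where
  one_act v := by
    simp [adjointAction, Algebra.TensorProduct.one_def]
  mul_act g h v := by
    simp only [adjointAction, LinearMap.comp_apply, LinearMap.rTensor_tmul,
      Bialgebra.comul_mul]
    induction (Coalgebra.comul (R := K) h) using TensorProduct.induction_on with
    | zero => simp
    | tmul a b =>
      induction (Coalgebra.comul (R := K) g) using TensorProduct.induction_on with
      | zero => simp
      | tmul c d => simp [HopfAlgebra.antipode_mul_antidistrib, mul_assoc]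
      | add x y hx hy => simp_all [add_mul, TensorProduct.add_tmul]
    | add x y hx hy => simp_all [mul_add, TensorProduct.add_tmul, TensorProduct.tmul_add]
  counit_coact v := by
    have h1 : (Coalgebra.counit (R := K) (A := H)) ∘ₗ (p : A →ₗ[K] H) = Coalgebra.counit (R := K) :=
      CoalgHomClass.counit_comp p
    simp only [leftCoaction, LinearMap.comp_apply]
    rw [← LinearMap.comp_apply, ← LinearMap.rTensor_comp, h1, Coalgebra.rTensor_counit_comul]
    simp
  coassoc := leftCoaction_coassoc
  compat := by
    refine TensorProduct.ext' fun g v => ?_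
    let ι₁ := convAlong (.id K H) (includeLeft : H →ₐ[K] H ⊗[K] A)
    let ι₂ := convAlong (.id K H) ((includeRight : A →ₐ[K] H ⊗[K] A).comp (i : H →ₐ[K] A))
    let ι₂' := convAlongInv (.id K H) ((includeRight : A →ₐ[K] H ⊗[K] A).comp (i : H →ₐ[K] A))
    let J := convAlong (.id K H) ((leftCoactionHom p).comp (i : H →ₐ[K] A))
    let J' := convAlongInv (.id K H) ((leftCoactionHom p).comp (i : H →ₐ[K] A))
    have hJ : J = ι₁ * ι₂ := leftCoactionHom_comp_conv hp
    have hJ' : J' * ι₁ = ι₂' := by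
      have h1 : ι₁ = J * ι₂' := by
        rw [hJ, mul_assoc, convAlong_mul_inv, mul_one]
      rw [h1, convAlongInv_mul_cancel]
    have hr : ∀ h, leftCoaction (p : A →ₗ[K] H) (adjointAction (i : H →ₗ[K] A) (h ⊗ₜ v)) =
        (J * convConst K H (leftCoaction (p : A →ₗ[K] H) v) * J') h := by
      intro h
      rw [adjointAction_tmul, ← leftCoactionHom_apply]
      refine map_conv₃ (leftCoactionHom p).toLinearMap (fun a b d => ?_) h
      simp [convConst_apply, J, J', ← leftCoactionHom_apply]
    have hrhs : ((LinearMap.mul' K H).rTensor A ∘ₗ (TensorProduct.rightComm K H A H).toLinearMap ∘ₗ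
        (leftCoaction (p : A →ₗ[K] H) ∘ₗ adjointAction (i : H →ₗ[K] A)).rTensor H ∘ₗ
        (TensorProduct.rightComm K H H A).toLinearMap ∘ₗ
        (Coalgebra.comul (R := K) (A := H)).rTensor A) (g ⊗ₜ v) =
        (J * convConst K H (leftCoaction (p : A →ₗ[K] H) v) * J' * ι₁) g := by
      refine apply_comul_eq_conv (F := (LinearMap.mul' K H).rTensor A ∘ₗ
        (TensorProduct.rightComm K H A H).toLinearMap ∘ₗ
        (leftCoaction (p : A →ₗ[K] H) ∘ₗ adjointAction (i : H →ₗ[K] A)).rTensor H ∘ₗ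
        (TensorProduct.rightComm K H H A).toLinearMap ∘ₗ
        (TensorProduct.mk K (H ⊗[K] H) A).flip v) (fun a b => ?_) g
      rw [← hr]
      simp only [LinearMap.comp_apply, LinearMap.flip_apply, TensorProduct.mk_apply,
        LinearEquiv.coe_coe, TensorProduct.rightComm_tmul, LinearMap.rTensor_tmul]
      induction leftCoaction (p : A →ₗ[K] H) (adjointAction (i : H →ₗ[K] A) (a ⊗ₜ v))
        using TensorProduct.induction_on with
      | zero => simp
      | tmul x y => simp [ι₁]
      | add x y hx hy => simp_all [TensorProduct.add_tmul, add_mul]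
    rw [hrhs, mul_assoc _ J', hJ', hJ]
    simp only [LinearMap.comp_apply, TensorProduct.map_tmul]
    generalize leftCoaction (p : A →ₗ[K] H) v = t
    induction t using TensorProduct.induction_on with
    | zero => simp [convConst]
    | tmul c x =>
      -- The two tensor factors of `H ⊗ A` commute, so `c ⊗ 1` can be moved to the left of `ι₂`,
      -- leaving the conjugate of `1 ⊗ x` by `ι₂`.
      have hcx : (c ⊗ₜ[K] x : H ⊗[K] A) = (c ⊗ₜ 1) * (1 ⊗ₜ x) := by simp
      have hcomm : ι₂ * convConst K H (c ⊗ₜ 1) = convConst K H (c ⊗ₜ 1) * ι₂ :=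
        conv_commute fun h => by simp [ι₂]
      rw [hcx, convConst_mul, mul_assoc ι₁, ← mul_assoc ι₂, hcomm, mul_assoc ι₁, mul_assoc _ ι₂]
      refine apply_comul_eq_conv (F := TensorProduct.map (LinearMap.mul' K H)
        (adjointAction (i : H →ₗ[K] A)) ∘ₗ
        (TensorProduct.tensorTensorTensorComm K H H H A).toLinearMap ∘ₗ
        (TensorProduct.mk K (H ⊗[K] H) (H ⊗[K] A)).flip _) (fun a b => ?_) g
      rw [mul_assoc, convConst_mul_apply]
      have h2 : (ι₂ * convConst K H (1 ⊗ₜ[K] x : H ⊗[K] A) * ι₂') b =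
          includeRight (adjointAction (i : H →ₗ[K] A) (b ⊗ₜ x)) := by
        rw [adjointAction_tmul]
        refine (map_conv₃ (includeRight : A →ₐ[K] H ⊗[K] A).toLinearMap (fun a b d => ?_) b).symm
        simp [convConst_apply, ι₂, ι₂']
      rw [h2]
      simp [ι₁]
    | add x y hx hy =>
      have h3 : convConst K H (x + y) = convConst K H x + convConst K H y := by
        ext; simp [convConst]
      rw [h3, mul_add, add_mul, ofConv_add, LinearMap.add_apply, ← hx, ← hy]
      simp [TensorProduct.tmul_add]

end Projection

end YangBaxter

namespace YangBaxter

open WithConv Algebra.TensorProduct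

section Projection

variable {K H A : Type*} [CommRing K] [Ring H] [HopfAlgebra K H] [Ring A] [HopfAlgebra K A]
  {i : H →ₐc[K] A} {p : A →ₐc[K] H}

/-- `A` is an algebra in the Yetter-Drinfel'd category: conjugation by `i` is multiplicative because
the inner `i(S(h₂)) i(h₃)` cancels, and the coaction is an algebra homomorphism. -/
theorem isYBAlgebra_adjointAction (hp : ∀ h, p (i h) = h)
    (hS : Function.Bijective (HopfAlgebra.antipode K : H →ₗ[K] H)) :
    IsYBAlgebra (naturalBraiding (adjointAction (i : H →ₗ[K] A)) (leftCoaction (p : A →ₗ[K] H))) := by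
  refine (isYetterDrinfeld_adjointAction hp).isYBAlgebra hS (fun g => ?_) ?_ ?_ ?_
  · rw [adjointAction_tmul, convConst_one, mul_one, convAlong_mul_inv]
    simp [Algebra.algebraMap_eq_smul_one]
  · ext g a b
    simp only [TensorProduct.AlgebraTensorModule.curry_apply, LinearMap.restrictScalars_self,
      TensorProduct.curry_apply, LinearMap.comp_apply, LinearMap.lTensor_tmul,
      LinearMap.mul'_apply]
    have h1 : LinearMap.mul' K A (tensorAction (adjointAction (i : H →ₗ[K] A))
        (adjointAction (i : H →ₗ[K] A)) (g ⊗ₜ (a ⊗ₜ b))) =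
        (toConv (actOn (adjointAction (i : H →ₗ[K] A)) a) *
          toConv (actOn (adjointAction (i : H →ₗ[K] A)) b)) g := by
      refine apply_comul_eq_conv (F := LinearMap.mul' K A ∘ₗ TensorProduct.map _ _ ∘ₗ
        (TensorProduct.tensorTensorTensorComm K H H A A).toLinearMap ∘ₗ
        (TensorProduct.mk K (H ⊗[K] H) (A ⊗[K] A)).flip (a ⊗ₜ b)) (fun x y => ?_) g
      simp
    rw [h1, adjointAction_tmul, actOn_adjointAction, actOn_adjointAction, convConst_mul]
    congr 2
    simp only [mul_assoc, convAlongInv_mul_cancel]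
  · rw [← leftCoactionHom_apply, map_one, Algebra.TensorProduct.one_def]
  · ext a b
    simp only [TensorProduct.AlgebraTensorModule.curry_apply, LinearMap.restrictScalars_self,
      TensorProduct.curry_apply, LinearMap.comp_apply, LinearMap.mul'_apply]
    rw [lTensor_mul'_tensorCoaction, ← leftCoactionHom_apply, map_mul]
    rfl

/-- This coaction is not claimed to be multiplicative. Since `S` reverses products, the whole
coaction of `y` ends up between `p(x₁) ⊗ x₂` and `S(p(x₃)) ⊗ 1`. The cases needed later are `x =
i(h)` and `x` coinvariant. -/
theorem conjCoaction_mul (x y : A) :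
    conjCoaction p (x * y) = (toConv (leftCoactionHom p).toLinearMap *
      convConst K A (conjCoaction p y) *
      convAlongInv (p : A →ₗc[K] H) (includeLeft : H →ₐ[K] H ⊗[K] A)) x := by
  let P := convAlong (p : A →ₗc[K] H) (includeLeft : H →ₐ[K] H ⊗[K] A)
  let P' := convAlongInv (p : A →ₗc[K] H) (includeLeft : H →ₐ[K] H ⊗[K] A)
  let I := toConv (includeRight : A →ₐ[K] H ⊗[K] A).toLinearMap
  let F : (A ⊗[K] A) ⊗[K] A →ₗ[K] H ⊗[K] A := LinearMap.mul' K (H ⊗[K] A) ∘ₗ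
    TensorProduct.map (LinearMap.mul' K (H ⊗[K] A) ∘ₗ TensorProduct.map P.ofConv I.ofConv) P'.ofConv
  have hF : ∀ a, conjCoaction p a =
      F ((Coalgebra.comul (R := K)).rTensor A (Coalgebra.comul a)) := fun a =>
    (apply_comul_comul_eq_conv (f := P) (g := I) (k := P') (fun _ _ _ => by simp [F]) a).symm
  -- The iterated coproduct is an algebra homomorphism. Hence both sides become bilinear expressions
  -- in `Δ₃ x` and `Δ₃ y`, which can be compared on pure tensors.
  let Δ₃ : A →ₐ[K] (A ⊗[K] A) ⊗[K] A :=
    (Algebra.TensorProduct.map (Bialgebra.comulAlgHom K A) (AlgHom.id K A)).comp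
      (Bialgebra.comulAlgHom K A)
  have hΔ : ∀ a : A, (Coalgebra.comul (R := K)).rTensor A (Coalgebra.comul a) = Δ₃ a :=
    fun _ => rfl
  rw [leftCoactionHom_conv, mul_assoc (P * I)]
  have h1 : (P * I * (convConst K A (conjCoaction p y) * P')) x =
      (LinearMap.mul' K (H ⊗[K] A) ∘ₗ TensorProduct.map (LinearMap.mul' K (H ⊗[K] A) ∘ₗ
        TensorProduct.map P.ofConv I.ofConv)
        (LinearMap.mulLeft K (conjCoaction p y) ∘ₗ P'.ofConv)) (Δ₃ x) := by
    rw [← hΔ]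
    refine (apply_comul_comul_eq_conv (fun _ _ _ => ?_) x).symm
    rw [convConst_mul_apply]
    simp
  rw [h1, hF, hF, hΔ, hΔ, map_mul]
  induction Δ₃ y using TensorProduct.induction_on with
  | zero => simp
  | tmul y c' =>
    induction y using TensorProduct.induction_on with
    | zero => simp
    | tmul a' b' =>
      induction Δ₃ x using TensorProduct.induction_on with
      | zero => simp
      | tmul x c =>
        induction x using TensorProduct.induction_on with
        | zero => simp
        | tmul a b =>
          simp [F, P, P', I, HopfAlgebra.antipode_mul_antidistrib, mul_assoc]
        | add x y hx hy => simp_all [TensorProduct.add_tmul, add_mul]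
      | add x y hx hy => simp_all [add_mul]
    | add x y hx hy =>
      have h2 : ∀ a b : H ⊗[K] A, LinearMap.mulLeft K (a + b) =
        LinearMap.mulLeft K a + LinearMap.mulLeft K b := fun a b => by ext; simp [add_mul]
      simp only [TensorProduct.add_tmul, mul_add, map_add, hx, hy, h2, LinearMap.add_comp,
        TensorProduct.map_add_right, LinearMap.comp_add, LinearMap.add_apply]
  | add x y hx hy =>
    have h2 : ∀ a b : H ⊗[K] A, LinearMap.mulLeft K (a + b) =
      LinearMap.mulLeft K a + LinearMap.mulLeft K b := fun a b => by ext; simp [add_mul]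
    simp only [mul_add, map_add, hx, hy, h2, LinearMap.add_comp,
      TensorProduct.map_add_right, LinearMap.comp_add, LinearMap.add_apply]

theorem convAlong_apply_map {C : Type*} [AddCommGroup C] [Module K C] [Coalgebra K C]
    {R : Type*} [Ring R] [Algebra K R] (q : C →ₗc[K] A) (x : WithConv (A →ₗ[K] R))
    (y : WithConv (A →ₗ[K] R)) (c : C) :
    (x * y) (q c) = (toConv (x.ofConv ∘ₗ (q : C →ₗ[K] A)) *
      toConv (y.ofConv ∘ₗ (q : C →ₗ[K] A))) c :=
  LinearMap.congr_fun (LinearMap.convMul_comp_coalgHom_distrib x y q) c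

theorem conjCoaction_map_mul (hp : ∀ h, p (i h) = h) (h : H) (y : A) :
    conjCoaction p (i h * y) = (convAlong (.id K H) (includeLeft : H →ₐ[K] H ⊗[K] A) *
        convAlong (.id K H) ((includeRight : A →ₐ[K] H ⊗[K] A).comp (i : H →ₐ[K] A)) *
        convConst K H (conjCoaction p y) *
        convAlongInv (.id K H) (includeLeft : H →ₐ[K] H ⊗[K] A)) h := by
  rw [conjCoaction_mul, ← leftCoactionHom_comp_conv hp]
  refine (convAlong_apply_map (i : H →ₗc[K] A) _ _ h).trans ?_
  congr 2
  · refine congrArg₂ _ ?_ ?_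
    · ext x
      rw [ofConv_toConv, LinearMap.comp_apply, mul_convConst_apply, mul_convConst_apply]
      rfl
    · ext x
      simp [hp]

end Projection

end YangBaxter

namespace YangBaxter

open WithConv Algebra.TensorProduct

section Projection

variable {K H A : Type*} [CommRing K] [Ring H] [HopfAlgebra K H] [Ring A] [HopfAlgebra K A]
  {i : H →ₐc[K] A} {p : A →ₐc[K] H}

theorem map_conjCoaction {R : Type*} [Ring R] [Algebra K R] (f : H ⊗[K] A →ₐ[K] R) (a : A) :
    f (conjCoaction p a) = (convAlong (p : A →ₗc[K] H) (f.comp includeLeft) *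
      toConv (f.comp includeRight).toLinearMap *
      convAlongInv (p : A →ₗc[K] H) (f.comp includeLeft)) a :=
  map_conv₃ f.toLinearMap (fun a b d => by simp only [AlgHom.toLinearMap_apply, map_mul]; rfl) a

/-- Multiplicativity of `L` is required only in the two outer legs, which makes the lemma applicable
to `id ⊗ conjCoaction`. -/
theorem map_conjCoaction' {R : Type*} [Ring R] [Algebra K R] (L : H ⊗[K] A →ₗ[K] R)
    (f : H →ₐ[K] R) (g : A →ₗ[K] R) (h : ∀ x y a, L ((x * y) ⊗ₜ a) = f x * g a * f y) (a : A) :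
    L (conjCoaction p a) = (convAlong (p : A →ₗc[K] H) f * toConv g *
      convAlongInv (p : A →ₗc[K] H) f) a :=
  map_conv₃ L (fun a b d => by simp [h]) a

/-- Let `f₁`, `f₂`, `f₃` be the three inclusions into `H ⊗ (H ⊗ A)`. Applying the coproduct of `H`
turns the conjugating map into `f₁ * f₂`, while iterating the coaction conjugates `f₃` by `f₂` and
then by `f₁`. These agree. -/
theorem conjCoaction_coassoc :
    (TensorProduct.assoc K H H A).toLinearMap ∘ₗ
      (Coalgebra.comul (R := K) (A := H)).rTensor A ∘ₗ conjCoaction p =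
      (conjCoaction p).lTensor H ∘ₗ conjCoaction p := by
  let q : A →ₗc[K] H := p
  let f₁ : H →ₐ[K] H ⊗[K] (H ⊗[K] A) := includeLeft
  let f₂ : H →ₐ[K] H ⊗[K] (H ⊗[K] A) := includeRight.comp includeLeft
  let f₃ : A →ₐ[K] H ⊗[K] (H ⊗[K] A) := includeRight.comp includeRight
  let d : H →ₐ[K] H ⊗[K] (H ⊗[K] A) := (Algebra.TensorProduct.assoc K K K H H A).toAlgHom.comp
    (includeLeft.comp (Bialgebra.comulAlgHom K H))
  have hd : convAlong q d = convAlong q f₁ * convAlong q f₂ := by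
    ext a
    have h1 : (convAlong q d) a = (Algebra.TensorProduct.assoc K K K H H A).toLinearMap
      ((TensorProduct.mk K (H ⊗[K] H) A).flip 1
        (Coalgebra.comul (R := K) (q a))) := rfl
    rw [h1, ← CoalgHomClass.map_comp_comul_apply q a]
    refine apply_comul_eq_conv
      (F := (Algebra.TensorProduct.assoc K K K H H A).toLinearMap ∘ₗ
        (TensorProduct.mk K (H ⊗[K] H) A).flip 1 ∘ₗ TensorProduct.map _ _) (fun a b => ?_) a
    simp [f₁, f₂]
  ext a
  simp only [LinearMap.comp_apply]
  rw [map_conjCoaction' ((conjCoaction p).lTensor H) f₁ (includeRight.toLinearMap ∘ₗ conjCoaction p)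
    (fun x y a => ?_)]
  · have h2 : toConv ((includeRight : H ⊗[K] A →ₐ[K] H ⊗[K] (H ⊗[K] A)).toLinearMap ∘ₗ
        conjCoaction p) = convAlong q f₂ * toConv f₃.toLinearMap * convAlongInv q f₂ := by
      ext a
      exact map_conjCoaction (includeRight : H ⊗[K] A →ₐ[K] H ⊗[K] (H ⊗[K] A)) a
    let D : H ⊗[K] A →ₐ[K] H ⊗[K] (H ⊗[K] A) :=
      (Algebra.TensorProduct.assoc K K K H H A).toAlgHom.comp
        (Algebra.TensorProduct.map (Bialgebra.comulAlgHom K H) (AlgHom.id K A))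
    have hD₁ : D.comp includeLeft = d := rfl
    have hD₂ : D.comp includeRight = f₃ := AlgHom.ext fun x => by
      simp [D, f₃, Algebra.TensorProduct.one_def]
    have h3 : (TensorProduct.assoc K H H A) ((Coalgebra.comul (R := K)).rTensor A
        (conjCoaction p a)) =
        (convAlong q d * toConv f₃.toLinearMap * convAlongInv q d) a := by
      rw [← hD₁, ← hD₂]
      exact map_conjCoaction D a
    rw [LinearEquiv.coe_coe, h3, h2, convAlongInv_eq q hd, hd]
    simp only [mul_assoc, q, f₁, f₂]
  · rw [LinearMap.lTensor_tmul]
    simp [f₁]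

/-- In the compatibility axiom the coaction of `i(h) v` ends with a factor `S(h₃)` in `H`, and the
additional factor of `H` on that side cancels it. Exactly the product of `∑ h₁ ⊗ i(h₂)` with the
coaction of `v` remains. -/
theorem isYetterDrinfeld_mulAction (hp : ∀ h, p (i h) = h) :
    IsYetterDrinfeld (mulAction (i : H →ₗ[K] A)) (conjCoaction p) where
  one_act v := by simp [mulAction]
  mul_act g h v := by simp [mulAction, mul_assoc]
  counit_coact v := by
    have h1 := map_conjCoaction (p := p) ((Algebra.TensorProduct.lid K A).toAlgHom.comp
      (Algebra.TensorProduct.map (Bialgebra.counitAlgHom K H) (AlgHom.id K A))) v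
    have h2 : convAlong (p : A →ₗc[K] H) (((Algebra.TensorProduct.lid K A).toAlgHom.comp
      (Algebra.TensorProduct.map (Bialgebra.counitAlgHom K H) (AlgHom.id K A))).comp
        includeLeft) = 1 := by
      ext a
      simp [Algebra.algebraMap_eq_smul_one]
    have h3 : convAlongInv (p : A →ₗc[K] H) (((Algebra.TensorProduct.lid K A).toAlgHom.comp
      (Algebra.TensorProduct.map (Bialgebra.counitAlgHom K H) (AlgHom.id K A))).comp
        includeLeft) = 1 := by
      ext a
      simp [Algebra.algebraMap_eq_smul_one]
    rw [h2, h3, one_mul, mul_one] at h1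
    exact h1.trans (by simp)
  coassoc := conjCoaction_coassoc
  compat := by
    refine TensorProduct.ext' fun g v => ?_
    have hrhs : ((LinearMap.mul' K H).rTensor A ∘ₗ (TensorProduct.rightComm K H A H).toLinearMap ∘ₗ
        (conjCoaction p ∘ₗ mulAction (i : H →ₗ[K] A)).rTensor H ∘ₗ
        (TensorProduct.rightComm K H H A).toLinearMap ∘ₗ
        (Coalgebra.comul (R := K) (A := H)).rTensor A) (g ⊗ₜ v) =
        (toConv (conjCoaction p ∘ₗ actOn (mulAction (i : H →ₗ[K] A)) v) *
          convAlong (.id K H) (includeLeft : H →ₐ[K] H ⊗[K] A)) g := by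
      refine apply_comul_eq_conv (F := (LinearMap.mul' K H).rTensor A ∘ₗ
        (TensorProduct.rightComm K H A H).toLinearMap ∘ₗ
        (conjCoaction p ∘ₗ mulAction (i : H →ₗ[K] A)).rTensor H ∘ₗ
        (TensorProduct.rightComm K H H A).toLinearMap ∘ₗ
        (TensorProduct.mk K (H ⊗[K] H) A).flip v) (fun a b => ?_) g
      simp only [LinearMap.comp_apply, LinearMap.flip_apply, TensorProduct.mk_apply,
        LinearEquiv.coe_coe, TensorProduct.rightComm_tmul, LinearMap.rTensor_tmul,
        actOn_apply]
      induction conjCoaction p (mulAction (i : H →ₗ[K] A) (a ⊗ₜ v))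
        using TensorProduct.induction_on with
      | zero => simp
      | tmul x y => simp
      | add x y hx hy => simp_all [TensorProduct.add_tmul, add_mul]
    have h1 : toConv (conjCoaction p ∘ₗ actOn (mulAction (i : H →ₗ[K] A)) v) =
        convAlong (.id K H) (includeLeft : H →ₐ[K] H ⊗[K] A) *
        convAlong (.id K H) ((includeRight : A →ₐ[K] H ⊗[K] A).comp (i : H →ₐ[K] A)) *
        convConst K H (conjCoaction p v) *
        convAlongInv (.id K H) (includeLeft : H →ₐ[K] H ⊗[K] A) := by
      ext h
      rw [← conjCoaction_map_mul hp]
      simp [mulAction]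
    rw [hrhs, h1, mul_assoc _ (convAlongInv _ _), convAlongInv_mul, mul_one, mul_convConst_apply]
    have h2 : ∀ r : H ⊗[K] A, TensorProduct.map (LinearMap.mul' K H) (mulAction (i : H →ₗ[K] A))
        (TensorProduct.tensorTensorTensorComm K H H H A (Coalgebra.comul (R := K) g ⊗ₜ r)) =
        (convAlong (.id K H) (includeLeft : H →ₐ[K] H ⊗[K] A) *
        convAlong (.id K H) ((includeRight : A →ₐ[K] H ⊗[K] A).comp (i : H →ₐ[K] A))) g * r := by
      intro r
      rw [← mul_convConst_apply, mul_assoc]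
      refine apply_comul_eq_conv (F := TensorProduct.map (LinearMap.mul' K H)
        (mulAction (i : H →ₗ[K] A)) ∘ₗ
        (TensorProduct.tensorTensorTensorComm K H H H A).toLinearMap ∘ₗ
        (TensorProduct.mk K (H ⊗[K] H) (H ⊗[K] A)).flip r) (fun a b => ?_) g
      rw [mul_convConst_apply]
      induction r using TensorProduct.induction_on with
      | zero => simp
      | tmul x y => simp [mulAction]
      | add x y hx hy => simp_all [mul_add]
    exact h2 _

/-- `A` is a coalgebra in the Yetter-Drinfel'd category. Left multiplication respects the coproduct
because the coproduct of `A` is multiplicative. The coaction of `∑ a₁ ⊗ a₂` has the coefficient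
`p(a₁) S(p(a₃)) p(a₄) S(p(a₆))`, whose inner pair cancels. -/
theorem isYBCoalgebra_mulAction (hp : ∀ h, p (i h) = h)
    (hS : Function.Bijective (HopfAlgebra.antipode K : H →ₗ[K] H)) :
    IsYBCoalgebra (naturalBraiding (mulAction (i : H →ₗ[K] A)) (conjCoaction p)) := by
  refine (isYetterDrinfeld_mulAction hp).isYBCoalgebra hS (fun g a => ?_) ?_ (fun a => ?_) ?_
  · simp [mulAction]
  · refine TensorProduct.ext' fun g a => ?_
    simp only [LinearMap.comp_apply, mulAction, LinearMap.rTensor_tmul, LinearMap.mul'_apply,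
      Bialgebra.comul_mul, LinearMap.lTensor_tmul, tensorAction, LinearEquiv.coe_coe]
    have h1 : Coalgebra.comul (R := K) ((i : H →ₗ[K] A) g) = TensorProduct.map (i : H →ₗ[K] A)
      (i : H →ₗ[K] A) (Coalgebra.comul (R := K) g) := (CoalgHomClass.map_comp_comul_apply i g).symm
    rw [h1]
    induction (Coalgebra.comul (R := K) g) using TensorProduct.induction_on with
    | zero => simp
    | tmul x y =>
      induction (Coalgebra.comul (R := K) a) using TensorProduct.induction_on with
      | zero => simp
      | tmul z w => simp
      | add x y hx hy => simp_all only [mul_add, TensorProduct.tmul_add, map_add]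
    | add x y hx hy => simp_all [add_mul, TensorProduct.add_tmul]
  · have h1 := map_conjCoaction (p := p) ((Algebra.TensorProduct.rid K K H).toAlgHom.comp
      (Algebra.TensorProduct.map (AlgHom.id K H) (Bialgebra.counitAlgHom K A))) a
    have h2 : toConv (((Algebra.TensorProduct.rid K K H).toAlgHom.comp
      (Algebra.TensorProduct.map (AlgHom.id K H) (Bialgebra.counitAlgHom K A))).comp
        includeRight).toLinearMap = 1 := by
      ext a
      simp [Algebra.algebraMap_eq_smul_one]
    rw [h2, mul_one, convAlong_mul_inv] at h1
    exact h1.trans (by simp [Algebra.algebraMap_eq_smul_one])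
  · ext a
    simp only [LinearMap.comp_apply]
    let q : A →ₗc[K] H := p
    let f₁ : H →ₐ[K] H ⊗[K] (A ⊗[K] A) := includeLeft
    let f₂ : A →ₐ[K] H ⊗[K] (A ⊗[K] A) := includeRight.comp includeLeft
    let f₃ : A →ₐ[K] H ⊗[K] (A ⊗[K] A) := includeRight.comp includeRight
    have h1 : (Coalgebra.comul (R := K)).lTensor H (conjCoaction p a) =
        (convAlong q f₁ * toConv ((includeRight : A ⊗[K] A →ₐ[K] H ⊗[K] (A ⊗[K] A)).comp
          (Bialgebra.comulAlgHom K A)).toLinearMap * convAlongInv q f₁) a :=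
      map_conjCoaction' _ _ _ (fun x y a => by simp [f₁]) a
    have h2 : toConv ((includeRight : A ⊗[K] A →ₐ[K] H ⊗[K] (A ⊗[K] A)).comp
        (Bialgebra.comulAlgHom K A)).toLinearMap = toConv f₂.toLinearMap * toConv f₃.toLinearMap := by
      ext a
      exact apply_comul_eq_conv (F := (includeRight : A ⊗[K] A →ₐ[K] H ⊗[K] (A ⊗[K] A)).toLinearMap)
        (fun x y => by simp [f₂, f₃]) a
    have h3 : tensorCoaction (conjCoaction p) (conjCoaction p) (Coalgebra.comul (R := K) a) =
        (toConv (((includeLeft : A →ₐ[K] A ⊗[K] A).toLinearMap).lTensor H ∘ₗ conjCoaction p) *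
        toConv (((includeRight : A →ₐ[K] A ⊗[K] A).toLinearMap).lTensor H ∘ₗ conjCoaction p)) a := by
      refine apply_comul_eq_conv (fun x y => ?_) a
      simp only [tensorCoaction, LinearMap.comp_apply, TensorProduct.map_tmul]
      induction conjCoaction p x using TensorProduct.induction_on with
      | zero => simp
      | tmul g x =>
        induction conjCoaction p y using TensorProduct.induction_on with
        | zero => simp
        | tmul h y => simp
        | add x y hx hy => simp_all [mul_add, TensorProduct.tmul_add]
      | add x y hx hy => simp_all [add_mul, TensorProduct.add_tmul]
    have h4 : toConv (((includeLeft : A →ₐ[K] A ⊗[K] A).toLinearMap).lTensor H ∘ₗ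
        conjCoaction p) = convAlong q f₁ * toConv f₂.toLinearMap * convAlongInv q f₁ := by
      ext a
      exact map_conjCoaction' (((includeLeft : A →ₐ[K] A ⊗[K] A).toLinearMap).lTensor H) f₁
        f₂.toLinearMap (fun x y a => by simp [f₁, f₂]) a
    have h5 : toConv (((includeRight : A →ₐ[K] A ⊗[K] A).toLinearMap).lTensor H ∘ₗ
        conjCoaction p) = convAlong q f₁ * toConv f₃.toLinearMap * convAlongInv q f₁ := by
      ext a
      exact map_conjCoaction' (((includeRight : A →ₐ[K] A ⊗[K] A).toLinearMap).lTensor H) f₁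
        f₃.toLinearMap (fun x y a => by simp [f₁, f₃]) a
    rw [h1, h2, h3, h4, h5]
    simp only [mul_assoc, convAlongInv_mul_cancel]

end Projection

end YangBaxter

namespace YangBaxter

open WithConv Algebra.TensorProduct

/-! ### Injections, kernels and equalizers under tensor products over a field -/

section Injective

variable {K U V W : Type*} [Field K] [AddCommMonoid U] [Module K U] [AddCommMonoid V] [Module K V]
  [AddCommMonoid W] [Module K W]

/-- Structure maps on subspaces arise this way: the map exists on the large space, and only the
containment of its values has to be verified. -/
theorem exists_comp_eq_of_range_le {g : U →ₗ[K] W} (hg : Function.Injective g) {f : V →ₗ[K] W}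
    (h : ∀ v, f v ∈ LinearMap.range g) : ∃ f' : V →ₗ[K] U, g ∘ₗ f' = f := by
  refine ⟨(LinearEquiv.ofInjective g hg).symm.toLinearMap ∘ₗ f.codRestrict _ h, ?_⟩
  ext v
  have := (LinearEquiv.ofInjective g hg).apply_symm_apply (f.codRestrict _ h v)
  exact congrArg Subtype.val this

theorem lTensor_injective {f : U →ₗ[K] V} (hf : Function.Injective f) :
    Function.Injective (f.lTensor W) := by
  let := Module.addCommMonoidToAddCommGroup K (M := U)
  let := Module.addCommMonoidToAddCommGroup K (M := V)
  let := Module.addCommMonoidToAddCommGroup K (M := W)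
  exact Module.Flat.lTensor_preserves_injective_linearMap f hf

theorem rTensor_injective {f : U →ₗ[K] V} (hf : Function.Injective f) :
    Function.Injective (f.rTensor W) := by
  let := Module.addCommMonoidToAddCommGroup K (M := U)
  let := Module.addCommMonoidToAddCommGroup K (M := V)
  let := Module.addCommMonoidToAddCommGroup K (M := W)
  exact Module.Flat.rTensor_preserves_injective_linearMap f hf

theorem map_injective {U' : Type*} [AddCommMonoid U'] [Module K U'] {f : U →ₗ[K] V}
    {g : U' →ₗ[K] W} (hf : Function.Injective f) (hg : Function.Injective g) :
    Function.Injective (TensorProduct.map f g) := by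
  rw [← LinearMap.lTensor_comp_rTensor, LinearMap.coe_comp]
  exact (lTensor_injective hg).comp (rTensor_injective hf)

/-- By flatness, tensoring with `W` preserves exactness of `ker f → U → V`. This turns a vanishing
condition into an actual tensor over the kernel. -/
theorem mem_range_lTensor_ker {f : U →ₗ[K] V} {t : W ⊗[K] U} (h : f.lTensor W t = 0) :
    t ∈ LinearMap.range ((LinearMap.ker f).subtype.lTensor W) := by
  let := Module.addCommMonoidToAddCommGroup K (M := U)
  let := Module.addCommMonoidToAddCommGroup K (M := V)
  let := Module.addCommMonoidToAddCommGroup K (M := W)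
  exact (Module.Flat.lTensor_exact W (LinearMap.exact_subtype_ker_map f) t).mp h

theorem mem_range_rTensor_ker {f : U →ₗ[K] V} {t : U ⊗[K] W} (h : f.rTensor W t = 0) :
    t ∈ LinearMap.range ((LinearMap.ker f).subtype.rTensor W) := by
  let := Module.addCommMonoidToAddCommGroup K (M := U)
  let := Module.addCommMonoidToAddCommGroup K (M := V)
  let := Module.addCommMonoidToAddCommGroup K (M := W)
  exact (Module.Flat.rTensor_exact W (LinearMap.exact_subtype_ker_map f) t).mp h

end Injective

section Linear

variable {K U V W : Type*} [Field K] [AddCommGroup U] [Module K U] [AddCommGroup V] [Module K V]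
  [AddCommGroup W] [Module K W]

theorem mem_range_lTensor_eqLocus {f g : U →ₗ[K] V} {t : W ⊗[K] U}
    (h : f.lTensor W t = g.lTensor W t) :
    t ∈ LinearMap.range ((LinearMap.eqLocus f g).subtype.lTensor W) := by
  rw [LinearMap.eqLocus_eq_ker_sub]
  apply mem_range_lTensor_ker
  rw [LinearMap.lTensor_sub, LinearMap.sub_apply, h, sub_self]

end Linear

section Sub

variable {K H V W : Type*} [Field K] [Ring H] [HopfAlgebra K H]
  [AddCommGroup V] [Module K V] [AddCommGroup W] [Module K W]

/-- A subobject of a Yetter-Drinfel'd module is a Yetter-Drinfel'd module. -/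
theorem IsYetterDrinfeld.of_injective {α : H ⊗[K] V →ₗ[K] V} {ρ : V →ₗ[K] H ⊗[K] V}
    (h : IsYetterDrinfeld α ρ) {f : W →ₗ[K] V} (hf : Function.Injective f)
    {β : H ⊗[K] W →ₗ[K] W} {θ : W →ₗ[K] H ⊗[K] W}
    (hβ : f ∘ₗ β = α ∘ₗ f.lTensor H) (hθ : f.lTensor H ∘ₗ θ = ρ ∘ₗ f) : IsYetterDrinfeld β θ := by
  have hβ' : ∀ g w, f (β (g ⊗ₜ w)) = α (g ⊗ₜ f w) := fun g w => LinearMap.congr_fun hβ (g ⊗ₜ w)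
  have hθ' : ∀ w, f.lTensor H (θ w) = ρ (f w) := LinearMap.congr_fun hθ
  refine ⟨fun w => hf ?_, fun g k w => hf ?_, fun w => hf ?_, ?_, ?_⟩
  · rw [hβ', h.one_act]
  · rw [hβ', hβ', hβ', h.mul_act]
  · conv_rhs => rw [← h.counit_coact (f w), ← hθ']
    induction θ w using TensorProduct.induction_on with
    | zero => simp
    | tmul x y => simp
    | add x y hx hy => simp_all
  · ext w
    -- Tensoring over a field keeps `f` injective, so identities between maps into `H ⊗ H ⊗ W` may
    -- be tested in `H ⊗ H ⊗ V`.
    apply lTensor_injective (lTensor_injective hf)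
    have h1 := LinearMap.congr_fun h.coassoc (f w)
    simp only [LinearMap.comp_apply, LinearEquiv.coe_coe, ← hθ'] at h1 ⊢
    refine Eq.trans ?_ (h1.trans ?_)
    · induction θ w using TensorProduct.induction_on with
      | zero => simp
      | tmul x y =>
        simp only [LinearMap.rTensor_tmul, LinearMap.lTensor_tmul]
        induction (Coalgebra.comul (R := K) x) using TensorProduct.induction_on with
        | zero => simp
        | tmul x y => simp
        | add x y hx hy => simp_all [TensorProduct.add_tmul]
      | add x y hx hy => simp_all
    · induction θ w using TensorProduct.induction_on with
      | zero => simp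
      | tmul x y => simp [hθ']
      | add x y hx hy => simp_all
  · refine TensorProduct.ext' fun g w => ?_
    apply lTensor_injective hf
    have h1 := LinearMap.congr_fun h.compat (g ⊗ₜ f w)
    simp only [LinearMap.comp_apply, LinearEquiv.coe_coe, TensorProduct.map_tmul,
      LinearMap.rTensor_tmul, ← hθ'] at h1 ⊢
    refine Eq.trans ?_ (h1.trans ?_)
    · induction θ w using TensorProduct.induction_on with
      | zero => simp
      | tmul x y =>
        induction (Coalgebra.comul (R := K) g) using TensorProduct.induction_on with
        | zero => simp
        | tmul x y => simp [hβ']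
        | add x y hx hy => simp_all [TensorProduct.add_tmul]
      | add x y hx hy => simp_all [TensorProduct.tmul_add]
    · induction (Coalgebra.comul (R := K) g) using TensorProduct.induction_on with
      | zero => simp
      | tmul x y =>
        simp only [TensorProduct.rightComm_tmul, LinearMap.rTensor_tmul, LinearMap.comp_apply,
          ← hβ', ← hθ']
        induction θ (β (x ⊗ₜ w)) using TensorProduct.induction_on with
        | zero => simp
        | tmul x y => simp
        | add x y hx hy => simp_all [TensorProduct.add_tmul]
      | add x y hx hy => simp_all [TensorProduct.add_tmul]

end Sub

/-! ### Coinvariants and Radford's decomposition -/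

section Coinvariants

variable {K H A : Type*} [Field K] [Ring H] [HopfAlgebra K H] [Ring A] [HopfAlgebra K A]
  {i : H →ₐc[K] A} {p : A →ₐc[K] H}

theorem mem_rightCoinvariants {a : A} :
    a ∈ rightCoinvariants (p : A →ₗ[K] H) ↔ rightCoactionHom p a = a ⊗ₜ 1 := Iff.rfl

/-- The right coaction is an algebra homomorphism with `i(h) ↦ ∑ i(h₁) ⊗ h₂`. It sends `h · b` to
the conjugate of `b ⊗ 1` by the product of `i(·) ⊗ 1` and `1 ⊗ (·)`; the second factor commutes with
`b ⊗ 1` and cancels against its inverse. -/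
theorem adjointAction_mem (hp : ∀ h, p (i h) = h) {b : A}
    (hb : b ∈ rightCoinvariants (p : A →ₗ[K] H)) (h : H) :
    adjointAction (i : H →ₗ[K] A) (h ⊗ₜ b) ∈ rightCoinvariants (p : A →ₗ[K] H) := by
  rw [mem_rightCoinvariants] at hb ⊢
  have h1 : rightCoactionHom p (adjointAction (i : H →ₗ[K] A) (h ⊗ₜ b)) =
      (convAlong (.id K H) ((rightCoactionHom p).comp (i : H →ₐ[K] A)) *
        convConst K H (rightCoactionHom p b) *
        convAlongInv (.id K H) ((rightCoactionHom p).comp (i : H →ₐ[K] A))) h := by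
    rw [adjointAction_tmul]
    exact map_conv₃ (rightCoactionHom p).toLinearMap (fun x y z => by simp [convConst_apply]) h
  have h2 : adjointAction (i : H →ₗ[K] A) (h ⊗ₜ b) ⊗ₜ[K] (1 : H) =
      (convAlong (.id K H) ((includeLeft : A →ₐ[K] A ⊗[K] H).comp (i : H →ₐ[K] A)) *
        convConst K H (b ⊗ₜ[K] (1 : H)) *
        convAlongInv (.id K H) ((includeLeft : A →ₐ[K] A ⊗[K] H).comp (i : H →ₐ[K] A))) h := by
    rw [adjointAction_tmul]
    exact map_conv₃ (includeLeft : A →ₐ[K] A ⊗[K] H).toLinearMap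
      (fun x y z => by simp [convConst_apply, TensorProduct.smul_tmul']) h
  have h3 : convAlong (.id K H) (includeRight : H →ₐ[K] A ⊗[K] H) * convConst K H (b ⊗ₜ[K] (1 : H)) =
      convConst K H (b ⊗ₜ[K] (1 : H)) * convAlong (.id K H) (includeRight : H →ₐ[K] A ⊗[K] H) :=
    conv_commute fun c => by simp
  rw [h1, h2, hb, convAlongInv_eq _ (rightCoactionHom_comp_conv hp), rightCoactionHom_comp_conv hp,
    mul_assoc _ _ (convConst K H _), h3]
  simp only [mul_assoc, convAlong_mul_inv_cancel]

/-- By coassociativity the left and right coactions commute, so the right coaction on the second leg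
of the left coaction of `b` only appends `1`. `B` is an equalizer, and flatness makes `H ⊗ B` the
corresponding equalizer in `H ⊗ A`. -/
theorem leftCoaction_mem {b : A} (hb : b ∈ rightCoinvariants (p : A →ₗ[K] H)) :
    leftCoaction (p : A →ₗ[K] H) b ∈
      LinearMap.range ((rightCoinvariants (p : A →ₗ[K] H)).subtype.lTensor H) := by
  apply mem_range_lTensor_eqLocus
  have h1 : ((p : A →ₗ[K] H).lTensor A ∘ₗ Coalgebra.comul (R := K)).lTensor H
      (leftCoaction (p : A →ₗ[K] H) b) = TensorProduct.assoc K H A H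
        ((leftCoaction (p : A →ₗ[K] H)).rTensor H
          ((p : A →ₗ[K] H).lTensor A (Coalgebra.comul (R := K) b))) := by
    have h2 := Coalgebra.coassoc_apply (R := K) b
    have h3 : ((p : A →ₗ[K] H).lTensor A ∘ₗ Coalgebra.comul (R := K)).lTensor H
      (leftCoaction (p : A →ₗ[K] H) b) = TensorProduct.map (p : A →ₗ[K] H)
        ((p : A →ₗ[K] H).lTensor A) ((Coalgebra.comul (R := K)).lTensor A (Coalgebra.comul b)) := by
      simp only [leftCoaction, LinearMap.comp_apply]
      induction (Coalgebra.comul (R := K) b) using TensorProduct.induction_on with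
      | zero => simp
      | tmul x y => simp
      | add x y hx hy => simp_all
    have h4 : (leftCoaction (p : A →ₗ[K] H)).rTensor H
          ((p : A →ₗ[K] H).lTensor A (Coalgebra.comul (R := K) b)) =
        TensorProduct.map ((p : A →ₗ[K] H).rTensor A) (p : A →ₗ[K] H)
          ((Coalgebra.comul (R := K)).rTensor A (Coalgebra.comul b)) := by
      induction (Coalgebra.comul (R := K) b) using TensorProduct.induction_on with
      | zero => simp
      | tmul x y => simp [leftCoaction]
      | add x y hx hy => simp_all
    rw [h3, h4, ← h2]
    induction ((Coalgebra.comul (R := K)).rTensor A (Coalgebra.comul (R := K) b))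
      using TensorProduct.induction_on with
    | zero => simp
    | tmul x y =>
      induction x using TensorProduct.induction_on with
      | zero => simp
      | tmul x y => simp
      | add x y hx hy => simp_all [TensorProduct.add_tmul]
    | add x y hx hy => simp_all
  rw [h1, ← rightCoactionHom_apply, mem_rightCoinvariants.mp hb, LinearMap.rTensor_tmul]
  induction leftCoaction (p : A →ₗ[K] H) b using TensorProduct.induction_on with
  | zero => simp
  | tmul x y => simp
  | add x y hx hy => simp_all [TensorProduct.add_tmul]

end Coinvariants

end YangBaxter

namespace YangBaxter

open WithConv Algebra.TensorProduct

section Radford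

variable {K H A : Type*} [Field K] [Ring H] [HopfAlgebra K H] [Ring A] [HopfAlgebra K A]
  (i : H →ₐc[K] A) (p : A →ₐc[K] H)

/-- The projection `a ↦ ∑ a₁ i(S(π(a₂)))` of `A` onto the right coinvariants. -/
def coinvariantsProj : A →ₗ[K] A :=
  LinearMap.mul' K A ∘ₗ ((i : H →ₗ[K] A) ∘ₗ HopfAlgebra.antipode K).lTensor A ∘ₗ
    (rightCoactionHom p).toLinearMap

theorem coinvariantsProj_apply (a : A) : coinvariantsProj i p a =
    (toConv (LinearMap.id : A →ₗ[K] A) * convAlongInv (p : A →ₗc[K] H) (i : H →ₐ[K] A)) a := by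
  refine apply_comul_eq_conv (F := LinearMap.mul' K A ∘ₗ
    ((i : H →ₗ[K] A) ∘ₗ HopfAlgebra.antipode K).lTensor A ∘ₗ (p : A →ₗ[K] H).lTensor A)
    (fun x y => ?_) a
  simp

variable {i p}

/-- Under the right coaction `id` acquires `1 ⊗ p(·)` on its right, and the inverse of `i ∘ p`
acquires `(1 ⊗ p(·))⁻¹` on its left. These two are adjacent in the product and cancel. -/
theorem coinvariantsProj_mem (hp : ∀ h, p (i h) = h) (a : A) :
    coinvariantsProj i p a ∈ rightCoinvariants (p : A →ₗ[K] H) := by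
  let q : A →ₗc[K] H := p
  let κ := toConv (includeLeft : A →ₐ[K] A ⊗[K] H).toLinearMap
  have hR : toConv (rightCoactionHom p).toLinearMap =
      κ * convAlong q (includeRight : H →ₐ[K] A ⊗[K] H) := by
    ext a
    refine apply_comul_eq_conv (F := (p : A →ₗ[K] H).lTensor A) (fun x y => ?_) a
    simp [κ, q]
  have hRi : convAlong q ((rightCoactionHom p).comp (i : H →ₐ[K] A)) =
      convAlong q ((includeLeft : A →ₐ[K] A ⊗[K] H).comp (i : H →ₐ[K] A)) *
        convAlong q (includeRight : H →ₐ[K] A ⊗[K] H) := by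
    ext a
    exact (congrArg (fun f => f.ofConv (q a)) (rightCoactionHom_comp_conv hp)).trans
      (convAlong_apply_map q _ _ a)
  rw [mem_rightCoinvariants, coinvariantsProj_apply]
  have h1 : rightCoactionHom p ((toConv (LinearMap.id : A →ₗ[K] A) * convAlongInv q (i : H →ₐ[K] A)) a) =
      (toConv (rightCoactionHom p).toLinearMap *
        convAlongInv q ((rightCoactionHom p).comp (i : H →ₐ[K] A))) a :=
    map_conv (rightCoactionHom p).toLinearMap (fun x y => by simp) a
  have h2 : (includeLeft : A →ₐ[K] A ⊗[K] H)
      ((toConv (LinearMap.id : A →ₗ[K] A) * convAlongInv q (i : H →ₐ[K] A)) a) =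
      (κ * convAlongInv q ((includeLeft : A →ₐ[K] A ⊗[K] H).comp (i : H →ₐ[K] A))) a :=
    map_conv (includeLeft : A →ₐ[K] A ⊗[K] H).toLinearMap (fun x y => by simp [κ]) a
  refine h1.trans (Eq.trans ?_ h2.symm)
  rw [hR, convAlongInv_eq q hRi, mul_assoc, convAlong_mul_inv_cancel]

/-- The projection is linear for left multiplication by coinvariants, and on `i(h)` it is `∑ i(h₁)
i(S(h₂)) = ε(h)`. -/
theorem coinvariantsProj_mul (hp : ∀ h, p (i h) = h) {b : A}
    (hb : b ∈ rightCoinvariants (p : A →ₗ[K] H)) (h : H) :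
    coinvariantsProj i p (b * i h) = Coalgebra.counit (R := K) h • b := by
  have h1 : coinvariantsProj i p (b * i h) = b * coinvariantsProj i p (i h) := by
    simp only [coinvariantsProj, LinearMap.comp_apply, AlgHom.toLinearMap_apply, map_mul,
      mem_rightCoinvariants.mp hb]
    induction rightCoactionHom p (i h) using TensorProduct.induction_on with
    | zero => simp
    | tmul x y => simp [mul_assoc]
    | add x y hx hy => simp_all [mul_add]
  have h2 : (toConv (LinearMap.id : A →ₗ[K] A) * convAlongInv (p : A →ₗc[K] H) (i : H →ₐ[K] A)) (i h) =
      (convAlong (.id K H) (i : H →ₐ[K] A) * convAlongInv (.id K H) (i : H →ₐ[K] A)) h := by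
    refine (convAlong_apply_map (i : H →ₗc[K] A) _ _ h).trans ?_
    refine congrArg₂ (fun x y : WithConv (H →ₗ[K] A) => (x * y).ofConv h) rfl ?_
    ext x
    simp [hp]
  rw [h1, coinvariantsProj_apply, h2, convAlong_mul_inv]
  simp [Algebra.algebraMap_eq_smul_one]

theorem bijective_radfordMap (hp : ∀ h, p (i h) = h) :
    Function.Bijective (radfordMap (i : H →ₗ[K] A) (p : A →ₗ[K] H)) := by
  have hR : ∀ h, rightCoactionHom p (i h) = (i : H →ₗ[K] A).rTensor H
      (Coalgebra.comul (R := K) h) := by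
    intro h
    rw [rightCoactionHom_apply, ← CoalgHomClass.map_comp_comul_apply i h]
    induction (Coalgebra.comul (R := K) h) using TensorProduct.induction_on with
    | zero => simp
    | tmul x y => simp [hp]
    | add x y hx hy => simp_all
  constructor
  -- With `E = coinvariantsProj i p`, a left inverse is `a ↦ ∑ E(a₁) ⊗ p(a₂)`: the right coaction of
  -- `b i(h)` is `∑ b i(h₁) ⊗ h₂`, and `E` reduces it to `b ⊗ h`.
  · have h1 : ∀ t, (coinvariantsProj i p).rTensor H (rightCoactionHom p
        (radfordMap (i : H →ₗ[K] A) (p : A →ₗ[K] H) t)) =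
        (rightCoinvariants (p : A →ₗ[K] H)).subtype.rTensor H t := by
      intro t
      induction t using TensorProduct.induction_on with
      | zero => simp
      | tmul b h =>
        have h2 : radfordMap (i : H →ₗ[K] A) (p : A →ₗ[K] H) (b ⊗ₜ h) = b * i h := rfl
        rw [h2, map_mul, mem_rightCoinvariants.mp b.2, hR, LinearMap.rTensor_tmul]
        conv_rhs => rw [← Coalgebra.sum_counit_smul (Coalgebra.Repr.arbitrary K h)]
        rw [← (Coalgebra.Repr.arbitrary K h).eq]
        simp [Finset.mul_sum, coinvariantsProj_mul hp b.2, TensorProduct.tmul_sum,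
          TensorProduct.smul_tmul']
      | add x y hx hy => simp_all
    intro s t hst
    apply rTensor_injective (rightCoinvariants (p : A →ₗ[K] H)).injective_subtype (W := H)
    rw [← h1, ← h1, hst]
  · intro a
    -- The same formula gives a preimage, since `id * (i ∘ p)⁻¹ * (i ∘ p) = id` in the convolution
    -- algebra.
    let E := (coinvariantsProj i p).codRestrict _ (coinvariantsProj_mem hp)
    refine ⟨TensorProduct.map E (p : A →ₗ[K] H) (Coalgebra.comul (R := K) a), ?_⟩
    rw [← LinearMap.comp_apply]
    refine (apply_comul_eq_conv (f := toConv (coinvariantsProj i p))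
      (g := convAlong (p : A →ₗc[K] H) (i : H →ₐ[K] A)) (fun x y => ?_) a).trans ?_
    · simp [radfordMap, E]
    · have h2 : toConv (coinvariantsProj i p) =
        toConv (LinearMap.id : A →ₗ[K] A) * convAlongInv (p : A →ₗc[K] H) (i : H →ₐ[K] A) := by
        ext a
        exact coinvariantsProj_apply i p a
      rw [h2, mul_assoc, convAlongInv_mul, mul_one]
      rfl

/-- For coinvariant `b` the third leg in `conjCoaction_mul` is replaced by `S(1) = 1`, so the
formula becomes multiplicative. -/
theorem conjCoaction_mul_of_mem {b : A} (hb : b ∈ rightCoinvariants (p : A →ₗ[K] H)) (y : A) :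
    conjCoaction p (b * y) = leftCoaction (p : A →ₗ[K] H) b * conjCoaction p y := by
  have h1 := apply_comul_eq_conv
    (f := toConv (leftCoactionHom p).toLinearMap * convConst K A (conjCoaction p y))
    (g := convAlongInv (p : A →ₗc[K] H) (includeLeft : H →ₐ[K] H ⊗[K] A))
    (F := LinearMap.mul' K (H ⊗[K] A) ∘ₗ TensorProduct.map
      (LinearMap.mulRight K (conjCoaction p y) ∘ₗ (leftCoactionHom p).toLinearMap)
      ((includeLeft : H →ₐ[K] H ⊗[K] A).toLinearMap ∘ₗ HopfAlgebra.antipode K) ∘ₗ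
      (p : A →ₗ[K] H).lTensor A) (fun x y => by rw [mul_convConst_apply]; simp) b
  rw [conjCoaction_mul, ← h1]
  simp only [LinearMap.comp_apply]
  rw [← rightCoactionHom_apply, mem_rightCoinvariants.mp hb, TensorProduct.map_tmul,
    LinearMap.mul'_apply]
  simp only [LinearMap.comp_apply, LinearMap.mulRight_apply, HopfAlgebra.antipode_one,
    AlgHom.toLinearMap_apply, map_one, mul_one]
  rfl

theorem conjCoaction_map (hp : ∀ h, p (i h) = h) (h : H) :
    conjCoaction p (i h) = (i : H →ₗ[K] A).lTensor H (coadjointCoaction K H h) := by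
  have h2 := conjCoaction_map_mul hp h 1
  have h3 : conjCoaction p (1 : A) = 1 := by
    simp [conjCoaction, Algebra.TensorProduct.one_def]
  rw [mul_one, h3, convConst_one, mul_one] at h2
  rw [h2]
  refine (apply_comul_comul_eq_conv (F := (i : H →ₗ[K] A).lTensor H ∘ₗ
    (LinearMap.mul' K H ∘ₗ (HopfAlgebra.antipode K).lTensor H).rTensor H ∘ₗ
    (TensorProduct.rightComm K H H H).toLinearMap) (fun a b d => ?_) h).symm
  simp

/-- The structure theorem for a Hopf algebra with a projection onto `H`. -/
theorem isBiproductYB (hp : ∀ h, p (i h) = h)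
    (hS : Function.Bijective (HopfAlgebra.antipode K : H →ₗ[K] H)) :
    IsBiproductYB (i : H →ₗ[K] A) (p : A →ₗ[K] H) := by
  let B := rightCoinvariants (p : A →ₗ[K] H)
  let f := radfordMap (i : H →ₗ[K] A) (p : A →ₗ[K] H)
  have hf : ∀ (b : B) (h : H), f (b ⊗ₜ h) = b * i h := fun _ _ => rfl
  have hmem : ∀ t : H ⊗[K] B, adjointAction (i : H →ₗ[K] A) (B.subtype.lTensor H t) ∈ B := by
    intro t
    induction t using TensorProduct.induction_on with
    | zero => simp
    | tmul h b => exact adjointAction_mem hp b.2 h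
    | add x y hx hy => simpa using add_mem hx hy
  let αB : H ⊗[K] B →ₗ[K] B :=
    (adjointAction (i : H →ₗ[K] A) ∘ₗ B.subtype.lTensor H).codRestrict B hmem
  have hα : B.subtype ∘ₗ αB = adjointAction (i : H →ₗ[K] A) ∘ₗ B.subtype.lTensor H :=
    LinearMap.subtype_comp_codRestrict _ _ _
  have hα' : ∀ h (b : B), (αB (h ⊗ₜ b) : A) = adjointAction (i : H →ₗ[K] A) (h ⊗ₜ (b : A)) :=
    fun _ _ => rfl
  obtain ⟨ρB, hρ⟩ := exists_comp_eq_of_range_le (lTensor_injective B.injective_subtype (W := H))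
    (f := leftCoaction (p : A →ₗ[K] H) ∘ₗ B.subtype) (fun b => leftCoaction_mem b.2)
  have hρ' : ∀ b, B.subtype.lTensor H (ρB b) = leftCoaction (p : A →ₗ[K] H) b :=
    LinearMap.congr_fun hρ
  -- Radford's map takes a tensor product coaction to a product in `H ⊗ A`. Leaving `θ` arbitrary
  -- covers the coproduct and the coadjoint coaction together; `hact` does the same for the two
  -- actions.
  have hcoact : ∀ (θ : H →ₗ[K] H ⊗[K] H) (b : B) (h : H),
      f.lTensor H (tensorCoaction ρB θ (b ⊗ₜ h)) =
        leftCoaction (p : A →ₗ[K] H) b * (i : H →ₗ[K] A).lTensor H (θ h) := by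
    intro θ b h
    rw [← hρ']
    simp only [tensorCoaction, LinearMap.comp_apply, TensorProduct.map_tmul]
    induction ρB b using TensorProduct.induction_on with
    | zero => simp
    | tmul g x =>
      induction θ h using TensorProduct.induction_on with
      | zero => simp
      | tmul k y => simp [hf]
      | add x y hx hy => simp_all [TensorProduct.tmul_add, mul_add]
    | add x y hx hy => simp_all [TensorProduct.add_tmul, add_mul]
  have hact : ∀ (β : H ⊗[K] H →ₗ[K] H) (g : H) (b : B) (h : H),
      f (tensorAction αB β (g ⊗ₜ (b ⊗ₜ h))) =
        (toConv (actOn (adjointAction (i : H →ₗ[K] A)) b) *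
          toConv ((i : H →ₗ[K] A) ∘ₗ actOn β h)) g := by
    intro β g b h
    refine apply_comul_eq_conv (F := f ∘ₗ TensorProduct.map αB β ∘ₗ
      (TensorProduct.tensorTensorTensorComm K H H B H).toLinearMap ∘ₗ
      (TensorProduct.mk K (H ⊗[K] H) (B ⊗[K] H)).flip (b ⊗ₜ h)) (fun x y => ?_) g
    simp [hf, hα']
  -- Once Radford's map is known to be linear and colinear, naturality transports the braidings to
  -- `A`. The four goals after the `refine` are these conditions for the two structures.
  have hσ := naturalBraiding_naturality (f := f)
    (α := tensorAction αB (adjointAction (LinearMap.id : H →ₗ[K] H)))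
    (ρ := tensorCoaction ρB (Coalgebra.comul (R := K) (A := H)))
    (α' := adjointAction (i : H →ₗ[K] A)) (ρ' := leftCoaction (p : A →ₗ[K] H))
  have hτ := naturalBraiding_naturality (f := f) (α := tensorAction αB (LinearMap.mul' K H))
    (ρ := tensorCoaction ρB (coadjointCoaction K H)) (α' := mulAction (i : H →ₗ[K] A))
    (ρ' := conjCoaction p)
  refine ⟨bijective_radfordMap hp, αB, ρB, hα, hρ,
    (isYetterDrinfeld_adjointAction hp).of_injective B.injective_subtype hα hρ,
    ⟨_, hσ ?_ ?_, isYBAlgebra_adjointAction hp hS⟩,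
    ⟨_, hτ ?_ ?_, isYBCoalgebra_mulAction hp hS⟩⟩
  · refine TensorProduct.ext' fun g t => ?_
    induction t using TensorProduct.induction_on with
    | zero => simp
    | tmul b h =>
      refine (hact _ g b h).trans ?_
      have h1 : toConv ((i : H →ₗ[K] A) ∘ₗ actOn (adjointAction (LinearMap.id : H →ₗ[K] H)) h) =
          convAlong (.id K H) (i : H →ₐ[K] A) * convConst K H (i h) *
            convAlongInv (.id K H) (i : H →ₐ[K] A) := by
        ext x
        have h2 : adjointAction (LinearMap.id : H →ₗ[K] H) (x ⊗ₜ h) = _ :=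
          adjointAction_tmul (BialgHom.id K H) x h
        rw [ofConv_toConv, LinearMap.comp_apply, actOn_apply, h2]
        exact map_conv₃ (i : H →ₗ[K] A) (fun x y z => by simp [convConst_apply]) x
      rw [h1, actOn_adjointAction, LinearMap.comp_apply, LinearMap.lTensor_tmul]
      refine Eq.trans ?_ (adjointAction_tmul i g _).symm
      rw [hf, convConst_mul]
      simp only [mul_assoc, convAlongInv_mul_cancel]
    | add x y hx hy => simp_all [TensorProduct.tmul_add]
  · refine TensorProduct.ext' fun b h => ?_
    refine Eq.trans ?_ (hcoact _ b h).symm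
    rw [LinearMap.comp_apply]
    refine (congrArg _ (hf b h)).trans ?_
    rw [← leftCoactionHom_apply, map_mul]
    congr 1
    rw [leftCoactionHom_apply, leftCoaction, LinearMap.comp_apply,
      ← CoalgHomClass.map_comp_comul_apply i h]
    induction (Coalgebra.comul (R := K) h) using TensorProduct.induction_on with
    | zero => simp
    | tmul x y => simp [hp]
    | add x y hx hy => simp_all
  · refine TensorProduct.ext' fun g t => ?_
    induction t using TensorProduct.induction_on with
    | zero => simp
    | tmul b h =>
      refine (hact _ g b h).trans ?_
      have h1 : toConv ((i : H →ₗ[K] A) ∘ₗ actOn (LinearMap.mul' K H) h) =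
          convAlong (.id K H) (i : H →ₐ[K] A) * convConst K H (i h) := by
        ext x
        rw [mul_convConst_apply]
        simp
      -- This is `∑ i(g₁) b i(S(g₂)) i(g₃) i(h) = i(g) b i(h)`: the diagonal action on `B ⊗ H`
      -- becomes left multiplication.
      rw [h1, actOn_adjointAction, mul_assoc, convAlongInv_mul_cancel, mul_assoc, ← convConst_mul,
        mul_convConst_apply]
      rfl
    | add x y hx hy => simp_all [TensorProduct.tmul_add]
  · refine TensorProduct.ext' fun b h => ?_
    refine Eq.trans ?_ (hcoact _ b h).symm
    rw [LinearMap.comp_apply]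
    refine (congrArg _ (hf b h)).trans ?_
    rw [conjCoaction_mul_of_mem b.2, conjCoaction_map hp]

end Radford

end YangBaxter

namespace YangBaxter

/-! ### Deconcatenation and coaction on the sum of the tensor powers -/

section PosTensor

variable (K : Type*) [CommRing K] (M : Type*) [AddCommGroup M] [Module K M]

/-- The inclusion of `M = M^{⊗ 1}` into the sum of the positive tensor powers. -/
def PosTensor.ι : M →ₗ[K] PosTensor K M :=
  DirectSum.lof K ℕ (fun k => TPow K M k) 0 ∘ₗ (TPow.zeroEquiv K M).symm.toLinearMap

variable {K M}

theorem PosTensor.append_lof (n : ℕ) (w : TPow K M n) (m : M) :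
    PosTensor.append K M (DirectSum.lof K ℕ (fun k => TPow K M k) n w ⊗ₜ m) =
      DirectSum.lof K ℕ (fun k => TPow K M k) (n + 1) ((TPow.succEquiv K M n).symm (w ⊗ₜ m)) := by
  simp [PosTensor.append]

theorem PosTensor.append_comp_rTensor_lof (n : ℕ) :
    PosTensor.append K M ∘ₗ (DirectSum.lof K ℕ (fun k => TPow K M k) n).rTensor M =
      DirectSum.lof K ℕ (fun k => TPow K M k) (n + 1) ∘ₗ
        (TPow.succEquiv K M n).symm.toLinearMap :=
  TensorProduct.ext' fun w m => PosTensor.append_lof n w m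

theorem PosTensor.induction_lof {P : PosTensor K M → Prop} (zero : P 0)
    (add : ∀ x y, P x → P y → P (x + y))
    (lof : ∀ n (w : TPow K M n), P (DirectSum.lof K ℕ (fun k => TPow K M k) n w))
    (x : PosTensor K M) : P x :=
  DirectSum.induction_on x zero lof add

/-- Every tensor is a sum of words built by appending letters. Proofs by this principle avoid the
degree index and the transports between tensor powers. -/
theorem PosTensor.induction {P : PosTensor K M → Prop} (zero : P 0)
    (add : ∀ x y, P x → P y → P (x + y)) (ι : ∀ m, P (PosTensor.ι K M m))
    (append : ∀ x m, P x → P (PosTensor.append K M (x ⊗ₜ m))) (x : PosTensor K M) : P x := by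
  have h : ∀ n (w : TPow K M n), P (DirectSum.lof K ℕ (fun k => TPow K M k) n w) := by
    intro n
    induction n with
    | zero => exact ι
    | succ n ih =>
      intro w
      obtain ⟨t, rfl⟩ := (TPow.succEquiv K M n).symm.surjective w
      induction t using TensorProduct.induction_on with
      | zero => simpa
      | tmul w m => rw [← PosTensor.append_lof]; exact append _ _ (ih w)
      | add x y hx hy => rw [map_add, map_add]; exact add _ _ hx hy
  induction x using DirectSum.induction_on with
  | zero => exact zero
  | of n w => exact h n w
  | add x y hx hy => exact add _ _ hx hy

theorem PosTensor.component_zero_append :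
    DirectSum.component K ℕ (fun k => TPow K M k) 0 ∘ₗ PosTensor.append K M = 0 := by
  refine TensorProduct.ext' fun x m => ?_
  induction x using PosTensor.induction_lof with
  | zero => simp
  | lof n w =>
    rw [LinearMap.comp_apply, PosTensor.append_lof, DirectSum.component.of]
    simp
  | add x y hx hy => simp_all [TensorProduct.add_tmul]

theorem PosTensor.component_succ_append (n : ℕ) :
    DirectSum.component K ℕ (fun k => TPow K M k) (n + 1) ∘ₗ PosTensor.append K M =
      (TPow.succEquiv K M n).symm.toLinearMap ∘ₗ
        (DirectSum.component K ℕ (fun k => TPow K M k) n).rTensor M := by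
  refine TensorProduct.ext' fun x m => ?_
  induction x using PosTensor.induction_lof with
  | zero => simp
  | lof k w =>
    rw [LinearMap.comp_apply, PosTensor.append_lof, DirectSum.component.of, LinearMap.comp_apply,
      LinearMap.rTensor_tmul, DirectSum.component.of]
    by_cases h : k = n
    · subst h
      simp
    · simp [h]
  | add x y hx hy => simp_all [TensorProduct.add_tmul]

end PosTensor

namespace HopfBimodule

variable {K H M : Type*} [Field K] [Ring H] [HopfAlgebra K H] [AddCommGroup M] [Module K M]
  [Module H M] [IsScalarTower K H M] [Module Hᵐᵒᵖ M] [IsScalarTower K Hᵐᵒᵖ M]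
  [SMulCommClass H Hᵐᵒᵖ M] (X : HopfBimodule K H M)

/-- The inclusion of `H` into the ambient space. -/
abbrev ambInl : H →ₗ[K] X.Ambient := LinearMap.inl K H (PosTensor K M)

/-- The inclusion of the positive tensor powers into the ambient space. -/
abbrev ambInr : PosTensor K M →ₗ[K] X.Ambient := LinearMap.inr K H (PosTensor K M)

/-- All terms but the last one of the deconcatenation, on the sum of the positive tensor powers. -/
def posDeconcat : PosTensor K M →ₗ[K] X.Ambient ⊗[K] PosTensor K M :=
  DirectSum.toModule K ℕ _ X.deconcatLeft

/-- The right coaction on the last tensor factor, on the sum of the positive tensor powers. -/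
def posCoact : PosTensor K M →ₗ[K] PosTensor K M ⊗[K] H :=
  DirectSum.toModule K ℕ _ fun n =>
    (DirectSum.lof K ℕ (fun k => TPow K M k) n).rTensor H ∘ₗ X.rightCoact n

theorem posDeconcat_lof (n : ℕ) (w : TPow K M n) :
    X.posDeconcat (DirectSum.lof K ℕ (fun k => TPow K M k) n w) = X.deconcatLeft n w := by
  simp [posDeconcat]

theorem posCoact_lof (n : ℕ) (w : TPow K M n) :
    X.posCoact (DirectSum.lof K ℕ (fun k => TPow K M k) n w) =
      (DirectSum.lof K ℕ (fun k => TPow K M k) n).rTensor H (X.rightCoact n w) := by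
  simp [posCoact]

theorem posDeconcat_ι (m : M) : X.posDeconcat (PosTensor.ι K M m) =
    TensorProduct.map X.ambInl (PosTensor.ι K M) (X.δL m) :=
  X.posDeconcat_lof 0 _

theorem posCoact_ι (m : M) : X.posCoact (PosTensor.ι K M m) =
    (PosTensor.ι K M).rTensor H (X.δR m) := by
  refine (X.posCoact_lof 0 _).trans ?_
  have h : (PosTensor.ι K M).rTensor H = (DirectSum.lof K ℕ (fun k => TPow K M k) 0).rTensor H ∘ₗ
      (TPow.zeroEquiv K M).symm.toLinearMap.rTensor H := LinearMap.rTensor_comp _ _ _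
  rw [h]
  rfl

/-- A cut of `x ⊗ m` either cuts `x` and keeps `m` at the end of the right part, or isolates `m`. -/
theorem posDeconcat_append (x : PosTensor K M) (m : M) :
    X.posDeconcat (PosTensor.append K M (x ⊗ₜ m)) =
      (PosTensor.append K M).lTensor X.Ambient
        (TensorProduct.assoc K X.Ambient (PosTensor K M) M (X.posDeconcat x ⊗ₜ m)) +
      X.ambInr x ⊗ₜ PosTensor.ι K M m := by
  induction x using PosTensor.induction_lof with
  | zero => simp only [TensorProduct.zero_tmul, map_zero, add_zero]
  | lof n w =>
    rw [PosTensor.append_lof, posDeconcat_lof, posDeconcat_lof]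
    simp [deconcatLeft]
    rfl
  | add x y hx hy =>
    simp only [TensorProduct.add_tmul, map_add, hx, hy]
    abel

theorem posCoact_append (x : PosTensor K M) (m : M) :
    X.posCoact (PosTensor.append K M (x ⊗ₜ m)) =
      (PosTensor.append K M).rTensor H
        ((TensorProduct.assoc K (PosTensor K M) M H).symm (x ⊗ₜ X.δR m)) := by
  induction x using PosTensor.induction_lof with
  | zero => simp
  | lof n w =>
    rw [PosTensor.append_lof, posCoact_lof]
    simp only [rightCoact, LinearMap.comp_apply, LinearEquiv.coe_coe, LinearEquiv.apply_symm_apply,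
      LinearMap.lTensor_tmul]
    induction X.δR m using TensorProduct.induction_on with
    | zero => simp
    | tmul y h =>
      simp only [TensorProduct.assoc_symm_tmul, LinearMap.rTensor_tmul, LinearEquiv.coe_coe]
      rw [← PosTensor.append_lof]
    | add x y hx hy => simp_all [TensorProduct.tmul_add]
  | add x y hx hy => simp_all [TensorProduct.add_tmul]

theorem deconcat_inl (h : H) : X.deconcat (X.ambInl h) =
    TensorProduct.map X.ambInl X.ambInl (Coalgebra.comul (R := K) h) := by
  simp [deconcat]

theorem deconcat_inr (x : PosTensor K M) : X.deconcat (X.ambInr x) =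
    X.ambInr.lTensor X.Ambient (X.posDeconcat x) +
      TensorProduct.map X.ambInr X.ambInl (X.posCoact x) := by
  induction x using PosTensor.induction_lof with
  | zero => simp only [map_zero, add_zero]
  | lof n w =>
    rw [X.posDeconcat_lof n w, X.posCoact_lof n w]
    simp only [deconcat, LinearMap.coprod_apply, map_zero, zero_add, LinearMap.coe_inr,
      DirectSum.toModule_lof, LinearMap.add_apply]
    congr 1
    simp only [LinearMap.comp_apply]
    induction X.rightCoact n w using TensorProduct.induction_on with
    | zero => simp
    | tmul y h => rfl
    | add x y hx hy => simp_all
  | add x y hx hy =>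
    simp only [map_add, hx, hy]
    abel

/-- For a single letter this is the compatibility of `δL` and `δR`. In a longer word the coaction
changes only the last letter, which every cut counted here leaves in the right part. -/
theorem posDeconcat_posCoact (x : PosTensor K M) :
    TensorProduct.assoc K X.Ambient (PosTensor K M) H
      (X.posDeconcat.rTensor H (X.posCoact x)) = X.posCoact.lTensor X.Ambient (X.posDeconcat x) := by
  induction x using PosTensor.induction with
  | zero => simp
  | add x y hx hy => simp only [map_add, hx, hy]
  | ι m =>
    rw [posCoact_ι, posDeconcat_ι]
    have h1 := LinearMap.congr_fun X.comm m
    simp only [LinearMap.comp_apply, LinearEquiv.coe_coe] at h1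
    have h2 : ∀ z : M ⊗[K] H, TensorProduct.assoc K X.Ambient (PosTensor K M) H
        (X.posDeconcat.rTensor H ((PosTensor.ι K M).rTensor H z)) =
        TensorProduct.map X.ambInl ((PosTensor.ι K M).rTensor H)
          (TensorProduct.assoc K H M H (X.δL.rTensor H z)) := by
      intro z
      induction z using TensorProduct.induction_on with
      | zero => simp
      | tmul y h =>
        simp only [LinearMap.rTensor_tmul, posDeconcat_ι]
        induction X.δL y using TensorProduct.induction_on with
        | zero => simp
        | tmul y h => simp
        | add x y hx hy => simp_all [TensorProduct.add_tmul]
      | add x y hx hy => simp only [map_add, hx, hy]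
    rw [h2, h1]
    induction X.δL m using TensorProduct.induction_on with
    | zero => simp
    | tmul y h => simp [posCoact_ι]
    | add x y hx hy => simp only [map_add, hx, hy]
  | append x m _ =>
    rw [posCoact_append, posDeconcat_append]
    have h1 : ∀ z : X.Ambient ⊗[K] PosTensor K M,
        X.posCoact.lTensor X.Ambient ((PosTensor.append K M).lTensor X.Ambient
        (TensorProduct.assoc K X.Ambient (PosTensor K M) M (z ⊗ₜ m))) =
        ((PosTensor.append K M).rTensor H).lTensor X.Ambient
          (((TensorProduct.assoc K (PosTensor K M) M H).symm.toLinearMap).lTensor X.Ambient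
          (TensorProduct.assoc K X.Ambient (PosTensor K M) (M ⊗[K] H) (z ⊗ₜ X.δR m))) := by
      intro z
      induction z using TensorProduct.induction_on with
      | zero => simp
      | tmul y h => simp [posCoact_append]
      | add x y hx hy => simp only [map_add, TensorProduct.add_tmul, hx, hy]
    rw [map_add, h1, LinearMap.lTensor_tmul, posCoact_ι]
    induction X.δR m using TensorProduct.induction_on with
    | zero => simp
    | tmul n h =>
      simp only [TensorProduct.assoc_symm_tmul, LinearMap.rTensor_tmul, posDeconcat_append]
      simp only [TensorProduct.add_tmul, map_add, TensorProduct.assoc_tmul]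
      congr 1
      induction X.posDeconcat x using TensorProduct.induction_on with
      | zero => simp
      | tmul y h => simp
      | add x y hx hy => simp only [map_add, TensorProduct.add_tmul, hx, hy]
    | add x y hx hy =>
      simp only [map_add, TensorProduct.tmul_add, hx, hy]
      abel

theorem posCoact_coassoc (x : PosTensor K M) :
    TensorProduct.assoc K (PosTensor K M) H H (X.posCoact.rTensor H (X.posCoact x)) =
      (Coalgebra.comul (R := K)).lTensor (PosTensor K M) (X.posCoact x) := by
  induction x using PosTensor.induction with
  | zero => simp
  | add x y hx hy => simp only [map_add, hx, hy]
  | ι m =>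
    rw [posCoact_ι]
    have h1 := LinearMap.congr_fun X.coassoc_right m
    simp only [LinearMap.comp_apply, LinearEquiv.coe_coe] at h1
    have h2 : ∀ z : M ⊗[K] H, TensorProduct.assoc K (PosTensor K M) H H
        (X.posCoact.rTensor H ((PosTensor.ι K M).rTensor H z)) =
        (PosTensor.ι K M).rTensor (H ⊗[K] H)
          (TensorProduct.assoc K M H H (X.δR.rTensor H z)) := by
      intro z
      induction z using TensorProduct.induction_on with
      | zero => simp
      | tmul y h =>
        simp only [LinearMap.rTensor_tmul, posCoact_ι]
        induction X.δR y using TensorProduct.induction_on with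
        | zero => simp
        | tmul y h => simp
        | add x y hx hy => simp_all [TensorProduct.add_tmul]
      | add x y hx hy => simp only [map_add, hx, hy]
    rw [h2, h1]
    induction X.δR m using TensorProduct.induction_on with
    | zero => simp
    | tmul y h => simp
    | add x y hx hy => simp only [map_add, hx, hy]
  | append x m _ =>
    rw [posCoact_append]
    have h1 := LinearMap.congr_fun X.coassoc_right m
    simp only [LinearMap.comp_apply, LinearEquiv.coe_coe] at h1
    have h2 : ∀ z : M ⊗[K] H, TensorProduct.assoc K (PosTensor K M) H H
        (X.posCoact.rTensor H ((PosTensor.append K M).rTensor H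
          ((TensorProduct.assoc K (PosTensor K M) M H).symm (x ⊗ₜ z)))) =
        (PosTensor.append K M).rTensor (H ⊗[K] H) ((TensorProduct.assoc K (PosTensor K M) M _).symm
          (x ⊗ₜ (TensorProduct.assoc K M H H (X.δR.rTensor H z)))) := by
      intro z
      induction z using TensorProduct.induction_on with
      | zero => simp
      | tmul y h =>
        simp only [LinearMap.rTensor_tmul, posCoact_append, TensorProduct.assoc_symm_tmul]
        induction X.δR y using TensorProduct.induction_on with
        | zero => simp
        | tmul y h => simp
        | add x y hx hy => simp_all [TensorProduct.add_tmul, TensorProduct.tmul_add]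
      | add x y hx hy => simp only [map_add, TensorProduct.tmul_add, hx, hy]
    rw [h2, h1]
    induction X.δR m using TensorProduct.induction_on with
    | zero => simp
    | tmul y h => simp
    | add x y hx hy => simp only [map_add, TensorProduct.tmul_add, hx, hy]

end HopfBimodule

end YangBaxter

namespace YangBaxter

namespace HopfBimodule

variable {K H M : Type*} [Field K] [Ring H] [HopfAlgebra K H] [AddCommGroup M] [Module K M]
  [Module H M] [IsScalarTower K H M] [Module Hᵐᵒᵖ M] [IsScalarTower K Hᵐᵒᵖ M]
  [SMulCommClass H Hᵐᵒᵖ M] (X : HopfBimodule K H M)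

/-! ### The cotensor condition and coassociativity of deconcatenation -/

section Cond

variable {Y Y' : Type*} [AddCommGroup Y] [Module K Y] [AddCommGroup Y'] [Module K Y']

/-- The map `ρ ⊗ id - id ⊗ δL`, whose kernel is the cotensor product of `Y` with `M`. -/
def cotensorCond (ρ : Y →ₗ[K] Y ⊗[K] H) : Y ⊗[K] M →ₗ[K] Y ⊗[K] (H ⊗[K] M) :=
  (TensorProduct.assoc K Y H M).toLinearMap ∘ₗ ρ.rTensor M - X.δL.lTensor Y

theorem cotensorCond_tmul (ρ : Y →ₗ[K] Y ⊗[K] H) (y : Y) (m : M) :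
    X.cotensorCond ρ (y ⊗ₜ m) =
      TensorProduct.assoc K Y H M (ρ y ⊗ₜ m) - y ⊗ₜ X.δL m := by
  simp [cotensorCond]

/-- This passes the condition between a single tensor power and the sum of all of them, through
inclusions as well as components. -/
theorem cotensorCond_naturality {ρ : Y →ₗ[K] Y ⊗[K] H} {ρ' : Y' →ₗ[K] Y' ⊗[K] H} {f : Y →ₗ[K] Y'}
    (h : ρ' ∘ₗ f = f.rTensor H ∘ₗ ρ) (t : Y ⊗[K] M) :
    X.cotensorCond ρ' (f.rTensor M t) = f.rTensor (H ⊗[K] M) (X.cotensorCond ρ t) := by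
  induction t using TensorProduct.induction_on with
  | zero => simp
  | tmul y m =>
    have h1 : ρ' (f y) = f.rTensor H (ρ y) := LinearMap.congr_fun h y
    rw [LinearMap.rTensor_tmul, cotensorCond_tmul, cotensorCond_tmul, h1, map_sub,
      LinearMap.rTensor_tmul]
    congr 1
    induction ρ y using TensorProduct.induction_on with
    | zero => simp
    | tmul y h => simp
    | add x y hx hy => simp only [map_add, TensorProduct.add_tmul, hx, hy]
  | add x y hx hy => simp only [map_add, hx, hy]

/-- The condition touches the last letter only through `δL`, which commutes with `δR`. Consequently
the right coaction on the last letter preserves the kernel that defines the cotensor product. -/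
theorem cotensorCond_δR (ρ : Y →ₗ[K] Y ⊗[K] H) (t : Y ⊗[K] M) :
    (X.cotensorCond ρ).rTensor H ((TensorProduct.assoc K Y M H).symm (X.δR.lTensor Y t)) =
      (TensorProduct.assoc K Y (H ⊗[K] M) H).symm
        (((TensorProduct.assoc K H M H).symm.toLinearMap ∘ₗ X.δR.lTensor H).lTensor Y
          (X.cotensorCond ρ t)) := by
  induction t using TensorProduct.induction_on with
  | zero => simp
  | tmul y m =>
    have h1 := LinearMap.congr_fun X.comm m
    simp only [LinearMap.comp_apply, LinearEquiv.coe_coe] at h1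
    rw [cotensorCond_tmul, map_sub, map_sub, LinearMap.lTensor_tmul, LinearMap.lTensor_tmul,
      LinearMap.comp_apply, ← h1, LinearEquiv.coe_coe, LinearEquiv.symm_apply_apply]
    have h2 : ∀ z : M ⊗[K] H, (X.cotensorCond ρ).rTensor H
        ((TensorProduct.assoc K Y M H).symm (y ⊗ₜ z)) =
        (TensorProduct.assoc K Y H M).toLinearMap.rTensor H
          ((TensorProduct.assoc K (Y ⊗[K] H) M H).symm (ρ y ⊗ₜ z)) -
        (TensorProduct.assoc K Y (H ⊗[K] M) H).symm (y ⊗ₜ X.δL.rTensor H z) := by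
      intro z
      induction z using TensorProduct.induction_on with
      | zero => simp
      | tmul n h => simp [cotensorCond_tmul, TensorProduct.sub_tmul]
      | add x y hx hy =>
        simp only [map_add, TensorProduct.tmul_add, hx, hy]
        abel
    rw [h2]
    congr 1
    induction ρ y using TensorProduct.induction_on with
    | zero => simp
    | tmul y h =>
      simp only [TensorProduct.assoc_tmul, LinearMap.lTensor_tmul, LinearMap.comp_apply]
      induction X.δR m using TensorProduct.induction_on with
      | zero => simp
      | tmul y h => simp
      | add x y hx hy => simp only [map_add, TensorProduct.tmul_add, hx, hy]
    | add x y hx hy => simp only [map_add, TensorProduct.add_tmul, hx, hy]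
  | add x y hx hy => simp only [map_add, hx, hy]

end Cond

theorem mem_cotensorPow_zero (w : TPow K M 0) : w ∈ X.cotensorPow 0 := by
  rw [cotensorPow]; exact Submodule.mem_top

theorem mem_cotensorPow_succ {n : ℕ} {u : TPow K M (n + 1)} :
    u ∈ X.cotensorPow (n + 1) ↔ ∃ t : X.cotensorPow n ⊗[K] M,
      (X.cotensorPow n).subtype.rTensor M t = TPow.succEquiv K M n u ∧
        X.cotensorCond (X.rightCoact n) ((X.cotensorPow n).subtype.rTensor M t) = 0 := by
  rw [cotensorPow, Submodule.mem_comap, Submodule.mem_inf, LinearMap.mem_range]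
  constructor
  · rintro ⟨⟨t, ht⟩, h⟩
    exact ⟨t, ht, by rw [ht]; exact h⟩
  · rintro ⟨t, ht, h⟩
    exact ⟨⟨t, ht⟩, by rw [ht] at h; exact h⟩

/-- The sum of the positive cotensor powers. -/
abbrev CotPos : Type _ := ⨁ n : ℕ, X.cotensorPow n

/-- The inclusion of the positive cotensor powers into the positive tensor powers. -/
def posIncl : X.CotPos →ₗ[K] PosTensor K M := DirectSum.lmap fun n => (X.cotensorPow n).subtype

/-- The inclusion of a cotensor power. -/
abbrev cotLof (n : ℕ) : X.cotensorPow n →ₗ[K] X.CotPos :=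
  DirectSum.lof K ℕ (fun k => X.cotensorPow k) n

/-- The inclusion of a tensor power. -/
abbrev tpowLof (n : ℕ) : TPow K M n →ₗ[K] PosTensor K M :=
  DirectSum.lof K ℕ (fun k => TPow K M k) n

theorem incl_apply (x : X.Cotensor) : X.incl x = (x.1, X.posIncl x.2) := rfl

theorem posIncl_cotLof (n : ℕ) (w : X.cotensorPow n) :
    X.posIncl (X.cotLof n w) = tpowLof n (w : TPow K M n) :=
  DirectSum.lmap_lof _ _ _

theorem posIncl_comp_cotLof (n : ℕ) :
    X.posIncl ∘ₗ X.cotLof n = tpowLof n ∘ₗ (X.cotensorPow n).subtype :=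
  LinearMap.ext (X.posIncl_cotLof n)

theorem posIncl_injective : Function.Injective X.posIncl :=
  (DirectSum.lmap_injective _).mpr fun _ => Submodule.injective_subtype _

theorem incl_injective : Function.Injective X.incl := by
  intro x y h
  rw [incl_apply, incl_apply, Prod.mk.injEq] at h
  exact Prod.ext h.1 (X.posIncl_injective h.2)

theorem mem_range_posIncl {x : PosTensor K M} (h : ∀ n, x n ∈ X.cotensorPow n) :
    x ∈ LinearMap.range X.posIncl := by
  classical
  rw [← DirectSum.sum_support_of x]
  exact Submodule.sum_mem _ fun n _ => ⟨X.cotLof n ⟨x n, h n⟩, X.posIncl_cotLof n _⟩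

theorem CotPos.induction {P : X.CotPos → Prop} (zero : P 0)
    (add : ∀ x y, P x → P y → P (x + y)) (lof : ∀ n w, P (X.cotLof n w)) (x : X.CotPos) : P x :=
  DirectSum.induction_on x zero lof add

theorem posCoact_comp_lof (n : ℕ) :
    X.posCoact ∘ₗ tpowLof n = (tpowLof n).rTensor H ∘ₗ X.rightCoact n :=
  LinearMap.ext (X.posCoact_lof n)

theorem component_posCoact (n : ℕ) (x : PosTensor K M) :
    (DirectSum.component K ℕ (fun k => TPow K M k) n).rTensor H (X.posCoact x) =
      X.rightCoact n (DirectSum.component K ℕ (fun k => TPow K M k) n x) := by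
  induction x using PosTensor.induction_lof with
  | zero => simp only [map_zero]
  | add x y hx hy => simp only [map_add, hx, hy]
  | lof k w =>
    rw [posCoact_lof, DirectSum.component.of, ← LinearMap.comp_apply, ← LinearMap.rTensor_comp]
    by_cases h : k = n
    · subst h
      have h1 : DirectSum.component K ℕ (fun k => TPow K M k) k ∘ₗ
          DirectSum.lof K ℕ (fun k => TPow K M k) k = LinearMap.id :=
        DirectSum.component_comp_lof_same ..
      rw [h1]
      simp
    · have h1 : DirectSum.component K ℕ (fun k => TPow K M k) n ∘ₗ
          DirectSum.lof K ℕ (fun k => TPow K M k) k = 0 := by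
        ext w
        rw [LinearMap.comp_apply, DirectSum.component.of, dif_neg h, LinearMap.zero_apply]
      rw [h1, dif_neg h]
      simp

/-- Membership is tested in each degree. Taking components commutes with the coaction, so each
component of `t` satisfies its own cotensor condition. -/
theorem append_mem_range {t : X.CotPos ⊗[K] M}
    (h : X.cotensorCond X.posCoact (X.posIncl.rTensor M t) = 0) :
    PosTensor.append K M (X.posIncl.rTensor M t) ∈ LinearMap.range X.posIncl := by
  refine X.mem_range_posIncl fun n => ?_
  cases n with
  | zero => exact X.mem_cotensorPow_zero _
  | succ n =>
    have h1 : (DirectSum.component K ℕ (fun k => TPow K M k) n).rTensor M (X.posIncl.rTensor M t) =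
        (X.cotensorPow n).subtype.rTensor M
          ((DirectSum.component K ℕ (fun k => X.cotensorPow k) n).rTensor M t) := by
      rw [← LinearMap.comp_apply, ← LinearMap.comp_apply, ← LinearMap.rTensor_comp,
        ← LinearMap.rTensor_comp]
      rfl
    have h2 := LinearMap.congr_fun (PosTensor.component_succ_append (K := K) (M := M) n)
      (X.posIncl.rTensor M t)
    rw [mem_cotensorPow_succ]
    refine ⟨(DirectSum.component K ℕ (fun k => X.cotensorPow k) n).rTensor M t, ?_, ?_⟩
    · rw [← h1, ← LinearEquiv.symm_apply_eq]
      exact h2.symm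
    · rw [← h1, X.cotensorCond_naturality (ρ := X.posCoact)
        (LinearMap.ext fun x => (X.component_posCoact n x).symm), h, map_zero]

/-- Every element of `M^{□ (n+2)}` comes from an element of `M^{□ (n+1)} ⊗ M`. -/
theorem exists_eq_append {n : ℕ} (u : X.cotensorPow (n + 1)) :
    ∃ t : X.cotensorPow n ⊗[K] M,
      (X.cotensorPow n).subtype.rTensor M t = TPow.succEquiv K M n u ∧
      X.posIncl (X.cotLof (n + 1) u) =
        PosTensor.append K M (X.posIncl.rTensor M ((X.cotLof n).rTensor M t)) ∧
      X.cotensorCond (X.rightCoact n) ((X.cotensorPow n).subtype.rTensor M t) = 0 ∧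
      X.cotensorCond X.posCoact (X.posIncl.rTensor M ((X.cotLof n).rTensor M t)) = 0 := by
  obtain ⟨t, ht, hc⟩ := X.mem_cotensorPow_succ.mp u.2
  have h1 : X.posIncl.rTensor M ((X.cotLof n).rTensor M t) =
      (tpowLof n).rTensor M ((X.cotensorPow n).subtype.rTensor M t) := by
    rw [← LinearMap.comp_apply, ← LinearMap.comp_apply, ← LinearMap.rTensor_comp,
      ← LinearMap.rTensor_comp, posIncl_comp_cotLof]
  refine ⟨t, ht, ?_, hc, ?_⟩
  · rw [h1, ht, posIncl_cotLof]
    have h2 := LinearMap.congr_fun (PosTensor.append_comp_rTensor_lof (K := K) (M := M) n)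
      (TPow.succEquiv K M n u)
    refine Eq.trans ?_ h2.symm
    rw [LinearMap.comp_apply, LinearEquiv.coe_coe, LinearEquiv.symm_apply_apply]
  · rw [h1, X.cotensorCond_naturality (X.posCoact_comp_lof n), hc, map_zero]

/-- The failure of coassociativity of deconcatenation, in the last factor `M ⊕ M^{⊗ 2} ⊕ ⋯`. -/
def coassocDefect : PosTensor K M →ₗ[K] X.Ambient ⊗[K] (X.Ambient ⊗[K] PosTensor K M) :=
  (TensorProduct.assoc K X.Ambient X.Ambient (PosTensor K M)).toLinearMap ∘ₗ
    X.deconcat.rTensor (PosTensor K M) ∘ₗ X.posDeconcat -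
  X.posDeconcat.lTensor X.Ambient ∘ₗ X.posDeconcat

theorem coassocDefect_apply (x : PosTensor K M) : X.coassocDefect x =
    TensorProduct.assoc K X.Ambient X.Ambient (PosTensor K M)
      (X.deconcat.rTensor (PosTensor K M) (X.posDeconcat x)) -
    X.posDeconcat.lTensor X.Ambient (X.posDeconcat x) := rfl

theorem coassocDefect_ι (m : M) : X.coassocDefect (PosTensor.ι K M m) = 0 := by
  rw [coassocDefect_apply, posDeconcat_ι, sub_eq_zero]
  have h1 := LinearMap.congr_fun X.coassoc_left m
  simp only [LinearMap.comp_apply, LinearEquiv.coe_coe] at h1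
  have h2 : ∀ z : H ⊗[K] M, X.posDeconcat.lTensor X.Ambient
      (TensorProduct.map X.ambInl (PosTensor.ι K M) z) =
      TensorProduct.map X.ambInl (TensorProduct.map X.ambInl (PosTensor.ι K M))
        (X.δL.lTensor H z) := by
    intro z
    induction z using TensorProduct.induction_on with
    | zero => simp
    | tmul h y =>
      simp only [TensorProduct.map_tmul, LinearMap.lTensor_tmul, posDeconcat_ι]
    | add x y hx hy => simp only [map_add, hx, hy]
  rw [h2, ← h1]
  induction X.δL m using TensorProduct.induction_on with
  | zero => simp
  | tmul h y =>
    simp only [TensorProduct.map_tmul, LinearMap.rTensor_tmul, deconcat_inl]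
    induction Coalgebra.comul (R := K) h using TensorProduct.induction_on with
    | zero => simp
    | tmul h k => simp
    | add x y hx hy => simp only [map_add, TensorProduct.add_tmul, hx, hy]
  | add x y hx hy => simp only [map_add, hx, hy]

/-- The two iterated deconcatenations of `x ⊗ m` differ in two ways. One is inherited from `x`. The
other occurs at the junction before `m`, where one iteration produces the right coaction of `x` and
the other produces `δL(m)`. This second difference is exactly the map defining the cotensor product.
-/
theorem coassocDefect_append (t : PosTensor K M ⊗[K] M) :
    X.coassocDefect (PosTensor.append K M t) =
      ((PosTensor.append K M).lTensor X.Ambient ∘ₗ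
        (TensorProduct.assoc K X.Ambient (PosTensor K M) M).toLinearMap).lTensor X.Ambient
        (TensorProduct.assoc K X.Ambient (X.Ambient ⊗[K] PosTensor K M) M
          (X.coassocDefect.rTensor M t)) +
      TensorProduct.map X.ambInr (TensorProduct.map X.ambInl (PosTensor.ι K M))
        (X.cotensorCond X.posCoact t) := by
  induction t using TensorProduct.induction_on with
  | zero => simp
  | add x y hx hy =>
    simp only [map_add, hx, hy]
    abel
  | tmul x m =>
    rw [coassocDefect_apply, posDeconcat_append, LinearMap.rTensor_tmul, coassocDefect_apply,
      cotensorCond_tmul]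
    simp only [map_add, map_sub, TensorProduct.sub_tmul, LinearMap.lTensor_tmul,
      LinearMap.rTensor_tmul, posDeconcat_ι, deconcat_inr, TensorProduct.add_tmul,
      TensorProduct.map_tmul]
    have h1 : ∀ z : X.Ambient ⊗[K] PosTensor K M,
        TensorProduct.assoc K X.Ambient X.Ambient (PosTensor K M)
          (X.deconcat.rTensor (PosTensor K M) ((PosTensor.append K M).lTensor X.Ambient
            (TensorProduct.assoc K X.Ambient (PosTensor K M) M (z ⊗ₜ m)))) =
        ((PosTensor.append K M).lTensor X.Ambient ∘ₗ
          (TensorProduct.assoc K X.Ambient (PosTensor K M) M).toLinearMap).lTensor X.Ambient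
          (TensorProduct.assoc K X.Ambient (X.Ambient ⊗[K] PosTensor K M) M
            (TensorProduct.assoc K X.Ambient X.Ambient (PosTensor K M)
              (X.deconcat.rTensor (PosTensor K M) z) ⊗ₜ m)) := by
      intro z
      induction z using TensorProduct.induction_on with
      | zero => simp
      | tmul a y =>
        simp only [TensorProduct.assoc_tmul, LinearMap.lTensor_tmul, LinearMap.rTensor_tmul]
        induction X.deconcat a using TensorProduct.induction_on with
        | zero => simp
        | tmul b c => simp
        | add x y hx hy => simp only [map_add, TensorProduct.add_tmul, hx, hy]
      | add x y hx hy => simp only [map_add, TensorProduct.add_tmul, hx, hy]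
    have h2 : ∀ z : X.Ambient ⊗[K] PosTensor K M,
        X.posDeconcat.lTensor X.Ambient ((PosTensor.append K M).lTensor X.Ambient
            (TensorProduct.assoc K X.Ambient (PosTensor K M) M (z ⊗ₜ m))) =
        ((PosTensor.append K M).lTensor X.Ambient ∘ₗ
          (TensorProduct.assoc K X.Ambient (PosTensor K M) M).toLinearMap).lTensor X.Ambient
          (TensorProduct.assoc K X.Ambient (X.Ambient ⊗[K] PosTensor K M) M
            (X.posDeconcat.lTensor X.Ambient z ⊗ₜ m)) +
        TensorProduct.assoc K X.Ambient X.Ambient (PosTensor K M)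
          (X.ambInr.lTensor X.Ambient z ⊗ₜ PosTensor.ι K M m) := by
      intro z
      induction z using TensorProduct.induction_on with
      | zero => simp
      | tmul a y =>
        simp only [TensorProduct.assoc_tmul, LinearMap.lTensor_tmul, posDeconcat_append,
          TensorProduct.tmul_add, LinearMap.comp_apply, LinearEquiv.coe_coe]
      | add x y hx hy =>
        simp only [map_add, TensorProduct.add_tmul, hx, hy]
        abel
    have h3 : ∀ z : PosTensor K M ⊗[K] H,
        TensorProduct.assoc K X.Ambient X.Ambient (PosTensor K M)
          (TensorProduct.map X.ambInr X.ambInl z ⊗ₜ PosTensor.ι K M m) =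
        TensorProduct.map X.ambInr (TensorProduct.map X.ambInl (PosTensor.ι K M))
          (TensorProduct.assoc K (PosTensor K M) H M (z ⊗ₜ m)) := by
      intro z
      induction z using TensorProduct.induction_on with
      | zero => simp
      | tmul a y =>
        simp only [TensorProduct.assoc_tmul, TensorProduct.map_tmul]
      | add x y hx hy => simp only [map_add, TensorProduct.add_tmul, hx, hy]
    rw [h1 (X.posDeconcat x), h2 (X.posDeconcat x)]
    simp only [h3]
    abel

/-- In degree one this is the left comodule axiom. In the induction step the junction term vanishes
by the cotensor condition, and the inherited term by the induction hypothesis in the first factor.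
-/
theorem coassocDefect_posIncl (x : X.CotPos) : X.coassocDefect (X.posIncl x) = 0 := by
  induction x using CotPos.induction with
  | zero => simp only [map_zero]
  | add x y hx hy => simp only [map_add, hx, hy, add_zero]
  | lof n w =>
    induction n with
    | zero =>
      rw [posIncl_cotLof]
      exact X.coassocDefect_ι _
    | succ n ih =>
      obtain ⟨t, -, h1, -, h2⟩ := X.exists_eq_append w
      rw [h1, coassocDefect_append, h2]
      have h3 : X.coassocDefect ∘ₗ X.posIncl ∘ₗ X.cotLof n = 0 := LinearMap.ext ih
      rw [← LinearMap.comp_apply (X.posIncl.rTensor M), ← LinearMap.comp_apply,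
        ← LinearMap.rTensor_comp, ← LinearMap.rTensor_comp, h3]
      simp

/-- Deconcatenation is coassociative on the cotensor powers. -/
theorem deconcat_coassoc (x : X.Cotensor) :
    TensorProduct.assoc K X.Ambient X.Ambient X.Ambient
      (X.deconcat.rTensor X.Ambient (X.deconcat (X.incl x))) =
    X.deconcat.lTensor X.Ambient (X.deconcat (X.incl x)) := by
  obtain ⟨h, x⟩ := x
  have h0 : X.incl (h, x) = X.ambInl h + X.ambInr (X.posIncl x) := by
    simp [incl_apply]
  rw [h0]
  simp only [map_add]
  congr 1
  · rw [deconcat_inl]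
    have h1 := Coalgebra.coassoc_apply (R := K) h
    have h2 : ∀ z : H ⊗[K] H, X.deconcat.lTensor X.Ambient (TensorProduct.map X.ambInl X.ambInl z) =
        TensorProduct.map X.ambInl (TensorProduct.map X.ambInl X.ambInl)
          ((Coalgebra.comul (R := K)).lTensor H z) := by
      intro z
      induction z using TensorProduct.induction_on with
      | zero => simp
      | tmul a b => simp only [TensorProduct.map_tmul, LinearMap.lTensor_tmul, deconcat_inl]
      | add x y hx hy => simp only [map_add, hx, hy]
    rw [h2, ← h1]
    induction Coalgebra.comul (R := K) h using TensorProduct.induction_on with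
    | zero => simp
    | tmul a b =>
      simp only [TensorProduct.map_tmul, LinearMap.rTensor_tmul, deconcat_inl]
      induction Coalgebra.comul (R := K) a using TensorProduct.induction_on with
      | zero => simp
      | tmul a b => simp
      | add x y hx hy => simp only [map_add, TensorProduct.add_tmul, hx, hy]
    | add x y hx hy => simp only [map_add, hx, hy]
  -- Terms are sorted by their last legs: `hd` handles a last leg of positive degree, `hC` a last
  -- leg in `H` with a middle leg of positive degree, and `hR` the case where both are in `H`.
  · have hd := X.coassocDefect_posIncl x
    rw [coassocDefect_apply, sub_eq_zero] at hd
    have hR := X.posCoact_coassoc (X.posIncl x)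
    have hC := X.posDeconcat_posCoact (X.posIncl x)
    generalize X.posIncl x = y at hd hR hC
    rw [deconcat_inr]
    simp only [map_add]
    have h1 : ∀ z : X.Ambient ⊗[K] PosTensor K M,
        TensorProduct.assoc K X.Ambient X.Ambient X.Ambient
          (X.deconcat.rTensor X.Ambient (X.ambInr.lTensor X.Ambient z)) =
        (X.ambInr.lTensor X.Ambient).lTensor X.Ambient
          (TensorProduct.assoc K X.Ambient X.Ambient (PosTensor K M)
            (X.deconcat.rTensor (PosTensor K M) z)) := by
      intro z
      induction z using TensorProduct.induction_on with
      | zero => simp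
      | tmul a b =>
        simp only [LinearMap.lTensor_tmul, LinearMap.rTensor_tmul]
        induction X.deconcat a using TensorProduct.induction_on with
        | zero => simp
        | tmul a b => simp
        | add x y hx hy => simp only [map_add, TensorProduct.add_tmul, hx, hy]
      | add x y hx hy => simp only [map_add, hx, hy]
    have h2 : ∀ z : X.Ambient ⊗[K] PosTensor K M,
        X.deconcat.lTensor X.Ambient (X.ambInr.lTensor X.Ambient z) =
        (X.ambInr.lTensor X.Ambient).lTensor X.Ambient (X.posDeconcat.lTensor X.Ambient z) +
        (TensorProduct.map X.ambInr X.ambInl).lTensor X.Ambient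
          (X.posCoact.lTensor X.Ambient z) := by
      intro z
      induction z using TensorProduct.induction_on with
      | zero => simp
      | tmul a b => simp only [LinearMap.lTensor_tmul, deconcat_inr, TensorProduct.tmul_add]
      | add x y hx hy =>
        simp only [map_add, hx, hy]
        abel
    have h3 : ∀ z : PosTensor K M ⊗[K] H,
        X.deconcat.lTensor X.Ambient (TensorProduct.map X.ambInr X.ambInl z) =
        TensorProduct.map X.ambInr (TensorProduct.map X.ambInl X.ambInl)
          ((Coalgebra.comul (R := K)).lTensor (PosTensor K M) z) := by
      intro z
      induction z using TensorProduct.induction_on with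
      | zero => simp
      | tmul a b => simp only [LinearMap.lTensor_tmul, TensorProduct.map_tmul, deconcat_inl]
      | add x y hx hy => simp only [map_add, hx, hy]
    have h4 : ∀ z : PosTensor K M ⊗[K] H,
        TensorProduct.assoc K X.Ambient X.Ambient X.Ambient
          (X.deconcat.rTensor X.Ambient (TensorProduct.map X.ambInr X.ambInl z)) =
        (TensorProduct.map X.ambInr X.ambInl).lTensor X.Ambient
          (TensorProduct.assoc K X.Ambient (PosTensor K M) H (X.posDeconcat.rTensor H z)) +
        TensorProduct.map X.ambInr (TensorProduct.map X.ambInl X.ambInl)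
          (TensorProduct.assoc K (PosTensor K M) H H (X.posCoact.rTensor H z)) := by
      intro z
      induction z using TensorProduct.induction_on with
      | zero => simp
      | tmul a b =>
        simp only [LinearMap.rTensor_tmul, TensorProduct.map_tmul, deconcat_inr,
          TensorProduct.add_tmul, map_add]
        congr 1
        · induction X.posDeconcat a using TensorProduct.induction_on with
          | zero => simp
          | tmul a b => simp
          | add x y hx hy => simp only [map_add, TensorProduct.add_tmul, hx, hy]
        · induction X.posCoact a using TensorProduct.induction_on with
          | zero => simp
          | tmul a b => simp
          | add x y hx hy => simp only [map_add, TensorProduct.add_tmul, hx, hy]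
      | add x y hx hy =>
        simp only [map_add, hx, hy]
        abel
    rw [h1, h2, h3, h4, hd, hR, hC]
    abel

end HopfBimodule

end YangBaxter

namespace YangBaxter

/-! ### Deconcatenation preserves the cotensor powers -/

section TensorMap

variable {K A A' B C C' D E E' : Type*} [CommRing K] [AddCommMonoid A] [Module K A]
  [AddCommMonoid A'] [Module K A'] [AddCommMonoid B] [Module K B] [AddCommMonoid C] [Module K C]
  [AddCommMonoid C'] [Module K C'] [AddCommMonoid D] [Module K D] [AddCommMonoid E] [Module K E]
  [AddCommMonoid E'] [Module K E']

theorem map_map_eq_lTensor {f : A' →ₗ[K] B} {f' : A →ₗ[K] A'} {f'' : A →ₗ[K] B}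
    (hf : f ∘ₗ f' = f'') {g : C' →ₗ[K] D} {g' : C →ₗ[K] C'} {a : E →ₗ[K] D} {b : E' →ₗ[K] E}
    {c : C →ₗ[K] E'} (hg : g ∘ₗ g' = a ∘ₗ b ∘ₗ c) (s : A ⊗[K] C) :
    TensorProduct.map f g (TensorProduct.map f' g' s) =
      a.lTensor B (TensorProduct.map f'' b (c.lTensor A s)) := by
  rw [← LinearMap.comp_apply, ← TensorProduct.map_comp, hf, hg]
  induction s using TensorProduct.induction_on with
  | zero => simp
  | tmul x y => simp
  | add x y hx hy => simp only [map_add, hx, hy]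

theorem map_map_eq_rTensor {f : A' →ₗ[K] B} {f' : A →ₗ[K] A'} {a : E →ₗ[K] B} {b : E' →ₗ[K] E}
    {c : A →ₗ[K] E'} (hf : f ∘ₗ f' = a ∘ₗ b ∘ₗ c) {g : C' →ₗ[K] D} {g' : C →ₗ[K] C'}
    {g'' : C →ₗ[K] D} (hg : g ∘ₗ g' = g'') (s : A ⊗[K] C) :
    TensorProduct.map f g (TensorProduct.map f' g' s) =
      TensorProduct.map a g'' (b.rTensor C (c.rTensor C s)) := by
  rw [← LinearMap.comp_apply, ← TensorProduct.map_comp, hf, hg]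
  induction s using TensorProduct.induction_on with
  | zero => simp
  | tmul x y => simp
  | add x y hx hy => simp only [map_add, hx, hy]

end TensorMap

namespace HopfBimodule

variable {K H M : Type*} [Field K] [Ring H] [HopfAlgebra K H] [AddCommGroup M] [Module K M]
  [Module H M] [IsScalarTower K H M] [Module Hᵐᵒᵖ M] [IsScalarTower K Hᵐᵒᵖ M]
  [SMulCommClass H Hᵐᵒᵖ M] (X : HopfBimodule K H M)

/-- The right coaction on the last factor restricts to the cotensor powers. -/
theorem rightCoact_mem_range {n : ℕ} (u : X.cotensorPow n) :
    X.rightCoact n u ∈ LinearMap.range ((X.cotensorPow n).subtype.rTensor H) := by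
  cases n with
  | zero =>
    have h : Function.Surjective ((X.cotensorPow 0).subtype.rTensor H) :=
      LinearMap.rTensor_surjective H fun w => ⟨⟨w, X.mem_cotensorPow_zero w⟩, rfl⟩
    exact h _
  | succ n =>
    obtain ⟨t, h1, -, h2, -⟩ := X.exists_eq_append u
    -- Applying `δR` to the last letter keeps the cotensor condition, so by flatness the result
    -- comes from the kernel tensored with `H`, and this kernel maps into the cotensor power.
    have h3 : (X.cotensorCond (X.rightCoact n) ∘ₗ (X.cotensorPow n).subtype.rTensor M).rTensor H
        ((TensorProduct.assoc K (X.cotensorPow n) M H).symm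
          (X.δR.lTensor (X.cotensorPow n) t)) = 0 := by
      have h4 := X.cotensorCond_δR (X.rightCoact n) ((X.cotensorPow n).subtype.rTensor M t)
      rw [h2, map_zero, map_zero] at h4
      rw [← h4, LinearMap.rTensor_comp, LinearMap.comp_apply]
      congr 1
      generalize t = t
      induction t using TensorProduct.induction_on with
      | zero => simp
      | tmul y m =>
        simp only [LinearMap.rTensor_tmul, LinearMap.lTensor_tmul]
        induction X.δR m using TensorProduct.induction_on with
        | zero => simp
        | tmul y h => simp
        | add x y hx hy => simp only [map_add, TensorProduct.tmul_add, hx, hy]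
      | add x y hx hy => simp only [map_add, hx, hy]
    obtain ⟨s, hs⟩ := mem_range_rTensor_ker h3
    obtain ⟨a, ha⟩ := exists_comp_eq_of_range_le (X.cotensorPow (n + 1)).injective_subtype
      (V := LinearMap.ker (X.cotensorCond (X.rightCoact n) ∘ₗ
        (X.cotensorPow n).subtype.rTensor M)) (f := (TPow.succEquiv K M n).symm.toLinearMap ∘ₗ (X.cotensorPow n).subtype.rTensor M ∘ₗ
        (LinearMap.ker (X.cotensorCond (X.rightCoact n) ∘ₗ
          (X.cotensorPow n).subtype.rTensor M)).subtype) (by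
        intro v
        rw [Submodule.range_subtype, mem_cotensorPow_succ]
        refine ⟨v, by simp, v.2⟩)
    refine ⟨a.rTensor H s, ?_⟩
    rw [← LinearMap.comp_apply, ← LinearMap.rTensor_comp, ha, LinearMap.rTensor_comp,
      LinearMap.rTensor_comp, LinearMap.comp_apply, LinearMap.comp_apply, hs]
    rw [rightCoact, LinearMap.comp_apply, LinearMap.comp_apply, LinearMap.comp_apply]
    rw [LinearEquiv.coe_coe (TPow.succEquiv K M n), ← h1]
    congr 1
    generalize t = t
    induction t using TensorProduct.induction_on with
    | zero => simp
    | tmul y m =>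
      simp only [LinearMap.rTensor_tmul, LinearMap.lTensor_tmul, LinearEquiv.coe_coe]
      induction X.δR m using TensorProduct.induction_on with
      | zero => simp
      | tmul y h => simp
      | add x y hx hy => simp only [map_add, TensorProduct.tmul_add, hx, hy]
    | add x y hx hy => simp only [map_add, hx, hy]

/-- The filtration of `T^c_H(M)` by degree. -/
def degFiltration (n : ℕ) : Submodule K X.Cotensor where
  carrier := {x | ∀ k, n ≤ k → x.2 k = 0}
  zero_mem' := fun _ _ => rfl
  add_mem' := fun {x y} hx hy k hk => by
    have h : (x + y).2 k = x.2 k + y.2 k := rfl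
    rw [h, hx k hk, hy k hk, add_zero]
  smul_mem' := fun a x hx k hk => by
    have h : (a • x).2 k = a • x.2 k := rfl
    rw [h, hx k hk, smul_zero]

theorem degFiltration_mono : Monotone X.degFiltration :=
  fun _ _ h _ hx k hk => hx k (h.trans hk)

theorem inl_mem_degFiltration (n : ℕ) (h : H) : LinearMap.inl K H X.CotPos h ∈ X.degFiltration n :=
  fun _ _ => rfl

theorem inr_mem_degFiltration (n : ℕ) (w : X.cotensorPow n) :
    LinearMap.inr K H X.CotPos (X.cotLof n w) ∈ X.degFiltration (n + 1) := by
  intro k hk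
  exact DirectSum.of_eq_of_ne (β := fun k => X.cotensorPow k) n k w (by omega)

/-- The inclusion of a cotensor power in the filtration by degree. -/
def cotToFiltration (n : ℕ) : X.cotensorPow n →ₗ[K] X.degFiltration (n + 1) :=
  LinearMap.codRestrict (X.degFiltration (n + 1)) (LinearMap.inr K H X.CotPos ∘ₗ X.cotLof n)
    fun w => X.inr_mem_degFiltration n w

theorem exists_mem_degFiltration (x : X.Cotensor) : ∃ n, x ∈ X.degFiltration n := by
  obtain ⟨h, x⟩ := x
  induction x using CotPos.induction with
  | zero => exact ⟨0, X.inl_mem_degFiltration 0 h⟩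
  | lof n w =>
    refine ⟨n + 1, ?_⟩
    have := add_mem (X.inl_mem_degFiltration (n + 1) h) (X.inr_mem_degFiltration n w)
    simpa using this
  | add x y hx hy =>
    obtain ⟨n, hn⟩ := hx
    obtain ⟨m, hm⟩ := hy
    refine ⟨max n m, fun k hk => ?_⟩
    have h1 : (h, x + y).2 k = x k + y k := rfl
    rw [h1, show x k = 0 from hn k (le_of_max_le_left hk),
      show y k = 0 from hm k (le_of_max_le_right hk), add_zero]

/-- The inclusion of `M` into the sum of the positive cotensor powers. -/
def cotι : M →ₗ[K] X.CotPos :=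
  X.cotLof 0 ∘ₗ LinearMap.codRestrict (X.cotensorPow 0) (TPow.zeroEquiv K M).symm.toLinearMap
    X.mem_cotensorPow_zero

theorem posIncl_comp_cotι : X.posIncl ∘ₗ X.cotι = PosTensor.ι K M :=
  LinearMap.ext fun _ => X.posIncl_cotLof 0 _

theorem incl_comp_inl : X.incl ∘ₗ LinearMap.inl K H X.CotPos = X.ambInl := by
  ext h
  · rfl
  · rw [LinearMap.comp_apply, incl_apply]
    simp

/-- The condition at the junction before `m` involves only the right coaction of `x`, with which
cutting `x` commutes. -/
theorem cotensorCond_posDeconcat (t : PosTensor K M ⊗[K] M) :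
    (X.cotensorCond X.posCoact).lTensor X.Ambient
      (TensorProduct.assoc K X.Ambient (PosTensor K M) M (X.posDeconcat.rTensor M t)) =
    TensorProduct.assoc K X.Ambient (PosTensor K M) (H ⊗[K] M)
      (X.posDeconcat.rTensor (H ⊗[K] M) (X.cotensorCond X.posCoact t)) := by
  induction t using TensorProduct.induction_on with
  | zero => simp
  | add x y hx hy => simp only [map_add, hx, hy]
  | tmul x m =>
    rw [cotensorCond_tmul, map_sub, map_sub, LinearMap.rTensor_tmul, LinearMap.rTensor_tmul]
    have h1 : ∀ z : X.Ambient ⊗[K] PosTensor K M, (X.cotensorCond X.posCoact).lTensor X.Ambient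
        (TensorProduct.assoc K X.Ambient (PosTensor K M) M (z ⊗ₜ m)) =
        (TensorProduct.assoc K (PosTensor K M) H M).toLinearMap.lTensor X.Ambient
          (TensorProduct.assoc K X.Ambient (PosTensor K M ⊗[K] H) M
            (X.posCoact.lTensor X.Ambient z ⊗ₜ m)) -
        TensorProduct.assoc K X.Ambient (PosTensor K M) (H ⊗[K] M) (z ⊗ₜ X.δL m) := by
      intro z
      induction z using TensorProduct.induction_on with
      | zero => simp
      | tmul a y => simp [cotensorCond_tmul, TensorProduct.tmul_sub]
      | add x y hx hy =>
        simp only [map_add, TensorProduct.add_tmul, hx, hy]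
        abel
    rw [h1 (X.posDeconcat x), ← posDeconcat_posCoact]
    congr 1
    induction X.posCoact x using TensorProduct.induction_on with
    | zero => simp
    | tmul y h =>
      simp only [LinearMap.rTensor_tmul, TensorProduct.assoc_tmul]
      induction X.posDeconcat y using TensorProduct.induction_on with
      | zero => simp
      | tmul a y => simp
      | add x y hx hy => simp only [map_add, TensorProduct.add_tmul, hx, hy]
    | add x y hx hy => simp only [map_add, TensorProduct.add_tmul, hx, hy]

theorem posDeconcat_append' (t : PosTensor K M ⊗[K] M) :
    X.posDeconcat (PosTensor.append K M t) =
      (PosTensor.append K M).lTensor X.Ambient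
        (TensorProduct.assoc K X.Ambient (PosTensor K M) M (X.posDeconcat.rTensor M t)) +
      TensorProduct.map X.ambInr (PosTensor.ι K M) t := by
  induction t using TensorProduct.induction_on with
  | zero => simp
  | add x y hx hy =>
    simp only [map_add, hx, hy]
    abel
  | tmul x m => exact X.posDeconcat_append x m

set_option maxHeartbeats 400000 in
/-- The deconcatenation of an element of `M^{□ (n+1)}`, without its last term, lies in
`(H ⊕ ⋯ ⊕ M^{□ n}) ⊗ (M ⊕ M^{□ 2} ⊕ ⋯)`. -/
theorem posDeconcat_mem_range {n : ℕ} (u : X.cotensorPow n) :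
    X.posDeconcat (X.posIncl (X.cotLof n u)) ∈ LinearMap.range
      (TensorProduct.map (X.incl ∘ₗ (X.degFiltration n).subtype) X.posIncl) := by
  induction n with
  | zero =>
    have h0 : tpowLof 0 (u : TPow K M 0) = PosTensor.ι K M (TPow.zeroEquiv K M u) := by
      rw [PosTensor.ι, LinearMap.comp_apply, LinearEquiv.coe_coe, LinearEquiv.symm_apply_apply]
    rw [posIncl_cotLof, h0, posDeconcat_ι]
    refine ⟨TensorProduct.map
      ((LinearMap.inl K H X.CotPos).codRestrict (X.degFiltration 0) (X.inl_mem_degFiltration 0)) X.cotι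
      (X.δL (TPow.zeroEquiv K M u)), ?_⟩
    rw [← LinearMap.comp_apply, ← TensorProduct.map_comp, posIncl_comp_cotι, LinearMap.comp_assoc,
      LinearMap.subtype_comp_codRestrict, incl_comp_inl]
  | succ n ih =>
    obtain ⟨t, -, h1, -, h2⟩ := X.exists_eq_append u
    have hi : Function.Injective (X.incl ∘ₗ (X.degFiltration n).subtype) :=
      X.incl_injective.comp (Submodule.injective_subtype _)
    have hm := map_injective hi X.posIncl_injective
    -- The induction hypothesis is upgraded to a linear lift, so that it can be applied to the first
    -- factor of the tensor `t`, which need not be pure.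
    obtain ⟨ℓ, hℓ⟩ : ∃ ℓ : X.cotensorPow n →ₗ[K] X.degFiltration n ⊗[K] X.CotPos,
        TensorProduct.map (X.incl ∘ₗ (X.degFiltration n).subtype) X.posIncl ∘ₗ ℓ =
          X.posDeconcat ∘ₗ X.posIncl ∘ₗ X.cotLof n :=
      exists_comp_eq_of_range_le hm fun v => ih v
    have h3 : X.posDeconcat.rTensor M (X.posIncl.rTensor M ((X.cotLof n).rTensor M t)) =
        (TensorProduct.map (X.incl ∘ₗ (X.degFiltration n).subtype) X.posIncl).rTensor M
          (ℓ.rTensor M t) := by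
      rw [← LinearMap.comp_apply, ← LinearMap.comp_apply, ← LinearMap.comp_apply,
        ← LinearMap.rTensor_comp, ← LinearMap.rTensor_comp, ← LinearMap.rTensor_comp, hℓ,
        LinearMap.comp_assoc]
    have h4 : ∀ z : (X.degFiltration n ⊗[K] X.CotPos) ⊗[K] M,
        TensorProduct.assoc K X.Ambient (PosTensor K M) M
          ((TensorProduct.map (X.incl ∘ₗ (X.degFiltration n).subtype) X.posIncl).rTensor M z) =
        TensorProduct.map (X.incl ∘ₗ (X.degFiltration n).subtype) (X.posIncl.rTensor M)
          (TensorProduct.assoc K _ _ M z) := by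
      intro z
      induction z using TensorProduct.induction_on with
      | zero => simp
      | add x y hx hy => simp only [map_add, hx, hy]
      | tmul z m =>
        induction z using TensorProduct.induction_on with
        | zero => simp
        | add x y hx hy => simp only [map_add, TensorProduct.add_tmul, hx, hy]
        | tmul a y => simp
    -- After a cut, the right part still satisfies the cotensor condition with the letter to be
    -- appended, so appending stays inside the cotensor powers.
    have h5 : (X.cotensorCond X.posCoact ∘ₗ X.posIncl.rTensor M).lTensor (X.degFiltration n)
        (TensorProduct.assoc K _ _ M (ℓ.rTensor M t)) = 0 := by
      apply rTensor_injective hi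
      have h6 := X.cotensorCond_posDeconcat (X.posIncl.rTensor M ((X.cotLof n).rTensor M t))
      rw [h2, map_zero, map_zero, h3, h4] at h6
      rw [map_zero, ← h6, ← LinearMap.comp_apply, ← LinearMap.comp_apply,
        LinearMap.rTensor_comp_lTensor, LinearMap.lTensor_comp_map]
    obtain ⟨s, hs⟩ := mem_range_lTensor_ker h5
    obtain ⟨b, hb⟩ := exists_comp_eq_of_range_le X.posIncl_injective
      (f := PosTensor.append K M ∘ₗ X.posIncl.rTensor M ∘ₗ
        (LinearMap.ker (X.cotensorCond X.posCoact ∘ₗ X.posIncl.rTensor M)).subtype)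
      (fun v => X.append_mem_range v.2)
    rw [h1, posDeconcat_append', h3, h4, ← hs]
    -- Index `k` stands for `M^{□ (k+1)}`, hence `degFiltration n` is `H ⊕ ⋯ ⊕ M^{□ n}`. Cuts inside
    -- the first factor have their left part there; the cut isolating the last letter has its left
    -- part in `M^{□ (n+1)}`, which accounts for the bound `n + 1`.
    refine Submodule.add_mem _
      ⟨TensorProduct.map (Submodule.inclusion (X.degFiltration_mono n.le_succ)) b s, ?_⟩
      ⟨TensorProduct.map (X.cotToFiltration n) X.cotι t, ?_⟩
    · exact map_map_eq_lTensor rfl hb s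
    · have h6 : (X.incl ∘ₗ (X.degFiltration (n + 1)).subtype) ∘ₗ X.cotToFiltration n =
          X.ambInr ∘ₗ X.posIncl ∘ₗ X.cotLof n := rfl
      exact map_map_eq_rTensor h6 X.posIncl_comp_cotι t

end HopfBimodule

end YangBaxter

namespace YangBaxter

/-! ### Filtered coalgebras and coordinates of deconcatenation -/

section Filtration

variable {K C P Q : Type*} [CommRing K] [AddCommGroup C] [Module K C] [Coalgebra K C]
  [AddCommGroup P] [Module K P] [AddCommGroup Q] [Module K Q]

/-- The filtration shifted by one step, starting with zero. -/
def predFiltration (F : ℕ → Submodule K C) : ℕ → Submodule K C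
  | 0 => ⊥
  | n + 1 => F n

/-- An exhaustive filtration of a coalgebra such that
`Δ (F n) ⊆ F (n-1) ⊗ C + F n ⊗ F 0`, where `F (-1) = 0`. -/
structure IsCoalgFiltration (F : ℕ → Submodule K C) : Prop where
  mono : Monotone F
  exhaustive : ∀ c, ∃ n, c ∈ F n
  comul_mem : ∀ n, ∀ c ∈ F n, Coalgebra.comul (R := K) c ∈
    Submodule.map₂ (TensorProduct.mk K C C) (predFiltration F n) ⊤ ⊔
      Submodule.map₂ (TensorProduct.mk K C C) (F n) (F 0)

/-- Each summand in the bound on `Δ (F n)` is killed by one of the two maps. This is the source of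
the finiteness and nilpotency arguments below. -/
theorem IsCoalgFiltration.map_comul_eq_zero {F : ℕ → Submodule K C} (hF : IsCoalgFiltration F)
    {f : C →ₗ[K] P} {g : C →ₗ[K] Q} {n : ℕ} (hf : ∀ c ∈ predFiltration F n, f c = 0)
    (hg : ∀ c ∈ F 0, g c = 0) {c : C} (hc : c ∈ F n) :
    TensorProduct.map f g (Coalgebra.comul (R := K) c) = 0 := by
  have h : Submodule.map₂ (TensorProduct.mk K C C) (predFiltration F n) ⊤ ⊔
      Submodule.map₂ (TensorProduct.mk K C C) (F n) (F 0) ≤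
        LinearMap.ker (TensorProduct.map f g) := by
    refine sup_le (Submodule.map₂_le.mpr fun x hx y _ => ?_)
      (Submodule.map₂_le.mpr fun x _ y hy => ?_)
    · simp [hf x hx]
    · simp [hg y hy]
  exact h (hF.comul_mem n c hc)

theorem map_mem_map₂ {D E : Type*} [AddCommMonoid D] [Module K D] [AddCommMonoid E] [Module K E]
    {f : D →ₗ[K] P} {g : E →ₗ[K] Q} {U : Submodule K P} {V : Submodule K Q}
    (hf : ∀ x, f x ∈ U) (hg : ∀ y, g y ∈ V) (t : D ⊗[K] E) :
    TensorProduct.map f g t ∈ Submodule.map₂ (TensorProduct.mk K P Q) U V := by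
  induction t using TensorProduct.induction_on with
  | zero => rw [map_zero]; exact zero_mem _
  | tmul x y => exact Submodule.apply_mem_map₂ _ (hf x) (hg y)
  | add x y hx hy => rw [map_add]; exact add_mem hx hy

end Filtration

theorem map_comul_assoc {K C P Q R : Type*} [CommRing K] [AddCommGroup C] [Module K C]
    [Coalgebra K C] [AddCommMonoid P] [Module K P] [AddCommMonoid Q] [Module K Q]
    [AddCommMonoid R] [Module K R] (f : C →ₗ[K] P) (g : C →ₗ[K] Q) (h : C →ₗ[K] R) (c : C) :
    TensorProduct.assoc K P Q R (TensorProduct.map (TensorProduct.map f g ∘ₗ Coalgebra.comul) h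
      (Coalgebra.comul (R := K) c)) =
    TensorProduct.map f (TensorProduct.map g h ∘ₗ Coalgebra.comul) (Coalgebra.comul (R := K) c) := by
  have h1 : ∀ z : C ⊗[K] C, TensorProduct.assoc K P Q R
      (TensorProduct.map (TensorProduct.map f g ∘ₗ Coalgebra.comul) h z) =
      TensorProduct.map f (TensorProduct.map g h) (TensorProduct.assoc K C C C
        (Coalgebra.comul.rTensor C z)) := by
    intro z
    induction z using TensorProduct.induction_on with
    | zero => simp
    | add x y hx hy => simp only [map_add, hx, hy]
    | tmul x y =>
      simp only [TensorProduct.map_tmul, LinearMap.rTensor_tmul, LinearMap.comp_apply]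
      induction Coalgebra.comul (R := K) x using TensorProduct.induction_on with
      | zero => simp
      | tmul x y => simp
      | add x y hx hy => simp only [map_add, TensorProduct.add_tmul, hx, hy]
  rw [h1, Coalgebra.coassoc_apply, ← LinearMap.comp_apply, LinearMap.map_comp_lTensor]

namespace HopfBimodule

variable {K H M : Type*} [Field K] [Ring H] [HopfAlgebra K H] [AddCommGroup M] [Module K M]
  [Module H M] [IsScalarTower K H M] [Module Hᵐᵒᵖ M] [IsScalarTower K Hᵐᵒᵖ M]
  [SMulCommClass H Hᵐᵒᵖ M] (X : HopfBimodule K H M)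

variable (K M) in
/-- The component in `M` of an element of the sum of the positive tensor powers. -/
def posDegOne : PosTensor K M →ₗ[K] M :=
  (TPow.zeroEquiv K M).toLinearMap ∘ₗ DirectSum.component K ℕ (fun k => TPow K M k) 0

theorem posDegOne_ι (m : M) : posDegOne K M (PosTensor.ι K M m) = m := by
  simp [posDegOne, PosTensor.ι, DirectSum.component.lof_self]

theorem posDegOne_append (t : PosTensor K M ⊗[K] M) :
    posDegOne K M (PosTensor.append K M t) = 0 := by
  have h := LinearMap.congr_fun (PosTensor.component_zero_append (K := K) (M := M)) t
  rw [LinearMap.comp_apply] at h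
  rw [posDegOne, LinearMap.comp_apply, h, LinearMap.zero_apply, map_zero]

theorem fst_posDegOne_posDeconcat (x : PosTensor K M) :
    TensorProduct.map (LinearMap.fst K H (PosTensor K M)) (posDegOne K M) (X.posDeconcat x) =
      X.δL (posDegOne K M x) := by
  induction x using PosTensor.induction with
  | zero => simp only [map_zero]
  | add x y hx hy => simp only [map_add, hx, hy]
  | ι m =>
    rw [posDeconcat_ι, posDegOne_ι]
    induction X.δL m using TensorProduct.induction_on with
    | zero => simp
    | tmul y h => simp [posDegOne_ι]
    | add x y hx hy => simp only [map_add, hx, hy]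
  | append x m _ =>
    rw [posDeconcat_append, posDegOne_append, map_zero, map_add, TensorProduct.map_tmul]
    simp only [LinearMap.coe_inr, LinearMap.fst_apply, TensorProduct.zero_tmul, add_zero]
    induction X.posDeconcat x using TensorProduct.induction_on with
    | zero => simp
    | tmul y h => simp [posDegOne_append]
    | add x y hx hy => simp only [map_add, TensorProduct.add_tmul, hx, hy, add_zero]

theorem snd_posDegOne_posDeconcat_ι (m : M) :
    TensorProduct.map (LinearMap.snd K H (PosTensor K M)) (posDegOne K M)
      (X.posDeconcat (PosTensor.ι K M m)) = 0 := by
  rw [posDeconcat_ι]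
  induction X.δL m using TensorProduct.induction_on with
  | zero => simp
  | tmul y h => simp
  | add x y hx hy => simp only [map_add, hx, hy, add_zero]

theorem snd_posDegOne_posDeconcat_append (x : PosTensor K M) (m : M) :
    TensorProduct.map (LinearMap.snd K H (PosTensor K M)) (posDegOne K M)
      (X.posDeconcat (PosTensor.append K M (x ⊗ₜ m))) = x ⊗ₜ m := by
  rw [posDeconcat_append, map_add, TensorProduct.map_tmul, posDegOne_ι]
  simp only [LinearMap.coe_inr, LinearMap.snd_apply]
  rw [add_eq_right]
  induction X.posDeconcat x using TensorProduct.induction_on with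
  | zero => simp
  | tmul y h => simp [posDegOne_append]
  | add x y hx hy => simp only [map_add, TensorProduct.add_tmul, hx, hy, add_zero]

/-- The cut of a word of length `n + 2` that isolates its last letter recovers the word. This is
what makes a coalgebra map computable from its components. -/
theorem component_posDeconcat (n : ℕ) (x : PosTensor K M) :
    TensorProduct.map (DirectSum.component K ℕ (fun k => TPow K M k) n ∘ₗ
      LinearMap.snd K H (PosTensor K M)) (posDegOne K M) (X.posDeconcat x) =
    TPow.succEquiv K M n (DirectSum.component K ℕ (fun k => TPow K M k) (n + 1) x) := by
  have h : ∀ z : X.Ambient ⊗[K] PosTensor K M,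
      TensorProduct.map (DirectSum.component K ℕ (fun k => TPow K M k) n ∘ₗ
        LinearMap.snd K H (PosTensor K M)) (posDegOne K M) z =
      (DirectSum.component K ℕ (fun k => TPow K M k) n).rTensor M
        (TensorProduct.map (LinearMap.snd K H (PosTensor K M)) (posDegOne K M) z) := by
    intro z
    induction z using TensorProduct.induction_on with
    | zero => simp
    | tmul y h => simp
    | add x y hx hy => simp only [map_add, hx, hy]
  rw [h]
  induction x using PosTensor.induction with
  | zero => simp only [map_zero]
  | add x y hx hy => simp only [map_add, hx, hy]
  | ι m =>
    rw [snd_posDegOne_posDeconcat_ι, PosTensor.ι, LinearMap.comp_apply, DirectSum.component.of,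
      dif_neg (by omega), map_zero, map_zero]
  | append x m _ =>
    rw [snd_posDegOne_posDeconcat_append]
    have h1 := LinearMap.congr_fun (PosTensor.component_succ_append (K := K) (M := M) n) (x ⊗ₜ m)
    rw [LinearMap.comp_apply] at h1
    rw [h1, LinearMap.comp_apply, LinearEquiv.coe_coe, LinearEquiv.apply_symm_apply]

theorem counit_posDeconcat (x : PosTensor K M) :
    TensorProduct.lid K (PosTensor K M) (TensorProduct.map
      (Coalgebra.counit (R := K) ∘ₗ LinearMap.fst K H (PosTensor K M)) LinearMap.id
      (X.posDeconcat x)) = x := by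
  induction x using PosTensor.induction with
  | zero => simp only [map_zero]
  | add x y hx hy => simp only [map_add, hx, hy]
  | ι m =>
    rw [posDeconcat_ι]
    conv_rhs => rw [← X.counit_left m]
    induction X.δL m using TensorProduct.induction_on with
    | zero => simp only [map_zero]
    | tmul y h => simp
    | add x y hx hy => simp only [map_add, hx, hy]
  | append x m hx =>
    rw [posDeconcat_append, map_add, TensorProduct.map_tmul]
    simp only [LinearMap.comp_apply, LinearMap.coe_inr, LinearMap.fst_apply, map_zero,
      TensorProduct.zero_tmul, add_zero]
    conv_rhs => rw [← hx]
    induction X.posDeconcat x using TensorProduct.induction_on with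
    | zero => simp
    | tmul y h => simp [← TensorProduct.smul_tmul']
    | add x y hx hy => simp only [map_add, TensorProduct.add_tmul, hx, hy]

theorem counit_posCoact (x : PosTensor K M) :
    TensorProduct.rid K (PosTensor K M) ((Coalgebra.counit (R := K)).lTensor _
      (X.posCoact x)) = x := by
  induction x using PosTensor.induction with
  | zero => simp only [map_zero]
  | add x y hx hy => simp only [map_add, hx, hy]
  | ι m =>
    rw [posCoact_ι]
    conv_rhs => rw [← X.counit_right m]
    induction X.δR m using TensorProduct.induction_on with
    | zero => simp only [map_zero]
    | tmul y h => simp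
    | add x y hx hy => simp only [map_add, hx, hy]
  | append x m hx =>
    rw [posCoact_append]
    conv_rhs => rw [← X.counit_right m]
    induction X.δR m using TensorProduct.induction_on with
    | zero => simp
    | tmul y h => simp
    | add x y hx hy => simp only [map_add, TensorProduct.tmul_add, hx, hy]

/-- The identification `e` makes the coalgebra `T` the cotensor coalgebra. -/
structure IsCotensorCoalgebra {T : Type*} [AddCommGroup T] [Module K T] [Coalgebra K T]
    (e : T ≃ₗ[K] X.Cotensor) : Prop where
  comul : ∀ x : T,
    TensorProduct.map (X.incl ∘ₗ e.toLinearMap) (X.incl ∘ₗ e.toLinearMap)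
      (Coalgebra.comul (R := K) x) = X.deconcat (X.incl (e x))
  counit : ∀ x : T, Coalgebra.counit (R := K) x = Coalgebra.counit (R := K) (e x).1

end HopfBimodule

end YangBaxter

namespace YangBaxter

/-! ### Components of the cotensor coalgebra and uniqueness of maps into it -/

namespace HopfBimodule

variable {K H M : Type*} [Field K] [Ring H] [HopfAlgebra K H] [AddCommGroup M] [Module K M]
  [Module H M] [IsScalarTower K H M] [Module Hᵐᵒᵖ M] [IsScalarTower K Hᵐᵒᵖ M]
  [SMulCommClass H Hᵐᵒᵖ M] (X : HopfBimodule K H M)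

theorem posDegOne_posCoact (x : PosTensor K M) :
    (posDegOne K M).rTensor H (X.posCoact x) = X.δR (posDegOne K M x) := by
  have h := X.component_posCoact 0 x
  have h1 : (posDegOne K M).rTensor H = (TPow.zeroEquiv K M).toLinearMap.rTensor H ∘ₗ
      (DirectSum.component K ℕ (fun k => TPow K M k) 0).rTensor H := LinearMap.rTensor_comp _ _ _
  rw [h1, LinearMap.comp_apply, h, rightCoact]
  simp only [LinearMap.comp_apply, LinearEquiv.coe_coe, posDegOne]
  induction X.δR _ using TensorProduct.induction_on with
  | zero => simp
  | tmul y h => simp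
  | add x y hx hy => simp only [map_add, hx, hy]

theorem incl_eq (x : X.Cotensor) : X.incl x = X.ambInl x.1 + X.ambInr (X.posIncl x.2) := by
  simp [incl_apply]

theorem map_deconcat_incl {P Q : Type*} [AddCommMonoid P] [Module K P] [AddCommMonoid Q]
    [Module K Q] (f : X.Ambient →ₗ[K] P) (g : X.Ambient →ₗ[K] Q) (x : X.Cotensor) :
    TensorProduct.map f g (X.deconcat (X.incl x)) =
      TensorProduct.map (f ∘ₗ X.ambInl) (g ∘ₗ X.ambInl) (Coalgebra.comul (R := K) x.1) +
      (TensorProduct.map f (g ∘ₗ X.ambInr) (X.posDeconcat (X.posIncl x.2)) +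
      TensorProduct.map (f ∘ₗ X.ambInr) (g ∘ₗ X.ambInl) (X.posCoact (X.posIncl x.2))) := by
  rw [incl_eq, map_add, deconcat_inl, deconcat_inr, map_add, map_add, TensorProduct.map_comp,
    TensorProduct.map_comp, LinearMap.comp_apply, LinearMap.comp_apply]
  congr 2
  rw [← LinearMap.comp_apply, LinearMap.map_comp_lTensor]

variable {T : Type*} [AddCommGroup T] [Module K T]

/-- The component in `H`. -/
def projH (e : T ≃ₗ[K] X.Cotensor) : T →ₗ[K] H := LinearMap.fst K H X.CotPos ∘ₗ e.toLinearMap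

/-- The component in `M`. -/
def projM (e : T ≃ₗ[K] X.Cotensor) : T →ₗ[K] M := X.degOne ∘ₗ e.toLinearMap

/-- The component in `M^{⊗ (n+1)}`. -/
def projPow (e : T ≃ₗ[K] X.Cotensor) (n : ℕ) : T →ₗ[K] TPow K M n :=
  DirectSum.component K ℕ (fun k => TPow K M k) n ∘ₗ X.posIncl ∘ₗ LinearMap.snd K H X.CotPos ∘ₗ
    e.toLinearMap

variable {X} {e : T ≃ₗ[K] X.Cotensor}

theorem ext_projPow {x y : T} (h : X.projH e x = X.projH e y)
    (hn : ∀ n, X.projPow e n x = X.projPow e n y) : x = y := by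
  apply e.injective
  refine Prod.ext h (X.posIncl_injective ?_)
  exact DFinsupp.ext hn

variable [Coalgebra K T]

namespace IsCotensorCoalgebra

variable (he : X.IsCotensorCoalgebra e)

include he

/-- Taking coordinate projections for `f` and `g` yields the relations between coproduct and
components; the terms of the wrong degree vanish. -/
theorem map_comul {P Q : Type*} [AddCommMonoid P] [Module K P] [AddCommMonoid Q]
    [Module K Q] (f : X.Ambient →ₗ[K] P) (g : X.Ambient →ₗ[K] Q) (x : T) :
    TensorProduct.map (f ∘ₗ X.incl ∘ₗ e.toLinearMap) (g ∘ₗ X.incl ∘ₗ e.toLinearMap)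
      (Coalgebra.comul (R := K) x) =
      TensorProduct.map (f ∘ₗ X.ambInl) (g ∘ₗ X.ambInl) (Coalgebra.comul (R := K) (e x).1) +
      (TensorProduct.map f (g ∘ₗ X.ambInr) (X.posDeconcat (X.posIncl (e x).2)) +
      TensorProduct.map (f ∘ₗ X.ambInr) (g ∘ₗ X.ambInl) (X.posCoact (X.posIncl (e x).2))) := by
  rw [← map_deconcat_incl, ← he.comul, TensorProduct.map_comp, LinearMap.comp_apply]

theorem comul_projH (x : T) : TensorProduct.map (X.projH e) (X.projH e)
    (Coalgebra.comul (R := K) x) = Coalgebra.comul (R := K) (X.projH e x) := by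
  have h := he.map_comul (LinearMap.fst K H (PosTensor K M)) (LinearMap.fst K H (PosTensor K M)) x
  rw [LinearMap.fst_comp_inr, LinearMap.fst_comp_inl, TensorProduct.map_zero_right,
    TensorProduct.map_zero_left, TensorProduct.map_id, LinearMap.zero_apply, LinearMap.zero_apply,
    add_zero, add_zero] at h
  exact h

theorem counit_projH (x : T) :
    Coalgebra.counit (R := K) (X.projH e x) = Coalgebra.counit (R := K) x :=
  (he.counit x).symm

theorem projH_projM_comul (x : T) : TensorProduct.map (X.projH e) (X.projM e)
    (Coalgebra.comul (R := K) x) = X.δL (X.projM e x) := by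
  have h := he.map_comul (LinearMap.fst K H (PosTensor K M))
    (posDegOne K M ∘ₗ LinearMap.snd K H (PosTensor K M)) x
  rw [LinearMap.fst_comp_inr, LinearMap.comp_assoc X.ambInl, LinearMap.snd_comp_inl,
    LinearMap.comp_assoc X.ambInr, LinearMap.snd_comp_inr, LinearMap.comp_zero,
    LinearMap.comp_id, TensorProduct.map_zero_left, TensorProduct.map_zero_right,
    LinearMap.zero_apply, LinearMap.zero_apply, zero_add, add_zero,
    fst_posDegOne_posDeconcat] at h
  exact h

theorem projM_projH_comul (x : T) : TensorProduct.map (X.projM e) (X.projH e)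
    (Coalgebra.comul (R := K) x) = X.δR (X.projM e x) := by
  have h := he.map_comul (posDegOne K M ∘ₗ LinearMap.snd K H (PosTensor K M))
    (LinearMap.fst K H (PosTensor K M)) x
  rw [LinearMap.fst_comp_inr, LinearMap.comp_assoc X.ambInl, LinearMap.snd_comp_inl,
    LinearMap.comp_assoc X.ambInr, LinearMap.snd_comp_inr, LinearMap.comp_zero,
    LinearMap.comp_id, TensorProduct.map_zero_left, TensorProduct.map_zero_right,
    LinearMap.zero_apply, LinearMap.zero_apply, zero_add, zero_add, LinearMap.fst_comp_inl] at h
  exact h.trans (X.posDegOne_posCoact _)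

theorem projPow_projM_comul (n : ℕ) (x : T) : TensorProduct.map (X.projPow e n) (X.projM e)
    (Coalgebra.comul (R := K) x) = TPow.succEquiv K M n (X.projPow e (n + 1) x) := by
  have h := he.map_comul (DirectSum.component K ℕ (fun k => TPow K M k) n ∘ₗ
    LinearMap.snd K H (PosTensor K M)) (posDegOne K M ∘ₗ LinearMap.snd K H (PosTensor K M)) x
  rw [LinearMap.comp_assoc X.ambInl, LinearMap.comp_assoc X.ambInl, LinearMap.snd_comp_inl,
    LinearMap.comp_assoc X.ambInr, LinearMap.comp_assoc X.ambInr, LinearMap.snd_comp_inr,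
    LinearMap.comp_zero, LinearMap.comp_zero,
    LinearMap.comp_id, TensorProduct.map_zero_left, TensorProduct.map_zero_right,
    LinearMap.zero_apply, LinearMap.zero_apply, zero_add, add_zero, component_posDeconcat] at h
  exact h

/-- A homomorphism of coalgebras into the cotensor coalgebra is determined by its components in
`H` and in `M`. -/
theorem hom_ext {C : Type*} [AddCommGroup C] [Module K C] [Coalgebra K C] {f g : C →ₗ[K] T}
    (hf : TensorProduct.map f f ∘ₗ Coalgebra.comul = Coalgebra.comul ∘ₗ f)
    (hg : TensorProduct.map g g ∘ₗ Coalgebra.comul = Coalgebra.comul ∘ₗ g)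
    (hH : X.projH e ∘ₗ f = X.projH e ∘ₗ g) (hM : X.projM e ∘ₗ f = X.projM e ∘ₗ g) : f = g := by
  have h : ∀ n, X.projPow e n ∘ₗ f = X.projPow e n ∘ₗ g := by
    intro n
    -- The component in `M^{⊗ (n+2)}` is obtained from the coproduct, which both maps respect, by
    -- taking the components in `M^{⊗ (n+1)}` and `M`.
    induction n with
    | zero =>
      ext c
      apply (TPow.zeroEquiv K M).injective
      exact LinearMap.congr_fun hM c
    | succ n ih =>
      ext c
      apply (TPow.succEquiv K M n).injective
      rw [LinearMap.comp_apply, LinearMap.comp_apply, ← he.projPow_projM_comul,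
        ← he.projPow_projM_comul, ← LinearMap.comp_apply Coalgebra.comul,
        ← LinearMap.comp_apply Coalgebra.comul, ← hf, ← hg, LinearMap.comp_apply,
        LinearMap.comp_apply, ← LinearMap.comp_apply (TensorProduct.map (X.projPow e n) _),
        ← LinearMap.comp_apply (TensorProduct.map (X.projPow e n) _), ← TensorProduct.map_comp,
        ← TensorProduct.map_comp, ih, hM]
  ext c
  exact ext_projPow (LinearMap.congr_fun hH c) fun n => LinearMap.congr_fun (h n) c

end IsCotensorCoalgebra

end HopfBimodule

section LocallyFinite

variable {K C : Type*} [CommRing K] [AddCommGroup C] [Module K C] {W : ℕ → Type*}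
  [∀ n, AddCommGroup (W n)] [∀ n, Module K (W n)]

/-- The bound may depend on `c`. The chosen truncation does not affect the element obtained, so
linearity is checked component by component. -/
theorem exists_directSum_lift (g : ∀ n, C →ₗ[K] W n) (h : ∀ c, ∃ N, ∀ n, N ≤ n → g n c = 0) :
    ∃ φ : C →ₗ[K] ⨁ n, W n, ∀ n, DirectSum.component K ℕ W n ∘ₗ φ = g n := by
  classical
  choose N hN using h
  have hφ : ∀ c n, (DFinsupp.mk (Finset.range (N c)) fun i => g i c : Π₀ n, W n) n = g n c := by
    intro c n
    rw [DFinsupp.mk_apply]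
    split_ifs with hn
    · rfl
    · rw [Finset.mem_range, not_lt] at hn
      exact (hN c n hn).symm
  refine ⟨{ toFun := fun c => (DFinsupp.mk (Finset.range (N c)) fun i => g i c : Π₀ n, W n)
            map_add' := fun x y => DFinsupp.ext fun n => ?_
            map_smul' := fun a x => DFinsupp.ext fun n => ?_ },
    fun n => LinearMap.ext fun c => hφ c n⟩
  · rw [hφ, map_add]
    exact (congrArg₂ (· + ·) (hφ x n) (hφ y n)).symm
  · rw [hφ, map_smul]
    exact (congrArg (a • ·) (hφ x n)).symm

end LocallyFinite

end YangBaxter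

namespace YangBaxter

/-! ### The universal property of the cotensor coalgebra -/

namespace HopfBimodule

variable {K H M : Type*} [Field K] [Ring H] [HopfAlgebra K H] [AddCommGroup M] [Module K M]
  [Module H M] [IsScalarTower K H M] [Module Hᵐᵒᵖ M] [IsScalarTower K Hᵐᵒᵖ M]
  [SMulCommClass H Hᵐᵒᵖ M] {X : HopfBimodule K H M}

variable {C : Type*} [AddCommGroup C] [Module K C] [Coalgebra K C]

/-- The iterated coproduct followed by `f ⊗ ⋯ ⊗ f`. -/
def iterComul (f : C →ₗ[K] M) : (n : ℕ) → (C →ₗ[K] TPow K M n)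
  | 0 => (TPow.zeroEquiv K M).symm.toLinearMap ∘ₗ f
  | n + 1 => (TPow.succEquiv K M n).symm.toLinearMap ∘ₗ
      TensorProduct.map (iterComul f n) f ∘ₗ Coalgebra.comul

theorem iterComul_succ (f : C →ₗ[K] M) (n : ℕ) (c : C) :
    TPow.succEquiv K M n (iterComul f (n + 1) c) =
      TensorProduct.map (iterComul f n) f (Coalgebra.comul (R := K) c) := by
  simp [iterComul]

/-- For `n ≥ 1`, either the last leg lies in `F 0` and is killed by `f`, or the remaining legs come
from an element one step lower in the filtration. Thus each `c` has only finitely many nonzero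
iterated coproducts. -/
theorem iterComul_eq_zero {F : ℕ → Submodule K C} (hF : IsCoalgFiltration F) {f : C →ₗ[K] M}
    (hf : ∀ c ∈ F 0, f c = 0) {n : ℕ} {c : C} (hc : c ∈ F n) : iterComul f n c = 0 := by
  induction n generalizing c with
  | zero => simp [iterComul, hf c hc]
  | succ n ih =>
    apply (TPow.succEquiv K M n).injective
    rw [iterComul_succ, hF.map_comul_eq_zero (n := n + 1) (fun c hc => ih hc) hf hc, map_zero]

variable {f₀ : C →ₗ[K] H} {f₁ : C →ₗ[K] M}

theorem rightCoact_iterComul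
    (hR : ∀ c, TensorProduct.map f₁ f₀ (Coalgebra.comul (R := K) c) = X.δR (f₁ c)) (n : ℕ) (c : C) :
    X.rightCoact n (iterComul f₁ n c) =
      TensorProduct.map (iterComul f₁ n) f₀ (Coalgebra.comul (R := K) c) := by
  cases n with
  | zero =>
    simp only [rightCoact, iterComul, LinearMap.comp_apply, LinearEquiv.coe_coe,
      LinearEquiv.apply_symm_apply, ← hR]
    rw [← LinearMap.comp_apply, LinearMap.rTensor_comp_map]
  | succ n =>
    have h1 : ∀ z : C ⊗[K] C, X.δR.lTensor (TPow K M n) (TensorProduct.map (iterComul f₁ n) f₁ z) =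
        TensorProduct.map (iterComul f₁ n) (TensorProduct.map f₁ f₀ ∘ₗ Coalgebra.comul) z := by
      intro z
      induction z using TensorProduct.induction_on with
      | zero => simp
      | tmul x y => simp [hR]
      | add x y hx hy => simp only [map_add, hx, hy]
    rw [rightCoact, LinearMap.comp_apply, LinearMap.comp_apply, LinearMap.comp_apply]
    simp only [LinearEquiv.coe_coe]
    rw [iterComul_succ, h1, ← map_comul_assoc, LinearEquiv.symm_apply_apply, ← LinearMap.comp_apply,
      LinearMap.rTensor_comp_map, iterComul]

/-- Both terms of the condition insert `f₀` between `g` and `f₁`, once by splitting the left leg and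
once by splitting the right leg. Coassociativity of `C` identifies them. -/
theorem cotensorCond_map {Y : Type*} [AddCommGroup Y] [Module K Y] {ρ : Y →ₗ[K] Y ⊗[K] H}
    {g : C →ₗ[K] Y}
    (hL : ∀ c, TensorProduct.map f₀ f₁ (Coalgebra.comul (R := K) c) = X.δL (f₁ c))
    (hg : ∀ c, ρ (g c) = TensorProduct.map g f₀ (Coalgebra.comul (R := K) c)) (c : C) :
    X.cotensorCond ρ (TensorProduct.map g f₁ (Coalgebra.comul (R := K) c)) = 0 := by
  have h1 : ∀ z : C ⊗[K] C, X.cotensorCond ρ (TensorProduct.map g f₁ z) =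
      TensorProduct.assoc K Y H M
        (TensorProduct.map (TensorProduct.map g f₀ ∘ₗ Coalgebra.comul) f₁ z) -
      TensorProduct.map g (TensorProduct.map f₀ f₁ ∘ₗ Coalgebra.comul) z := by
    intro z
    induction z using TensorProduct.induction_on with
    | zero => simp
    | tmul x y => simp [cotensorCond_tmul, hg, hL]
    | add x y hx hy =>
      simp only [map_add, hx, hy]
      abel
  rw [h1, map_comul_assoc, sub_self]

theorem iterComul_mem (hL : ∀ c, TensorProduct.map f₀ f₁ (Coalgebra.comul (R := K) c) = X.δL (f₁ c))
    (hR : ∀ c, TensorProduct.map f₁ f₀ (Coalgebra.comul (R := K) c) = X.δR (f₁ c)) (n : ℕ) (c : C) :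
    iterComul f₁ n c ∈ X.cotensorPow n := by
  induction n generalizing c with
  | zero => exact X.mem_cotensorPow_zero _
  | succ n ih =>
    rw [mem_cotensorPow_succ]
    have h1 : (X.cotensorPow n).subtype ∘ₗ (iterComul f₁ n).codRestrict _ ih = iterComul f₁ n :=
      LinearMap.subtype_comp_codRestrict _ _ _
    have h2 : (X.cotensorPow n).subtype.rTensor M
        (TensorProduct.map ((iterComul f₁ n).codRestrict _ ih) f₁ (Coalgebra.comul (R := K) c)) =
        TensorProduct.map (iterComul f₁ n) f₁ (Coalgebra.comul (R := K) c) := by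
      rw [← LinearMap.comp_apply, LinearMap.rTensor_comp_map, h1]
    refine ⟨TensorProduct.map ((iterComul f₁ n).codRestrict _ ih) f₁ (Coalgebra.comul c), ?_, ?_⟩
    · rw [h2, iterComul_succ]
    · rw [h2]
      exact cotensorCond_map hL (rightCoact_iterComul hR n) c

/-- The map into the positive cotensor powers with component `f₁` in `M`. -/
theorem exists_cotPos_lift {F : ℕ → Submodule K C} (hF : IsCoalgFiltration F)
    (hL : ∀ c, TensorProduct.map f₀ f₁ (Coalgebra.comul (R := K) c) = X.δL (f₁ c))
    (hR : ∀ c, TensorProduct.map f₁ f₀ (Coalgebra.comul (R := K) c) = X.δR (f₁ c))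
    (h0 : ∀ c ∈ F 0, f₁ c = 0) :
    ∃ φ : C →ₗ[K] X.CotPos, ∀ c, X.posIncl (φ c) = PosTensor.ι K M (f₁ c) +
      PosTensor.append K M
        (TensorProduct.map (X.posIncl ∘ₗ φ) f₁ (Coalgebra.comul (R := K) c)) := by
  -- The lift is the sum of all iterated coproducts. Only its recursion `Φ = ι ∘ f₁ + append ∘ (Φ ⊗
  -- f₁) ∘ Δ` is exported, and the later arguments rely on it alone.
  obtain ⟨φ, hφ⟩ := exists_directSum_lift
    (fun n => (iterComul f₁ n).codRestrict (X.cotensorPow n) (iterComul_mem hL hR n)) (by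
      intro c
      obtain ⟨N, hN⟩ := hF.exhaustive c
      exact ⟨N, fun n hn => Subtype.ext (iterComul_eq_zero hF h0 (hF.mono hn hN))⟩)
  have hφ' : ∀ n, DirectSum.component K ℕ (fun k => TPow K M k) n ∘ₗ X.posIncl ∘ₗ φ =
      iterComul f₁ n := by
    intro n
    ext c
    exact congrArg Subtype.val (LinearMap.congr_fun (hφ n) c)
  refine ⟨φ, fun c => DFinsupp.ext fun n => ?_⟩
  have h1 := LinearMap.congr_fun (hφ' n) c
  refine h1.trans (Eq.trans ?_ (map_add (DirectSum.component K ℕ (fun k => TPow K M k) n) _ _).symm)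
  cases n with
  | zero =>
    have h2 := LinearMap.congr_fun (PosTensor.component_zero_append (K := K) (M := M))
      (TensorProduct.map (X.posIncl ∘ₗ φ) f₁ (Coalgebra.comul (R := K) c))
    rw [LinearMap.comp_apply, LinearMap.zero_apply] at h2
    rw [h2, add_zero, PosTensor.ι, LinearMap.comp_apply, DirectSum.component.lof_self, iterComul,
      LinearMap.comp_apply]
  | succ n =>
    have h2 := LinearMap.congr_fun (PosTensor.component_succ_append (K := K) (M := M) n)
      (TensorProduct.map (X.posIncl ∘ₗ φ) f₁ (Coalgebra.comul (R := K) c))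
    rw [LinearMap.comp_apply] at h2
    rw [h2, PosTensor.ι, LinearMap.comp_apply, DirectSum.component.of, dif_neg (by omega), zero_add,
      LinearMap.comp_apply, ← LinearMap.comp_apply (LinearMap.rTensor _ _),
      LinearMap.rTensor_comp_map, hφ', iterComul]
    rfl

section Lift

variable {Φ : C →ₗ[K] PosTensor K M}
  (hΦ : ∀ c, Φ c = PosTensor.ι K M (f₁ c) +
    PosTensor.append K M (TensorProduct.map Φ f₁ (Coalgebra.comul (R := K) c)))

include hΦ

/-- Substituting the recursion on both sides suffices: the last letter is always a value of `f₁`, on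
which `δR` is known. -/
theorem posCoact_lift
    (hR : ∀ c, TensorProduct.map f₁ f₀ (Coalgebra.comul (R := K) c) = X.δR (f₁ c)) (c : C) :
    X.posCoact (Φ c) = TensorProduct.map Φ f₀ (Coalgebra.comul (R := K) c) := by
  have h1 : ∀ z : C ⊗[K] C, X.posCoact (PosTensor.append K M (TensorProduct.map Φ f₁ z)) =
      (PosTensor.append K M).rTensor H ((TensorProduct.assoc K (PosTensor K M) M H).symm
        (TensorProduct.map Φ (TensorProduct.map f₁ f₀ ∘ₗ Coalgebra.comul) z)) := by
    intro z
    induction z using TensorProduct.induction_on with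
    | zero => simp
    | tmul x y => simp [posCoact_append, hR]
    | add x y hx hy => simp only [map_add, hx, hy]
  have h2 : ∀ z : C ⊗[K] C, TensorProduct.map Φ f₀ z =
      (PosTensor.ι K M).rTensor H (TensorProduct.map f₁ f₀ z) +
      (PosTensor.append K M).rTensor H
        (TensorProduct.map (TensorProduct.map Φ f₁ ∘ₗ Coalgebra.comul) f₀ z) := by
    intro z
    induction z using TensorProduct.induction_on with
    | zero => simp
    | tmul x y =>
      rw [TensorProduct.map_tmul, hΦ x, TensorProduct.add_tmul]
      simp
    | add x y hx hy =>
      simp only [map_add, hx, hy]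
      abel
  rw [hΦ c, map_add, posCoact_ι, h1, ← map_comul_assoc, LinearEquiv.symm_apply_apply, h2, hR]

/-- The difference `E` of the two sides satisfies the homogeneous recursion `E = append ∘ (E ⊗ f₁) ∘
Δ`. Since `f₁` kills `F 0`, vanishing of `E` on one step of the filtration implies vanishing on the
next. -/
theorem posDeconcat_lift {F : ℕ → Submodule K C} (hF : IsCoalgFiltration F)
    (hL : ∀ c, TensorProduct.map f₀ f₁ (Coalgebra.comul (R := K) c) = X.δL (f₁ c))
    (h0 : ∀ c ∈ F 0, f₁ c = 0) (c : C) :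
    X.posDeconcat (Φ c) =
      TensorProduct.map (X.ambInl ∘ₗ f₀ + X.ambInr ∘ₗ Φ) Φ (Coalgebra.comul (R := K) c) := by
  set g := X.ambInl ∘ₗ f₀ + X.ambInr ∘ₗ Φ with hg
  set E : C →ₗ[K] X.Ambient ⊗[K] PosTensor K M :=
    X.posDeconcat ∘ₗ Φ - TensorProduct.map g Φ ∘ₗ Coalgebra.comul with hE
  have h1 : ∀ z : C ⊗[K] C, X.posDeconcat (PosTensor.append K M (TensorProduct.map Φ f₁ z)) =
      (PosTensor.append K M).lTensor X.Ambient (TensorProduct.assoc K X.Ambient (PosTensor K M) M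
        (TensorProduct.map (X.posDeconcat ∘ₗ Φ) f₁ z)) +
      TensorProduct.map (X.ambInr ∘ₗ Φ) (PosTensor.ι K M ∘ₗ f₁) z := by
    intro z
    induction z using TensorProduct.induction_on with
    | zero => simp
    | tmul x y =>
      rw [TensorProduct.map_tmul, TensorProduct.map_tmul, TensorProduct.map_tmul,
        posDeconcat_append]
      rfl
    | add x y hx hy =>
      simp only [map_add, hx, hy]
      abel
  have h2 : ∀ z : C ⊗[K] C, TensorProduct.map g Φ z =
      TensorProduct.map g (PosTensor.ι K M ∘ₗ f₁) z +
      (PosTensor.append K M).lTensor X.Ambient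
        (TensorProduct.map g (TensorProduct.map Φ f₁ ∘ₗ Coalgebra.comul) z) := by
    intro z
    induction z using TensorProduct.induction_on with
    | zero => simp
    | tmul x y =>
      rw [TensorProduct.map_tmul, hΦ y, TensorProduct.tmul_add]
      simp
    | add x y hx hy =>
      simp only [map_add, hx, hy]
      abel
  have h3 : ∀ c, X.posDeconcat (PosTensor.ι K M (f₁ c)) =
      TensorProduct.map (X.ambInl ∘ₗ f₀) (PosTensor.ι K M ∘ₗ f₁) (Coalgebra.comul (R := K) c) := by
    intro c
    rw [posDeconcat_ι, ← hL, TensorProduct.map_comp, LinearMap.comp_apply]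
  have h4 : ∀ c, E c = (PosTensor.append K M).lTensor X.Ambient
      (TensorProduct.assoc K X.Ambient (PosTensor K M) M
        (TensorProduct.map E f₁ (Coalgebra.comul (R := K) c))) := by
    intro c
    have h5 : TensorProduct.map E f₁ (Coalgebra.comul (R := K) c) =
        TensorProduct.map (X.posDeconcat ∘ₗ Φ) f₁ (Coalgebra.comul (R := K) c) -
        TensorProduct.map (TensorProduct.map g Φ ∘ₗ Coalgebra.comul) f₁
          (Coalgebra.comul (R := K) c) := by
      induction Coalgebra.comul (R := K) c using TensorProduct.induction_on with
      | zero => simp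
      | tmul x y => simp [hE, TensorProduct.sub_tmul]
      | add x y hx hy =>
        simp only [map_add, hx, hy]
        abel
    rw [h5, map_sub, map_sub, map_comul_assoc]
    have h6 : E c = X.posDeconcat (Φ c) - TensorProduct.map g Φ (Coalgebra.comul c) := rfl
    rw [h6, h2, hΦ c, map_add, h3, h1, hg, TensorProduct.map_add_left, LinearMap.add_apply]
    abel
  -- Indexing by `predFiltration` starts the induction at the zero subspace, so that `F 0` needs no
  -- separate case.
  have h7 : ∀ n, ∀ c ∈ predFiltration F n, E c = 0 := by
    intro n
    induction n with
    | zero =>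
      intro c hc
      rw [(Submodule.mem_bot K).mp hc, map_zero]
    | succ n ih =>
      intro c hc
      rw [h4, hF.map_comul_eq_zero ih h0 hc, map_zero, map_zero]
  obtain ⟨n, hn⟩ := hF.exhaustive c
  exact sub_eq_zero.mp (h7 (n + 1) c hn)

end Lift

/-- The universal property of the cotensor coalgebra. -/
theorem IsCotensorCoalgebra.exists_lift {T : Type*} [AddCommGroup T] [Module K T] [Coalgebra K T]
    {e : T ≃ₗ[K] X.Cotensor} (he : X.IsCotensorCoalgebra e)
    {F : ℕ → Submodule K C} (hF : IsCoalgFiltration F) (f₀ : C →ₗc[K] H)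
    (hL : ∀ c, TensorProduct.map (f₀ : C →ₗ[K] H) f₁ (Coalgebra.comul (R := K) c) = X.δL (f₁ c))
    (hR : ∀ c, TensorProduct.map f₁ (f₀ : C →ₗ[K] H) (Coalgebra.comul (R := K) c) = X.δR (f₁ c))
    (h0 : ∀ c ∈ F 0, f₁ c = 0) :
    ∃ f : C →ₗc[K] T, (∀ c, X.projH e (f c) = f₀ c) ∧ ∀ c, X.projM e (f c) = f₁ c := by
  obtain ⟨φ, hφ⟩ := exists_cotPos_lift hF hL hR h0
  set f : C →ₗ[K] T := e.symm.toLinearMap ∘ₗ LinearMap.prod (f₀ : C →ₗ[K] H) φ with hf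
  have hef : ∀ c, e (f c) = (f₀ c, φ c) := fun c => e.apply_symm_apply _
  have h1 : (X.incl ∘ₗ e.toLinearMap) ∘ₗ f =
      X.ambInl ∘ₗ (f₀ : C →ₗ[K] H) + X.ambInr ∘ₗ X.posIncl ∘ₗ φ := by
    ext c : 1
    have h2 : (X.incl ∘ₗ e.toLinearMap) (f c) = X.incl (e (f c)) := rfl
    rw [LinearMap.comp_apply, h2, hef, incl_eq]
    rfl
  have h3 : Function.Injective
      (TensorProduct.map (X.incl ∘ₗ e.toLinearMap) (X.incl ∘ₗ e.toLinearMap)) :=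
    map_injective (X.incl_injective.comp e.injective) (X.incl_injective.comp e.injective)
  refine ⟨{ f with
    counit_comp := ?_
    map_comp_comul := ?_ }, fun c => ?_, fun c => ?_⟩
  · ext c
    have h2 : (Coalgebra.counit (R := K) ∘ₗ f) c = Coalgebra.counit (R := K) (f c) := rfl
    refine h2.trans ?_
    rw [he.counit, hef]
    exact LinearMap.congr_fun (CoalgHomClass.counit_comp f₀) c
  · ext c
    apply h3
    have h2 : (TensorProduct.map (X.incl ∘ₗ e.toLinearMap) (X.incl ∘ₗ e.toLinearMap))
        (TensorProduct.map f f (Coalgebra.comul (R := K) c)) =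
        TensorProduct.map (X.incl ∘ₗ e.toLinearMap) (X.incl ∘ₗ e.toLinearMap)
          (Coalgebra.comul (R := K) (f c)) := by
      rw [he.comul, hef, incl_eq, map_add, deconcat_inl, deconcat_inr,
        ← LinearMap.comp_apply, ← TensorProduct.map_comp, h1]
      have h4 := posDeconcat_lift (f₀ := (f₀ : C →ₗ[K] H)) (Φ := X.posIncl ∘ₗ φ) hφ hF hL h0 c
      have h5 := posCoact_lift (f₀ := (f₀ : C →ₗ[K] H)) (Φ := X.posIncl ∘ₗ φ) hφ hR c
      rw [LinearMap.comp_apply] at h4 h5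
      rw [h4, h5, ← CoalgHomClass.map_comp_comul_apply f₀ c]
      rw [TensorProduct.map_add_right, LinearMap.add_apply, TensorProduct.map_add_left,
        LinearMap.add_apply, TensorProduct.map_comp, TensorProduct.map_comp, LinearMap.comp_apply,
        LinearMap.comp_apply, ← LinearMap.comp_apply (LinearMap.lTensor _ _),
        LinearMap.lTensor_comp_map, add_assoc, add_comm (TensorProduct.map X.ambInr X.ambInl _)]
    exact h2
  · exact congrArg Prod.fst (hef c)
  · have h2 := hφ c
    have h5 : X.projM e (f c) = posDegOne K M (X.posIncl (e (f c)).2) := rfl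
    refine h5.trans ?_
    rw [hef, h2, map_add, posDegOne_ι, posDegOne_append, add_zero]

end HopfBimodule

end YangBaxter

namespace YangBaxter

/-! ### The coalgebra structure on the cotensor space and its degree filtration -/

namespace HopfBimodule

variable {K H M : Type*} [Field K] [Ring H] [HopfAlgebra K H] [AddCommGroup M] [Module K M]
  [Module H M] [IsScalarTower K H M] [Module Hᵐᵒᵖ M] [IsScalarTower K Hᵐᵒᵖ M]
  [SMulCommClass H Hᵐᵒᵖ M] (X : HopfBimodule K H M)

theorem incl_inl (h : H) : X.incl (LinearMap.inl K H X.CotPos h) = X.ambInl h :=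
  LinearMap.congr_fun X.incl_comp_inl h

theorem incl_inr (x : X.CotPos) :
    X.incl (LinearMap.inr K H X.CotPos x) = X.ambInr (X.posIncl x) := rfl

theorem exists_deconcat_inl (h : H) :
    X.deconcat (X.incl (LinearMap.inl K H X.CotPos h)) = TensorProduct.map X.incl X.incl
      (TensorProduct.map (LinearMap.inl K H X.CotPos) (LinearMap.inl K H X.CotPos)
        (Coalgebra.comul (R := K) h)) := by
  rw [incl_inl, deconcat_inl, ← LinearMap.comp_apply (TensorProduct.map X.incl X.incl),
    ← TensorProduct.map_comp, incl_comp_inl]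

theorem exists_deconcat_inr {n : ℕ} (u : X.cotensorPow n) :
    ∃ (a : X.degFiltration n ⊗[K] X.CotPos) (b : X.cotensorPow n ⊗[K] H),
      X.deconcat (X.incl (LinearMap.inr K H X.CotPos (X.cotLof n u))) =
        TensorProduct.map X.incl X.incl
          (TensorProduct.map (X.degFiltration n).subtype (LinearMap.inr K H X.CotPos) a +
            TensorProduct.map (LinearMap.inr K H X.CotPos ∘ₗ X.cotLof n)
              (LinearMap.inl K H X.CotPos) b) := by
  obtain ⟨a, ha⟩ := X.posDeconcat_mem_range u
  obtain ⟨b, hb⟩ := X.rightCoact_mem_range u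
  refine ⟨a, b, ?_⟩
  rw [LinearMap.map_add, incl_inr, deconcat_inr, ← ha, posIncl_cotLof, posCoact_lof, ← hb]
  congr 1
  · generalize a = z
    induction z using TensorProduct.induction_on with
    | zero => simp only [map_zero]
    | tmul x y => rfl
    | add x y hx hy => simp only [map_add, hx, hy]
  · generalize b = z
    induction z using TensorProduct.induction_on with
    | zero => simp only [map_zero]
    | tmul x y =>
      simp only [LinearMap.rTensor_tmul, TensorProduct.map_tmul, incl_inl, LinearMap.comp_apply,
        incl_inr, posIncl_cotLof]
      rfl
    | add x y hx hy => simp only [map_add, hx, hy]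

theorem Cotensor.induction {P : X.Cotensor → Prop} (add : ∀ x y, P x → P y → P (x + y))
    (inl : ∀ h, P (LinearMap.inl K H X.CotPos h))
    (inr : ∀ n u, P (LinearMap.inr K H X.CotPos (X.cotLof n u))) (x : X.Cotensor) : P x := by
  have h1 : ∀ y : X.CotPos, P (LinearMap.inr K H X.CotPos y) := by
    intro y
    induction y using CotPos.induction with
    | zero =>
      have := inl 0
      rwa [map_zero, ← map_zero (LinearMap.inr K H X.CotPos)] at this
    | lof n w => exact inr n w
    | add x y hx hy => rw [map_add]; exact add _ _ hx hy
  have h2 : x = LinearMap.inl K H X.CotPos x.1 + LinearMap.inr K H X.CotPos x.2 := by simp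
  rw [h2]
  exact add _ _ (inl _) (h1 _)

theorem deconcat_mem_range (x : X.Cotensor) :
    X.deconcat (X.incl x) ∈ LinearMap.range (TensorProduct.map X.incl X.incl) := by
  induction x using Cotensor.induction with
  | add x y hx hy => rw [map_add, map_add]; exact add_mem hx hy
  | inl h => exact ⟨_, (X.exists_deconcat_inl h).symm⟩
  | inr n u =>
    obtain ⟨a, b, h⟩ := X.exists_deconcat_inr u
    exact ⟨_, h.symm⟩

/-- The space underlying the cotensor Hopf algebra. -/
def CotensorAlgebra : Type _ := X.Cotensor

instance : AddCommGroup X.CotensorAlgebra := inferInstanceAs (AddCommGroup X.Cotensor)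

instance : Module K X.CotensorAlgebra := inferInstanceAs (Module K X.Cotensor)

/-- The identity map. -/
def cotensorEquiv : X.CotensorAlgebra ≃ₗ[K] X.Cotensor := LinearEquiv.refl K X.Cotensor

/-- The inclusion in the ambient space. -/
def cotIncl : X.CotensorAlgebra →ₗ[K] X.Ambient := X.incl ∘ₗ X.cotensorEquiv.toLinearMap

theorem cotIncl_injective : Function.Injective X.cotIncl :=
  X.incl_injective.comp X.cotensorEquiv.injective

theorem exists_comul : ∃ Δ : X.CotensorAlgebra →ₗ[K] X.CotensorAlgebra ⊗[K] X.CotensorAlgebra,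
    TensorProduct.map X.cotIncl X.cotIncl ∘ₗ Δ = X.deconcat ∘ₗ X.cotIncl :=
  exists_comp_eq_of_range_le (map_injective X.cotIncl_injective X.cotIncl_injective)
    X.deconcat_mem_range

/-- The coproduct of the cotensor coalgebra. -/
def cotComul : X.CotensorAlgebra →ₗ[K] X.CotensorAlgebra ⊗[K] X.CotensorAlgebra :=
  X.exists_comul.choose

theorem map_cotIncl_cotComul (x : X.CotensorAlgebra) :
    TensorProduct.map X.cotIncl X.cotIncl (X.cotComul x) = X.deconcat (X.cotIncl x) :=
  LinearMap.congr_fun X.exists_comul.choose_spec x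

theorem counit_deconcat (x : X.Cotensor) :
    TensorProduct.lid K X.Ambient (TensorProduct.map
      (Coalgebra.counit (R := K) ∘ₗ LinearMap.fst K H (PosTensor K M)) LinearMap.id
      (X.deconcat (X.incl x))) = X.incl x := by
  rw [map_deconcat_incl]
  have h1 := X.counit_posDeconcat (X.posIncl x.2)
  rw [LinearMap.comp_assoc X.ambInl, LinearMap.comp_assoc X.ambInr, LinearMap.fst_comp_inl,
    LinearMap.fst_comp_inr, LinearMap.comp_zero, TensorProduct.map_zero_left, LinearMap.zero_apply,
    add_zero, map_add, incl_eq]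
  conv_rhs => rw [← h1]
  congr 1
  · have h2 := Coalgebra.rTensor_counit_comul (R := K) x.1
    have h3 : ∀ z : H ⊗[K] H, TensorProduct.lid K X.Ambient (TensorProduct.map
        (Coalgebra.counit (R := K) ∘ₗ LinearMap.id) (LinearMap.id ∘ₗ X.ambInl) z) =
        X.ambInl (TensorProduct.lid K H ((Coalgebra.counit (R := K)).rTensor H z)) := by
      intro z
      induction z using TensorProduct.induction_on with
      | zero => simp only [map_zero]
      | tmul x y => simp
      | add x y hx hy => simp only [map_add, hx, hy]
    rw [h3, h2, TensorProduct.lid_tmul, one_smul]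
  · induction X.posDeconcat (X.posIncl x.2) using TensorProduct.induction_on with
    | zero => simp only [map_zero]
    | tmul x y => simp
    | add x y hx hy => simp only [map_add, hx, hy]

theorem deconcat_counit (x : X.Cotensor) :
    TensorProduct.rid K X.Ambient (TensorProduct.map LinearMap.id
      (Coalgebra.counit (R := K) ∘ₗ LinearMap.fst K H (PosTensor K M))
      (X.deconcat (X.incl x))) = X.incl x := by
  rw [map_deconcat_incl]
  have h1 := X.counit_posCoact (X.posIncl x.2)
  rw [LinearMap.comp_assoc X.ambInl, LinearMap.comp_assoc X.ambInr, LinearMap.fst_comp_inl,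
    LinearMap.fst_comp_inr, LinearMap.comp_zero, TensorProduct.map_zero_right, LinearMap.zero_apply,
    zero_add, map_add, incl_eq]
  conv_rhs => rw [← h1]
  congr 1
  · have h2 := Coalgebra.lTensor_counit_comul (R := K) x.1
    have h3 : ∀ z : H ⊗[K] H, TensorProduct.rid K X.Ambient (TensorProduct.map
        (LinearMap.id ∘ₗ X.ambInl) (Coalgebra.counit (R := K) ∘ₗ LinearMap.id) z) =
        X.ambInl (TensorProduct.rid K H ((Coalgebra.counit (R := K)).lTensor H z)) := by
      intro z
      induction z using TensorProduct.induction_on with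
      | zero => simp only [map_zero]
      | tmul x y => simp
      | add x y hx hy => simp only [map_add, hx, hy]
    rw [h3, h2, TensorProduct.rid_tmul, one_smul]
  · induction X.posCoact (X.posIncl x.2) using TensorProduct.induction_on with
    | zero => simp only [map_zero]
    | tmul x y => simp
    | add x y hx hy => simp only [map_add, hx, hy]

/-- The counit of the cotensor coalgebra. -/
def cotCounit : X.CotensorAlgebra →ₗ[K] K :=
  Coalgebra.counit (R := K) ∘ₗ LinearMap.fst K H (PosTensor K M) ∘ₗ X.cotIncl

instance : CoalgebraStruct K X.CotensorAlgebra where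
  comul := X.cotComul
  counit := X.cotCounit

/-- The identity is tested in the ambient space after an injective map; there it holds on elements
coming from the cotensor powers. -/
theorem cotComul_coassoc (x : X.CotensorAlgebra) :
    TensorProduct.assoc K _ _ _ (X.cotComul.rTensor X.CotensorAlgebra (X.cotComul x)) =
      X.cotComul.lTensor X.CotensorAlgebra (X.cotComul x) := by
  apply map_injective X.cotIncl_injective (map_injective X.cotIncl_injective X.cotIncl_injective)
  have h1 : ∀ z : X.CotensorAlgebra ⊗[K] X.CotensorAlgebra,
      TensorProduct.map X.cotIncl (TensorProduct.map X.cotIncl X.cotIncl)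
        (TensorProduct.assoc K _ _ _ (X.cotComul.rTensor X.CotensorAlgebra z)) =
      TensorProduct.assoc K _ _ _ (X.deconcat.rTensor X.Ambient
        (TensorProduct.map X.cotIncl X.cotIncl z)) := by
    intro z
    induction z using TensorProduct.induction_on with
    | zero => simp only [map_zero]
    | tmul x y =>
      rw [LinearMap.rTensor_tmul, TensorProduct.map_tmul, LinearMap.rTensor_tmul,
        ← map_cotIncl_cotComul]
      induction X.cotComul x using TensorProduct.induction_on with
      | zero => simp only [map_zero, TensorProduct.zero_tmul]
      | tmul x y => simp
      | add x y hx hy => simp only [map_add, TensorProduct.add_tmul, hx, hy]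
    | add x y hx hy => simp only [map_add, hx, hy]
  have h2 : ∀ z : X.CotensorAlgebra ⊗[K] X.CotensorAlgebra,
      TensorProduct.map X.cotIncl (TensorProduct.map X.cotIncl X.cotIncl)
        (X.cotComul.lTensor X.CotensorAlgebra z) =
      X.deconcat.lTensor X.Ambient (TensorProduct.map X.cotIncl X.cotIncl z) := by
    intro z
    induction z using TensorProduct.induction_on with
    | zero => simp only [map_zero]
    | tmul x y =>
      rw [LinearMap.lTensor_tmul, TensorProduct.map_tmul, TensorProduct.map_tmul,
        LinearMap.lTensor_tmul, map_cotIncl_cotComul]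
    | add x y hx hy => simp only [map_add, hx, hy]
  rw [h1, h2, map_cotIncl_cotComul]
  exact X.deconcat_coassoc (X.cotensorEquiv x)

instance : Coalgebra K X.CotensorAlgebra where
  coassoc := LinearMap.ext X.cotComul_coassoc
  rTensor_counit_comp_comul := by
    ext x
    apply (TensorProduct.lid K X.CotensorAlgebra).injective
    apply X.cotIncl_injective
    have h1 : ∀ z : X.CotensorAlgebra ⊗[K] X.CotensorAlgebra,
        X.cotIncl (TensorProduct.lid K _ (X.cotCounit.rTensor X.CotensorAlgebra z)) =
        TensorProduct.lid K X.Ambient (TensorProduct.map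
          (Coalgebra.counit (R := K) ∘ₗ LinearMap.fst K H (PosTensor K M)) LinearMap.id
          (TensorProduct.map X.cotIncl X.cotIncl z)) := by
      intro z
      induction z using TensorProduct.induction_on with
      | zero => simp only [map_zero]
      | tmul x y => simp [cotCounit]
      | add x y hx hy => simp only [map_add, hx, hy]
    refine (h1 (X.cotComul x)).trans ?_
    rw [map_cotIncl_cotComul]
    refine (X.counit_deconcat (X.cotensorEquiv x)).trans ?_
    simp
    rfl
  lTensor_counit_comp_comul := by
    ext x
    apply (TensorProduct.rid K X.CotensorAlgebra).injective
    apply X.cotIncl_injective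
    have h1 : ∀ z : X.CotensorAlgebra ⊗[K] X.CotensorAlgebra,
        X.cotIncl (TensorProduct.rid K _ (X.cotCounit.lTensor X.CotensorAlgebra z)) =
        TensorProduct.rid K X.Ambient (TensorProduct.map LinearMap.id
          (Coalgebra.counit (R := K) ∘ₗ LinearMap.fst K H (PosTensor K M))
          (TensorProduct.map X.cotIncl X.cotIncl z)) := by
      intro z
      induction z using TensorProduct.induction_on with
      | zero => simp only [map_zero]
      | tmul x y => simp [cotCounit]
      | add x y hx hy => simp only [map_add, hx, hy]
    refine (h1 (X.cotComul x)).trans ?_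
    rw [map_cotIncl_cotComul]
    refine (X.deconcat_counit (X.cotensorEquiv x)).trans ?_
    simp
    rfl

theorem isCotensorCoalgebra : X.IsCotensorCoalgebra X.cotensorEquiv :=
  ⟨X.map_cotIncl_cotComul, fun _ => rfl⟩

variable {X} {T : Type*} [AddCommGroup T] [Module K T]

theorem map_incl_map_symm (e : T ≃ₗ[K] X.Cotensor) {P Q : Type*} [AddCommMonoid P] [Module K P]
    [AddCommMonoid Q] [Module K Q] (f : P →ₗ[K] X.Cotensor) (g : Q →ₗ[K] X.Cotensor)
    (z : P ⊗[K] Q) :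
    TensorProduct.map (X.incl ∘ₗ e.toLinearMap) (X.incl ∘ₗ e.toLinearMap)
      (TensorProduct.map (e.symm.toLinearMap ∘ₗ f) (e.symm.toLinearMap ∘ₗ g) z) =
    TensorProduct.map X.incl X.incl (TensorProduct.map f g z) := by
  induction z using TensorProduct.induction_on with
  | zero => simp only [map_zero]
  | tmul x y => simp
  | add x y hx hy => simp only [map_add, hx, hy]

/-- The cotensor coalgebra is filtered by degree. -/
theorem IsCotensorCoalgebra.isCoalgFiltration [Coalgebra K T] {e : T ≃ₗ[K] X.Cotensor}
    (he : X.IsCotensorCoalgebra e) :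
    IsCoalgFiltration fun n => (X.degFiltration n).comap e.toLinearMap := by
  have hi : Function.Injective
      (TensorProduct.map (X.incl ∘ₗ e.toLinearMap) (X.incl ∘ₗ e.toLinearMap)) :=
    map_injective (X.incl_injective.comp e.injective) (X.incl_injective.comp e.injective)
  have hl : ∀ h : H, Coalgebra.comul (R := K) (e.symm (LinearMap.inl K H X.CotPos h)) =
      TensorProduct.map (e.symm.toLinearMap ∘ₗ LinearMap.inl K H X.CotPos)
        (e.symm.toLinearMap ∘ₗ LinearMap.inl K H X.CotPos) (Coalgebra.comul (R := K) h) := by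
    intro h
    apply hi
    rw [map_incl_map_symm, he.comul, LinearEquiv.apply_symm_apply, exists_deconcat_inl]
  refine ⟨fun n m h => Submodule.comap_mono (X.degFiltration_mono h),
    fun c => X.exists_mem_degFiltration (e c), fun n c hc => ?_⟩
  set F := fun n => (X.degFiltration n).comap e.toLinearMap with hF
  have hmem : ∀ n y, y ∈ X.degFiltration n → e.symm y ∈ F n := by
    intro n y hy
    rw [hF, Submodule.mem_comap, LinearEquiv.coe_coe, LinearEquiv.apply_symm_apply]
    exact hy
  have hinl : ∀ m (h : H), e.symm (LinearMap.inl K H X.CotPos h) ∈ F m :=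
    fun m h => hmem m _ (X.inl_mem_degFiltration m h)
  set N := Submodule.map₂ (TensorProduct.mk K T T) (predFiltration F n) ⊤ ⊔
    Submodule.map₂ (TensorProduct.mk K T T) (F n) (F 0)
  set L : Submodule K X.Cotensor := N.comap (Coalgebra.comul (R := K) ∘ₗ e.symm.toLinearMap)
  have h1 : ∀ h : H, LinearMap.inl K H X.CotPos h ∈ L := by
    intro h
    refine Submodule.mem_sup_right ?_
    rw [LinearMap.comp_apply, LinearEquiv.coe_coe, hl]
    exact map_mem_map₂ (hinl n) (hinl 0) _
  -- A word of length `k + 1 ≤ n` contributes cuts with left part in degree at most `k ≤ n - 1`,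
  -- which belong to the first summand of `N`, and the right coaction term, whose second leg is in
  -- `H` and which belongs to the second summand.
  have h2 : ∀ k (u : X.cotensorPow k), k < n →
      LinearMap.inr K H X.CotPos (X.cotLof k u) ∈ L := by
    intro k u hk
    obtain ⟨a, b, hab⟩ := X.exists_deconcat_inr u
    have h3 : Coalgebra.comul (R := K) (e.symm (LinearMap.inr K H X.CotPos (X.cotLof k u))) =
        TensorProduct.map (e.symm.toLinearMap ∘ₗ (X.degFiltration k).subtype)
          (e.symm.toLinearMap ∘ₗ LinearMap.inr K H X.CotPos) a +
        TensorProduct.map (e.symm.toLinearMap ∘ₗ LinearMap.inr K H X.CotPos ∘ₗ X.cotLof k)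
          (e.symm.toLinearMap ∘ₗ LinearMap.inl K H X.CotPos) b := by
      apply hi
      rw [map_add, map_incl_map_symm, map_incl_map_symm, he.comul, LinearEquiv.apply_symm_apply, hab, LinearMap.map_add]
    have h4 : Coalgebra.comul (R := K)
        (e.symm (LinearMap.inr K H X.CotPos (X.cotLof k u))) ∈ N := by
      rw [h3]
      refine Submodule.add_mem_sup ?_ ?_
      · refine map_mem_map₂ (fun x => ?_) (fun _ => Submodule.mem_top) _
        cases n with
        | zero => omega
        | succ n => exact hmem n _ (X.degFiltration_mono (by omega) x.2)
      · refine map_mem_map₂ (fun x => ?_) (hinl 0) _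
        exact hmem n _ (X.degFiltration_mono hk (X.inr_mem_degFiltration k x))
    exact h4
  have h5 : e c ∈ L := by
    classical
    have h6 : e c = LinearMap.inl K H X.CotPos (e c).1 + LinearMap.inr K H X.CotPos (e c).2 := by
      simp
    rw [h6]
    refine add_mem (h1 _) ?_
    rw [← DirectSum.sum_support_of (e c).2, map_sum]
    refine Submodule.sum_mem _ fun k hk => h2 k _ ?_
    by_contra hkn
    exact (DFinsupp.mem_support_iff.mp hk) (hc k (not_lt.mp hkn))
  have h7 : Coalgebra.comul (R := K) (e.symm (e c)) ∈ N := h5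
  rwa [LinearEquiv.symm_apply_apply] at h7

end HopfBimodule

end YangBaxter

namespace YangBaxter

/-! ### Tensor products of filtered coalgebras, and the product -/

section TensorFiltration

variable {K C D : Type*} [Field K] [AddCommGroup C] [Module K C] [AddCommGroup D] [Module K D]

theorem comul_tmul_eq [Coalgebra K C] [Coalgebra K D] (x : C) (y : D) : Coalgebra.comul (R := K) (x ⊗ₜ[K] y) =
    TensorProduct.tensorTensorTensorComm K C C D D
      (Coalgebra.comul (R := K) x ⊗ₜ Coalgebra.comul (R := K) y) := by
  rw [TensorProduct.comul_tmul]
  rfl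

theorem tensorTensorTensorComm_mem {P P' : Submodule K C} {Q Q' : Submodule K D} {z : C ⊗[K] C}
    {w : D ⊗[K] D} (hz : z ∈ Submodule.map₂ (TensorProduct.mk K C C) P P')
    (hw : w ∈ Submodule.map₂ (TensorProduct.mk K D D) Q Q') :
    TensorProduct.tensorTensorTensorComm K C C D D (z ⊗ₜ w) ∈
      Submodule.map₂ (TensorProduct.mk K (C ⊗[K] D) (C ⊗[K] D))
        (Submodule.map₂ (TensorProduct.mk K C D) P Q)
        (Submodule.map₂ (TensorProduct.mk K C D) P' Q') := by
  have h1 : ∀ p ∈ P, ∀ p' ∈ P', Submodule.map₂ (TensorProduct.mk K D D) Q Q' ≤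
      (Submodule.map₂ (TensorProduct.mk K (C ⊗[K] D) (C ⊗[K] D))
        (Submodule.map₂ (TensorProduct.mk K C D) P Q)
        (Submodule.map₂ (TensorProduct.mk K C D) P' Q')).comap
      ((TensorProduct.tensorTensorTensorComm K C C D D).toLinearMap ∘ₗ
        TensorProduct.mk K _ _ (p ⊗ₜ p')) := by
    intro p hp p' hp'
    refine Submodule.map₂_le.mpr fun q hq q' hq' => ?_
    exact Submodule.apply_mem_map₂ _ (Submodule.apply_mem_map₂ _ hp hq)
      (Submodule.apply_mem_map₂ _ hp' hq')
  have h2 : Submodule.map₂ (TensorProduct.mk K C C) P P' ≤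
      (Submodule.map₂ (TensorProduct.mk K (C ⊗[K] D) (C ⊗[K] D))
        (Submodule.map₂ (TensorProduct.mk K C D) P Q)
        (Submodule.map₂ (TensorProduct.mk K C D) P' Q')).comap
      ((TensorProduct.tensorTensorTensorComm K C C D D).toLinearMap ∘ₗ
        (TensorProduct.mk K (C ⊗[K] C) (D ⊗[K] D)).flip w) :=
    Submodule.map₂_le.mpr fun p hp p' hp' => h1 p hp p' hp' hw
  exact h2 hz

/-- The tensor product of two filtrations. -/
def tensorFiltration (F : ℕ → Submodule K C) (G : ℕ → Submodule K D) (n : ℕ) :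
    Submodule K (C ⊗[K] D) :=
  ⨆ (i : ℕ) (j : ℕ) (_ : i + j = n), Submodule.map₂ (TensorProduct.mk K C D) (F i) (G j)

theorem map₂_le_tensorFiltration (F : ℕ → Submodule K C) (G : ℕ → Submodule K D) {i j n : ℕ}
    (h : i + j = n) :
    Submodule.map₂ (TensorProduct.mk K C D) (F i) (G j) ≤ tensorFiltration F G n :=
  le_iSup_of_le i (le_iSup_of_le j (le_iSup_of_le h le_rfl))

theorem tensorFiltration_le {F : ℕ → Submodule K C} {G : ℕ → Submodule K D} {n : ℕ}
    {N : Submodule K (C ⊗[K] D)} (h : ∀ i j, i + j = n → ∀ x ∈ F i, ∀ y ∈ G j, x ⊗ₜ y ∈ N) :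
    tensorFiltration F G n ≤ N :=
  iSup_le fun i => iSup_le fun j => iSup_le fun hij =>
    Submodule.map₂_le.mpr fun x hx y hy => h i j hij x hx y hy

theorem map₂_pred_left_le (F : ℕ → Submodule K C) (G : ℕ → Submodule K D) {i j n : ℕ}
    (h : i + j = n) : Submodule.map₂ (TensorProduct.mk K C D) (predFiltration F i) (G j) ≤
      predFiltration (tensorFiltration F G) n := by
  cases i with
  | zero => simp [predFiltration]
  | succ i =>
    obtain rfl : n = (i + j) + 1 := by omega
    exact map₂_le_tensorFiltration F G rfl

theorem map₂_pred_right_le (F : ℕ → Submodule K C) (G : ℕ → Submodule K D) {i j n : ℕ}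
    (h : i + j = n) : Submodule.map₂ (TensorProduct.mk K C D) (F i) (predFiltration G j) ≤
      predFiltration (tensorFiltration F G) n := by
  cases j with
  | zero => simp [predFiltration]
  | succ j =>
    obtain rfl : n = (i + j) + 1 := by omega
    exact map₂_le_tensorFiltration F G rfl

variable [Coalgebra K C] [Coalgebra K D]

theorem IsCoalgFiltration.pred_le {F : ℕ → Submodule K C} (hF : IsCoalgFiltration F) (n : ℕ) :
    predFiltration F n ≤ F n := by
  cases n with
  | zero => exact bot_le
  | succ n => exact hF.mono n.le_succ

/-- The tensor product of two filtered coalgebras is filtered. -/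
theorem IsCoalgFiltration.tensor {F : ℕ → Submodule K C} {G : ℕ → Submodule K D}
    (hF : IsCoalgFiltration F) (hG : IsCoalgFiltration G) :
    IsCoalgFiltration (tensorFiltration F G) := by
  have hmono : Monotone (tensorFiltration F G) := by
    intro n m hnm
    refine tensorFiltration_le fun i j hij x hx y hy => ?_
    exact map₂_le_tensorFiltration F G (i := i + (m - n)) (j := j) (by omega)
      (Submodule.apply_mem_map₂ _ (hF.mono (by omega) hx) hy)
  refine ⟨hmono, fun c => ?_, fun n => ?_⟩
  · induction c using TensorProduct.induction_on with
    | zero => exact ⟨0, zero_mem _⟩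
    | tmul x y =>
      obtain ⟨i, hi⟩ := hF.exhaustive x
      obtain ⟨j, hj⟩ := hG.exhaustive y
      exact ⟨i + j, map₂_le_tensorFiltration F G rfl (Submodule.apply_mem_map₂ _ hi hj)⟩
    | add x y hx hy =>
      obtain ⟨i, hi⟩ := hx
      obtain ⟨j, hj⟩ := hy
      exact ⟨max i j, add_mem (hmono (le_max_left i j) hi) (hmono (le_max_right i j) hj)⟩
  · set N := Submodule.map₂ (TensorProduct.mk K (C ⊗[K] D) (C ⊗[K] D))
      (predFiltration (tensorFiltration F G) n) ⊤ ⊔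
      Submodule.map₂ (TensorProduct.mk K (C ⊗[K] D) (C ⊗[K] D))
        (tensorFiltration F G n) (tensorFiltration F G 0)
    suffices h : tensorFiltration F G n ≤ N.comap (Coalgebra.comul (R := K)) from fun c hc => h hc
    refine tensorFiltration_le fun i j hij x hx y hy => ?_
    rw [Submodule.mem_comap, comul_tmul_eq]
    obtain ⟨z₁, hz₁, z₂, hz₂, hz⟩ := Submodule.mem_sup.mp (hF.comul_mem i x hx)
    obtain ⟨w₁, hw₁, w₂, hw₂, hw⟩ := Submodule.mem_sup.mp (hG.comul_mem j y hy)
    rw [← hz, ← hw, TensorProduct.add_tmul, TensorProduct.tmul_add, TensorProduct.tmul_add, map_add,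
      map_add, map_add]
    -- In three of the four products at least one left leg has dropped a step, so the total degree
    -- on the left is at most `n - 1`. In the last one both right legs are in degree zero.
    refine add_mem (add_mem ?_ ?_) (add_mem ?_ ?_)
    · refine Submodule.mem_sup_left (Submodule.map₂_le_map₂ ?_ le_top
        (tensorTensorTensorComm_mem hz₁ hw₁))
      exact (Submodule.map₂_le_map₂ le_rfl (hG.pred_le j)).trans (map₂_pred_left_le F G hij)
    · refine Submodule.mem_sup_left (Submodule.map₂_le_map₂ ?_ le_top
        (tensorTensorTensorComm_mem hz₁ hw₂))
      exact map₂_pred_left_le F G hij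
    · refine Submodule.mem_sup_left (Submodule.map₂_le_map₂ ?_ le_top
        (tensorTensorTensorComm_mem hz₂ hw₁))
      exact map₂_pred_right_le F G hij
    · refine Submodule.mem_sup_right (Submodule.map₂_le_map₂ ?_ ?_
        (tensorTensorTensorComm_mem hz₂ hw₂))
      · exact map₂_le_tensorFiltration F G hij
      · exact map₂_le_tensorFiltration F G rfl

theorem map_tensorTensorTensorComm {K A B C D A' B' C' D' P Q : Type*} [CommRing K]
    [AddCommMonoid A] [Module K A] [AddCommMonoid B] [Module K B] [AddCommMonoid C] [Module K C]
    [AddCommMonoid D] [Module K D] [AddCommMonoid A'] [Module K A'] [AddCommMonoid B']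
    [Module K B'] [AddCommMonoid C'] [Module K C'] [AddCommMonoid D'] [Module K D']
    [AddCommMonoid P] [Module K P] [AddCommMonoid Q] [Module K Q]
    (m : A' ⊗[K] C' →ₗ[K] P) (n : B' ⊗[K] D' →ₗ[K] Q) (a : A →ₗ[K] A') (b : B →ₗ[K] B')
    (c : C →ₗ[K] C') (d : D →ₗ[K] D') (z : A ⊗[K] B) (w : C ⊗[K] D) :
    TensorProduct.map (m ∘ₗ TensorProduct.map a c) (n ∘ₗ TensorProduct.map b d)
      (TensorProduct.tensorTensorTensorComm K A B C D (z ⊗ₜ w)) =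
    TensorProduct.map m n (TensorProduct.tensorTensorTensorComm K A' B' C' D'
      (TensorProduct.map a b z ⊗ₜ TensorProduct.map c d w)) := by
  induction z using TensorProduct.induction_on with
  | zero => simp
  | tmul x y =>
    induction w using TensorProduct.induction_on with
    | zero => simp
    | tmul x y => simp
    | add x y hx hy => simp only [map_add, TensorProduct.tmul_add, hx, hy]
  | add x y hx hy => simp only [map_add, TensorProduct.add_tmul, hx, hy]

end TensorFiltration

namespace HopfBimodule

variable {K H M : Type*} [Field K] [Ring H] [HopfAlgebra K H] [AddCommGroup M] [Module K M]
  [Module H M] [IsScalarTower K H M] [Module Hᵐᵒᵖ M] [IsScalarTower K Hᵐᵒᵖ M]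
  [SMulCommClass H Hᵐᵒᵖ M] {X : HopfBimodule K H M}
  {T : Type*} [AddCommGroup T] [Module K T] {e : T ≃ₗ[K] X.Cotensor}

theorem projM_eq_zero {x : T} (hx : x ∈ (X.degFiltration 0).comap e.toLinearMap) :
    X.projM e x = 0 := by
  have h : (e x).2 0 = 0 := hx 0 le_rfl
  have h1 : X.projM e x = TPow.zeroEquiv K M ((e x).2 0 : TPow K M 0) := rfl
  rw [h1, h]
  simp

variable (e) in
/-- The component in `M` of the product. -/
def mulDegOne : T ⊗[K] T →ₗ[K] M :=
  leftAct K H M ∘ₗ TensorProduct.map (X.projH e) (X.projM e) +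
    rightAct K H M ∘ₗ TensorProduct.map (X.projM e) (X.projH e)

theorem mulDegOne_tmul (x y : T) : mulDegOne e (x ⊗ₜ y) =
    X.projH e x • X.projM e y + MulOpposite.op (X.projH e y) • X.projM e x := by
  simp [mulDegOne, leftAct, rightAct]

namespace IsCotensorCoalgebra

variable [Coalgebra K T]

/-- The projection to `H`, as a homomorphism of coalgebras. -/
def projHom (he : X.IsCotensorCoalgebra e) : T →ₗc[K] H where
  __ := X.projH e
  counit_comp := LinearMap.ext he.counit_projH
  map_comp_comul := LinearMap.ext he.comul_projH

theorem comul_inl (he : X.IsCotensorCoalgebra e) (h : H) :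
    Coalgebra.comul (R := K) (e.symm (LinearMap.inl K H X.CotPos h)) =
      TensorProduct.map (e.symm.toLinearMap ∘ₗ LinearMap.inl K H X.CotPos)
        (e.symm.toLinearMap ∘ₗ LinearMap.inl K H X.CotPos) (Coalgebra.comul (R := K) h) := by
  have hi : Function.Injective
      (TensorProduct.map (X.incl ∘ₗ e.toLinearMap) (X.incl ∘ₗ e.toLinearMap)) :=
    map_injective (X.incl_injective.comp e.injective) (X.incl_injective.comp e.injective)
  apply hi
  have h1 := he.comul (e.symm (LinearMap.inl K H X.CotPos h))
  refine h1.trans ?_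
  rw [LinearEquiv.apply_symm_apply, exists_deconcat_inl]
  exact (map_incl_map_symm e _ _ _).symm

/-- The inclusion of `H`, as a homomorphism of coalgebras. -/
def inclHom (he : X.IsCotensorCoalgebra e) : H →ₗc[K] T where
  __ := e.symm.toLinearMap ∘ₗ LinearMap.inl K H X.CotPos
  counit_comp := by
    ext h
    have h1 := he.counit (e.symm (LinearMap.inl K H X.CotPos h))
    rw [LinearEquiv.apply_symm_apply] at h1
    exact h1
  map_comp_comul := LinearMap.ext fun h => (he.comul_inl h).symm

/-- The universal property is applied to `T ⊗ T` with the tensor filtration. The prescribed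
component in `M` is compatible with both coactions because `δL` and `δR` are bimodule maps, and it
vanishes in filtration degree zero because both factors then have no component in `M`. -/
theorem exists_mul (he : X.IsCotensorCoalgebra e) : ∃ m : T ⊗[K] T →ₗc[K] T,
    (∀ x y, X.projH e (m (x ⊗ₜ y)) = X.projH e x * X.projH e y) ∧
    ∀ x y, X.projM e (m (x ⊗ₜ y)) =
      X.projH e x • X.projM e y + MulOpposite.op (X.projH e y) • X.projM e x := by
  set f₀ : T ⊗[K] T →ₗc[K] H :=
    (Bialgebra.mulCoalgHom K H).comp (Coalgebra.TensorProduct.map he.projHom he.projHom)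
  have hf₀ : (f₀ : T ⊗[K] T →ₗ[K] H) =
    LinearMap.mul' K H ∘ₗ TensorProduct.map (X.projH e) (X.projH e) := rfl
  obtain ⟨m, hH, hM⟩ := he.exists_lift (f₁ := mulDegOne e)
    (he.isCoalgFiltration.tensor he.isCoalgFiltration) f₀ (by
      intro c
      induction c using TensorProduct.induction_on with
      | zero => simp only [map_zero]
      | add x y hx hy => simp only [map_add, hx, hy]
      | tmul x y =>
        have h1 := LinearMap.congr_fun X.δL_leftAct (X.projH e x ⊗ₜ X.projM e y)
        have h2 := LinearMap.congr_fun X.δL_rightAct (X.projM e x ⊗ₜ X.projH e y)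
        simp only [LinearMap.comp_apply, TensorProduct.map_tmul, LinearEquiv.coe_coe,
          ← he.comul_projH, ← he.projH_projM_comul] at h1 h2
        rw [hf₀, comul_tmul_eq, mulDegOne, TensorProduct.map_add_right, LinearMap.add_apply,
          LinearMap.add_apply, map_add, map_tensorTensorTensorComm, map_tensorTensorTensorComm,
          ← h1, ← h2]
        rfl) (by
      intro c
      induction c using TensorProduct.induction_on with
      | zero => simp only [map_zero]
      | add x y hx hy => simp only [map_add, hx, hy]
      | tmul x y =>
        have h1 := LinearMap.congr_fun X.δR_leftAct (X.projH e x ⊗ₜ X.projM e y)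
        have h2 := LinearMap.congr_fun X.δR_rightAct (X.projM e x ⊗ₜ X.projH e y)
        simp only [LinearMap.comp_apply, TensorProduct.map_tmul, LinearEquiv.coe_coe,
          ← he.comul_projH, ← he.projM_projH_comul] at h1 h2
        rw [hf₀, comul_tmul_eq, mulDegOne, TensorProduct.map_add_left, LinearMap.add_apply,
          LinearMap.add_apply, map_add, map_tensorTensorTensorComm, map_tensorTensorTensorComm,
          ← h1, ← h2]
        rfl) (by
      intro c hc
      have h1 : tensorFiltration (fun n => (X.degFiltration n).comap e.toLinearMap)
          (fun n => (X.degFiltration n).comap e.toLinearMap) 0 ≤ LinearMap.ker (mulDegOne e) := by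
        refine tensorFiltration_le fun i j hij x hx y hy => ?_
        obtain ⟨rfl, rfl⟩ : i = 0 ∧ j = 0 := by omega
        rw [LinearMap.mem_ker, mulDegOne_tmul, projM_eq_zero hx, projM_eq_zero hy, smul_zero,
          smul_zero, add_zero]
      exact h1 hc)
  exact ⟨m, fun x y => hH (x ⊗ₜ y), fun x y => (hM _).trans (mulDegOne_tmul x y)⟩

end IsCotensorCoalgebra

end HopfBimodule

end YangBaxter

namespace YangBaxter

/-! ### The bialgebra structure -/

namespace HopfBimodule

variable {K H M : Type*} [Field K] [Ring H] [HopfAlgebra K H] [AddCommGroup M] [Module K M]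
  [Module H M] [IsScalarTower K H M] [Module Hᵐᵒᵖ M] [IsScalarTower K Hᵐᵒᵖ M]
  [SMulCommClass H Hᵐᵒᵖ M] (X : HopfBimodule K H M)

/-- The product of the cotensor Hopf algebra. -/
def cotMul : X.CotensorAlgebra ⊗[K] X.CotensorAlgebra →ₗc[K] X.CotensorAlgebra :=
  X.isCotensorCoalgebra.exists_mul.choose

instance : Mul X.CotensorAlgebra := ⟨fun x y => X.cotMul (x ⊗ₜ y)⟩

instance : One X.CotensorAlgebra := ⟨X.isCotensorCoalgebra.inclHom 1⟩

variable {X}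

theorem projH_cotMul (x y : X.CotensorAlgebra) : X.projH X.cotensorEquiv (x * y) =
    X.projH X.cotensorEquiv x * X.projH X.cotensorEquiv y :=
  X.isCotensorCoalgebra.exists_mul.choose_spec.1 x y

theorem projM_cotMul (x y : X.CotensorAlgebra) : X.projM X.cotensorEquiv (x * y) =
    X.projH X.cotensorEquiv x • X.projM X.cotensorEquiv y +
      MulOpposite.op (X.projH X.cotensorEquiv y) • X.projM X.cotensorEquiv x :=
  X.isCotensorCoalgebra.exists_mul.choose_spec.2 x y

theorem projH_cotOne : X.projH X.cotensorEquiv 1 = 1 := rfl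

theorem projM_cotOne : X.projM X.cotensorEquiv 1 = 0 :=
  projM_eq_zero (X.inl_mem_degFiltration 0 1)

theorem comul_cotOne : Coalgebra.comul (R := K) (1 : X.CotensorAlgebra) = 1 ⊗ₜ 1 := by
  have h := CoalgHomClass.map_comp_comul_apply X.isCotensorCoalgebra.inclHom (1 : H)
  rw [Bialgebra.comul_one, Algebra.TensorProduct.one_def, TensorProduct.map_tmul] at h
  exact h.symm

theorem counit_cotOne : Coalgebra.counit (R := K) (1 : X.CotensorAlgebra) = 1 := by
  have h := LinearMap.congr_fun (CoalgHomClass.counit_comp X.isCotensorCoalgebra.inclHom) (1 : H)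
  exact h.trans Bialgebra.counit_one

theorem comul_cotMul (x y : X.CotensorAlgebra) : Coalgebra.comul (R := K) (x * y) =
    TensorProduct.map (X.cotMul : _ →ₗ[K] X.CotensorAlgebra) (X.cotMul : _ →ₗ[K] X.CotensorAlgebra)
      (TensorProduct.tensorTensorTensorComm K _ _ _ _
        (Coalgebra.comul (R := K) x ⊗ₜ Coalgebra.comul (R := K) y)) := by
  rw [← comul_tmul_eq]
  exact (CoalgHomClass.map_comp_comul_apply X.cotMul (x ⊗ₜ y)).symm

theorem counit_cotMul (x y : X.CotensorAlgebra) : Coalgebra.counit (R := K) (x * y) =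
    Coalgebra.counit (R := K) x * Coalgebra.counit (R := K) y := by
  have h := LinearMap.congr_fun (CoalgHomClass.counit_comp X.cotMul) (x ⊗ₜ y)
  refine h.trans ?_
  rw [TensorProduct.counit_tmul, smul_eq_mul, mul_comm]

/-- Since `1` is grouplike, multiplication by it respects coproducts; it has the same components as
the identity, so uniqueness applies. -/
theorem cotOne_mul (x : X.CotensorAlgebra) : 1 * x = x := by
  have h : (X.cotMul : _ →ₗ[K] X.CotensorAlgebra) ∘ₗ TensorProduct.mk K _ _ (1 : X.CotensorAlgebra) =
      LinearMap.id := by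
    refine X.isCotensorCoalgebra.hom_ext ?_ ?_ ?_ ?_
    · ext x
      refine Eq.trans ?_ (comul_cotMul 1 x).symm
      rw [comul_cotOne, LinearMap.comp_apply]
      induction Coalgebra.comul (R := K) x using TensorProduct.induction_on with
      | zero => simp
      | tmul x y => simp
      | add x y hx hy => simp only [map_add, TensorProduct.tmul_add, hx, hy]
    · rw [TensorProduct.map_id, LinearMap.id_comp, LinearMap.comp_id]
    · ext x
      refine (projH_cotMul 1 x).trans ?_
      rw [projH_cotOne, one_mul]
      rfl
    · ext x
      refine (projM_cotMul 1 x).trans ?_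
      rw [projH_cotOne, projM_cotOne, one_smul, smul_zero, add_zero]
      rfl
  exact LinearMap.congr_fun h x

theorem mul_cotOne (x : X.CotensorAlgebra) : x * 1 = x := by
  have h : (X.cotMul : _ →ₗ[K] X.CotensorAlgebra) ∘ₗ (TensorProduct.mk K _ _).flip (1 : X.CotensorAlgebra) =
      LinearMap.id := by
    refine X.isCotensorCoalgebra.hom_ext ?_ ?_ ?_ ?_
    · ext x
      refine Eq.trans ?_ (comul_cotMul x 1).symm
      rw [comul_cotOne, LinearMap.comp_apply]
      induction Coalgebra.comul (R := K) x using TensorProduct.induction_on with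
      | zero => simp
      | tmul x y => simp
      | add x y hx hy => simp only [map_add, TensorProduct.add_tmul, hx, hy]
    · rw [TensorProduct.map_id, LinearMap.id_comp, LinearMap.comp_id]
    · ext x
      refine (projH_cotMul x 1).trans ?_
      rw [projH_cotOne, mul_one]
      rfl
    · ext x
      refine (projM_cotMul x 1).trans ?_
      rw [projH_cotOne, projM_cotOne, MulOpposite.op_one, one_smul, smul_zero, zero_add]
      rfl
  exact LinearMap.congr_fun h x

/-- Both bracketings are coalgebra maps on the triple tensor product. Their components in `H` agree
by associativity there, and those in `M` by the bimodule axioms. -/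
theorem cotMul_assoc (x y z : X.CotensorAlgebra) : x * y * z = x * (y * z) := by
  set f : (X.CotensorAlgebra ⊗[K] X.CotensorAlgebra) ⊗[K] X.CotensorAlgebra →ₗc[K]
      X.CotensorAlgebra := X.cotMul.comp (CoalgHom.rTensor _ X.cotMul) with hf
  set g : (X.CotensorAlgebra ⊗[K] X.CotensorAlgebra) ⊗[K] X.CotensorAlgebra →ₗc[K]
      X.CotensorAlgebra := (X.cotMul.comp (CoalgHom.lTensor _ X.cotMul)).comp
        (Coalgebra.TensorProduct.assoc K K X.CotensorAlgebra X.CotensorAlgebra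
          X.CotensorAlgebra).toCoalgHom with hg
  have hf' : ∀ x y z, f ((x ⊗ₜ y) ⊗ₜ z) = x * y * z := fun _ _ _ => rfl
  have hg' : ∀ x y z, g ((x ⊗ₜ y) ⊗ₜ z) = x * (y * z) := fun _ _ _ => rfl
  have h : (f : (X.CotensorAlgebra ⊗[K] X.CotensorAlgebra) ⊗[K] X.CotensorAlgebra →ₗ[K]
      X.CotensorAlgebra) = (g : (X.CotensorAlgebra ⊗[K] X.CotensorAlgebra) ⊗[K] X.CotensorAlgebra
      →ₗ[K] X.CotensorAlgebra) := by
    refine X.isCotensorCoalgebra.hom_ext (CoalgHomClass.map_comp_comul f)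
      (CoalgHomClass.map_comp_comul g) ?_ ?_
    · refine TensorProduct.ext_threefold fun x y z => ?_
      refine (congrArg (X.projH X.cotensorEquiv) (hf' x y z)).trans
        (Eq.trans ?_ (congrArg (X.projH X.cotensorEquiv) (hg' x y z)).symm)
      rw [projH_cotMul, projH_cotMul, projH_cotMul, projH_cotMul, mul_assoc]
    · refine TensorProduct.ext_threefold fun x y z => ?_
      refine (congrArg (X.projM X.cotensorEquiv) (hf' x y z)).trans
        (Eq.trans ?_ (congrArg (X.projM X.cotensorEquiv) (hg' x y z)).symm)
      rw [projM_cotMul, projM_cotMul, projM_cotMul, projM_cotMul, projH_cotMul, projH_cotMul,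
        smul_add, smul_add, MulOpposite.op_mul, mul_smul, mul_smul,
        smul_comm (X.projH X.cotensorEquiv x) (MulOpposite.op (X.projH X.cotensorEquiv z)),
        add_assoc]
  rw [← hf', ← hg']
  exact LinearMap.congr_fun h _

instance : Ring X.CotensorAlgebra :=
  { (inferInstance : AddCommGroup X.CotensorAlgebra), (inferInstance : Mul X.CotensorAlgebra),
    (inferInstance : One X.CotensorAlgebra) with
    left_distrib := fun x y z => by
      change X.cotMul (x ⊗ₜ (y + z)) = X.cotMul (x ⊗ₜ y) + X.cotMul (x ⊗ₜ z)
      rw [TensorProduct.tmul_add, map_add]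
    right_distrib := fun x y z => by
      change X.cotMul ((x + y) ⊗ₜ z) = X.cotMul (x ⊗ₜ z) + X.cotMul (y ⊗ₜ z)
      rw [TensorProduct.add_tmul, map_add]
    zero_mul := fun x => by
      change X.cotMul (0 ⊗ₜ x) = 0
      rw [TensorProduct.zero_tmul, map_zero]
    mul_zero := fun x => by
      change X.cotMul (x ⊗ₜ 0) = 0
      rw [TensorProduct.tmul_zero, map_zero]
    mul_assoc := cotMul_assoc
    one_mul := cotOne_mul
    mul_one := mul_cotOne }

instance : Algebra K X.CotensorAlgebra :=
  Algebra.ofModule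
    (fun a x y => by
      change X.cotMul ((a • x) ⊗ₜ y) = a • X.cotMul (x ⊗ₜ y)
      rw [← TensorProduct.smul_tmul', map_smul])
    (fun a x y => by
      change X.cotMul (x ⊗ₜ (a • y)) = a • X.cotMul (x ⊗ₜ y)
      rw [TensorProduct.tmul_smul, map_smul])

instance : Bialgebra K X.CotensorAlgebra :=
  Bialgebra.mk' K X.CotensorAlgebra counit_cotOne (fun {a b} => counit_cotMul a b)
    (comul_cotOne.trans Algebra.TensorProduct.one_def.symm) (fun {a b} => by
      rw [comul_cotMul]
      induction Coalgebra.comul (R := K) a using TensorProduct.induction_on with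
      | zero => simp
      | tmul x y =>
        induction Coalgebra.comul (R := K) b using TensorProduct.induction_on with
        | zero => simp
        | tmul x y =>
          rw [Algebra.TensorProduct.tmul_mul_tmul]
          rfl
        | add x y hx hy => simp only [map_add, TensorProduct.tmul_add, mul_add, hx, hy]
      | add x y hx hy => simp only [map_add, TensorProduct.add_tmul, add_mul, hx, hy])

end HopfBimodule

end YangBaxter

namespace YangBaxter

open WithConv

/-! ### Takeuchi's criterion and the antipode -/

section Takeuchi

variable {K C R : Type*} [CommRing K] [AddCommGroup C] [Module K C] [Coalgebra K C]
  [Ring R] [Algebra K R] {F : ℕ → Submodule K C}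

/-- `γ` kills `F 0`, and each further convolution factor uses up one step of the filtration, so `γ ^
(n + 1)` kills `F n`. -/
theorem IsCoalgFiltration.conv_pow_eq_zero (hF : IsCoalgFiltration F) {γ : WithConv (C →ₗ[K] R)}
    (hγ : ∀ c ∈ F 0, γ c = 0) {n k : ℕ} (hk : n < k) {c : C} (hc : c ∈ F n) :
    (γ ^ k) c = 0 := by
  have h : ∀ n, ∀ c ∈ F n, (γ ^ (n + 1)) c = 0 := by
    intro n
    induction n with
    | zero => simpa using hγ
    | succ n ih =>
      intro c hc
      rw [pow_succ, LinearMap.convMul_apply,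
        hF.map_comul_eq_zero (n := n + 1) (fun c hc => ih c hc) hγ hc, map_zero]
  obtain ⟨m, rfl⟩ : ∃ m, k = m + 1 := ⟨k - 1, by omega⟩
  exact h m c (hF.mono (by omega) hc)

/-- The geometric series of a locally nilpotent map is a convolution inverse of `1 - γ`. -/
theorem isUnit_one_sub_of_locally_nilpotent {γ : WithConv (C →ₗ[K] R)}
    (hN : ∀ c, ∃ N, ∀ k, N ≤ k → (γ ^ k) c = 0) : IsUnit (1 - γ) := by
  -- At each `c` the geometric series is a finite sum whose length depends on `c`. Linearity of `s`
  -- is verified on a partial sum long enough for all arguments involved.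
  obtain ⟨s, hs⟩ : ∃ s : WithConv (C →ₗ[K] R), ∀ c, ∃ N, ∀ m, N ≤ m →
      s c = (∑ k ∈ Finset.range m, γ ^ k : WithConv (C →ₗ[K] R)) c := by
    choose N hN using hN
    have hsum : ∀ (m : ℕ) (c : C), (∑ k ∈ Finset.range m, γ ^ k : WithConv (C →ₗ[K] R)) c =
        ∑ k ∈ Finset.range m, (γ ^ k) c := by
      intro m c
      induction m with
      | zero => simp
      | succ m ih => rw [Finset.sum_range_succ, Finset.sum_range_succ, ← ih]; rfl
    have hconst : ∀ c m, N c ≤ m → ∑ k ∈ Finset.range m, (γ ^ k) c =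
        ∑ k ∈ Finset.range (N c), (γ ^ k) c := fun c m hm =>
      Finset.eventually_constant_sum (hN c) hm
    refine ⟨toConv
      { toFun := fun c => ∑ k ∈ Finset.range (N c), (γ ^ k) c
        map_add' := fun x y => ?_
        map_smul' := fun a x => ?_ }, fun c => ⟨N c, fun m hm => ?_⟩⟩
    · have h1 : N x ≤ N x + N y + N (x + y) := by omega
      have h2 : N y ≤ N x + N y + N (x + y) := by omega
      have h3 : N (x + y) ≤ N x + N y + N (x + y) := by omega
      rw [← hconst _ _ h1, ← hconst _ _ h2, ← hconst _ _ h3, ← Finset.sum_add_distrib]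
      simp only [map_add]
    · have h1 : N x ≤ N x + N (a • x) := by omega
      have h2 : N (a • x) ≤ N x + N (a • x) := by omega
      rw [← hconst _ _ h1, ← hconst _ _ h2, RingHom.id_apply, Finset.smul_sum]
      simp only [map_smul]
    · rw [hsum, hconst c m hm]
      rfl
  -- A tensor involves only finitely many legs, so one truncation of the series serves for all of
  -- them in a convolution product.
  have hl : ∀ (f : WithConv (C →ₗ[K] R)) (z : C ⊗[K] C), ∃ N, ∀ m, N ≤ m →
      TensorProduct.map f.ofConv s.ofConv z = TensorProduct.map f.ofConv
        (∑ k ∈ Finset.range m, γ ^ k : WithConv (C →ₗ[K] R)).ofConv z ∧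
      TensorProduct.map s.ofConv f.ofConv z = TensorProduct.map
        (∑ k ∈ Finset.range m, γ ^ k : WithConv (C →ₗ[K] R)).ofConv f.ofConv z := by
    intro f z
    induction z using TensorProduct.induction_on with
    | zero => exact ⟨0, fun m _ => by simp only [map_zero, and_self]⟩
    | tmul x y =>
      obtain ⟨N, hN⟩ := hs x
      obtain ⟨N', hN'⟩ := hs y
      refine ⟨N + N', fun m hm => ⟨?_, ?_⟩⟩
      · exact congrArg (f x ⊗ₜ[K] ·) (hN' m (by omega))
      · exact congrArg (· ⊗ₜ[K] f y) (hN m (by omega))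
    | add x y hx hy =>
      obtain ⟨N, hN⟩ := hx
      obtain ⟨N', hN'⟩ := hy
      refine ⟨N + N', fun m hm => ?_⟩
      rw [map_add, map_add, map_add, map_add, (hN m (by omega)).1, (hN m (by omega)).2,
        (hN' m (by omega)).1, (hN' m (by omega)).2]
      exact ⟨rfl, rfl⟩
  refine isUnit_iff_exists.mpr ⟨s, ?_, ?_⟩
  · refine WithConv.ext (LinearMap.ext fun c => ?_)
    obtain ⟨N, hN'⟩ := hN c
    obtain ⟨m, hm⟩ := hl (1 - γ) (Coalgebra.comul c)
    have h1 : ((1 - γ) * s : WithConv (C →ₗ[K] R)) c =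
        ((1 - γ) * ∑ k ∈ Finset.range (N + m), γ ^ k : WithConv (C →ₗ[K] R)) c := by
      rw [LinearMap.convMul_apply, LinearMap.convMul_apply, (hm (N + m) (by omega)).1]
    have h2 : (1 - γ ^ (N + m) : WithConv (C →ₗ[K] R)) c =
      (1 : WithConv (C →ₗ[K] R)) c - (γ ^ (N + m)) c := rfl
    refine h1.trans ?_
    rw [mul_neg_geom_sum, h2, hN' _ (by omega), sub_zero]
  · refine WithConv.ext (LinearMap.ext fun c => ?_)
    obtain ⟨N, hN'⟩ := hN c
    obtain ⟨m, hm⟩ := hl (1 - γ) (Coalgebra.comul c)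
    have h1 : (s * (1 - γ) : WithConv (C →ₗ[K] R)) c =
        ((∑ k ∈ Finset.range (N + m), γ ^ k) * (1 - γ) : WithConv (C →ₗ[K] R)) c := by
      rw [LinearMap.convMul_apply, LinearMap.convMul_apply, (hm (N + m) (by omega)).2]
    have h2 : (1 - γ ^ (N + m) : WithConv (C →ₗ[K] R)) c =
      (1 : WithConv (C →ₗ[K] R)) c - (γ ^ (N + m)) c := rfl
    refine h1.trans ?_
    rw [geom_sum_mul_neg, h2, hN' _ (by omega), sub_zero]

/-- Takeuchi's criterion: if `f` agrees on `F 0` with the convolution inverse `g` of `g'`, then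
`1 - f * g'` is locally nilpotent. -/
theorem IsCoalgFiltration.locally_nilpotent (hF : IsCoalgFiltration F)
    {f g g' : WithConv (C →ₗ[K] R)} (h₁ : g * g' = 1) (hfg : ∀ c ∈ F 0, f c = g c) (c : C) :
    ∃ N, ∀ k, N ≤ k → ((1 - f * g') ^ k : WithConv (C →ₗ[K] R)) c = 0 := by
  obtain ⟨n, hn⟩ := hF.exhaustive c
  refine ⟨n + 1, fun k hk => hF.conv_pow_eq_zero (fun c hc => ?_) hk hn⟩
  -- For `n = 0` the bound says `Δ (F 0) ⊆ F 0 ⊗ F 0`, so `(g - f) * g' = 1 - f * g'` vanishes on `F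
  -- 0`.
  have h1 : Submodule.map₂ (TensorProduct.mk K C C) (predFiltration F 0) ⊤ ⊔
      Submodule.map₂ (TensorProduct.mk K C C) (F 0) (F 0) ≤
        LinearMap.ker (TensorProduct.map (g - f).ofConv g'.ofConv) := by
    refine sup_le (Submodule.map₂_le.mpr fun x hx y _ => ?_)
      (Submodule.map₂_le.mpr fun x hx y _ => ?_)
    · rw [(Submodule.mem_bot K).mp hx]
      simp
    · simp [hfg x hx]
  have h3 : TensorProduct.map (g - f).ofConv g'.ofConv (Coalgebra.comul (R := K) c) = 0 :=
    h1 (hF.comul_mem 0 c hc)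
  rw [← h₁, ← sub_mul, LinearMap.convMul_apply, h3, map_zero]

/-- The geometric series makes `f * g' = 1 - (1 - f * g')` a unit, and `f = (f * g') * g`. -/
theorem isUnit_of_locally_nilpotent {f g g' : WithConv (C →ₗ[K] R)} (h₁ : g * g' = 1)
    (h₂ : g' * g = 1)
    (hN : ∀ c, ∃ N, ∀ k, N ≤ k → ((1 - f * g') ^ k : WithConv (C →ₗ[K] R)) c = 0) :
    IsUnit f := by
  have h := isUnit_one_sub_of_locally_nilpotent hN
  rw [sub_sub_cancel] at h
  have h4 := h.mul (isUnit_iff_exists.mpr ⟨g', h₁, h₂⟩ : IsUnit g)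
  rwa [mul_assoc, h₂, mul_one] at h4

end Takeuchi

end YangBaxter

namespace YangBaxter

open WithConv

namespace HopfBimodule

variable {K H M : Type*} [Field K] [Ring H] [HopfAlgebra K H] [AddCommGroup M] [Module K M]
  [Module H M] [IsScalarTower K H M] [Module Hᵐᵒᵖ M] [IsScalarTower K Hᵐᵒᵖ M]
  [SMulCommClass H Hᵐᵒᵖ M] {X : HopfBimodule K H M}

namespace IsCotensorCoalgebra

section Bialgebra

variable {T : Type*} [Ring T] [Bialgebra K T] {e : T ≃ₗ[K] X.Cotensor}
  (he : X.IsCotensorCoalgebra e) (hone : e 1 = (1, 0))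
  (hH : ∀ x y : T, X.projH e (x * y) = X.projH e x * X.projH e y)
  (hM : ∀ x y : T, X.projM e (x * y) =
    X.projH e x • X.projM e y + MulOpposite.op (X.projH e y) • X.projM e x)

/-- The projection to `H`, as a homomorphism of bialgebras. -/
def projBialgHom : T →ₐc[K] H :=
  BialgHom.ofAlgHom (AlgHom.ofLinearMap (X.projH e) (congrArg Prod.fst hone) hH)
    (AlgHom.toLinearMap_injective (LinearMap.ext he.counit_projH))
    (AlgHom.toLinearMap_injective (LinearMap.ext he.comul_projH))

theorem projH_inclHom (h : H) : X.projH e (he.inclHom h) = h :=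
  congrArg Prod.fst (e.apply_symm_apply (h, 0))

theorem projM_inclHom (h : H) : X.projM e (he.inclHom h) = 0 := by
  apply projM_eq_zero
  rw [Submodule.mem_comap]
  exact (congrArg (· ∈ X.degFiltration 0) (e.apply_symm_apply _)).mpr
    (X.inl_mem_degFiltration 0 h)

include hH hM in
-- Both sides are coalgebra maps on `H ⊗ H` whose component in `H` is the product and whose
-- component in `M` is zero.
theorem inclHom_mul (g h : H) : he.inclHom (g * h) = he.inclHom g * he.inclHom h := by
  set f₁ : H ⊗[K] H →ₗc[K] T := he.inclHom.comp (Bialgebra.mulCoalgHom K H)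
  set f₂ : H ⊗[K] H →ₗc[K] T :=
    (Bialgebra.mulCoalgHom K T).comp (Coalgebra.TensorProduct.map he.inclHom he.inclHom)
  have h1 : ∀ g h, f₁ (g ⊗ₜ h) = he.inclHom (g * h) := fun _ _ => rfl
  have h2 : ∀ g h, f₂ (g ⊗ₜ h) = he.inclHom g * he.inclHom h := fun _ _ => rfl
  have h3 : (f₁ : H ⊗[K] H →ₗ[K] T) = (f₂ : H ⊗[K] H →ₗ[K] T) := by
    refine he.hom_ext (CoalgHomClass.map_comp_comul f₁) (CoalgHomClass.map_comp_comul f₂)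
      (TensorProduct.ext' fun x y => ?_) (TensorProduct.ext' fun x y => ?_)
    · refine (congrArg (X.projH e) (h1 x y)).trans
        (Eq.trans ?_ (congrArg (X.projH e) (h2 x y)).symm)
      rw [hH, projH_inclHom, projH_inclHom, projH_inclHom]
    · refine (congrArg (X.projM e) (h1 x y)).trans
        (Eq.trans ?_ (congrArg (X.projM e) (h2 x y)).symm)
      rw [hM, projM_inclHom, projM_inclHom, projM_inclHom, smul_zero, smul_zero, add_zero]
  rw [← h1, ← h2]
  exact LinearMap.congr_fun h3 _

include hone in
theorem inclHom_one : he.inclHom 1 = 1 :=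
  e.injective ((e.apply_symm_apply _).trans hone.symm)

/-- The inclusion of `H`, as a homomorphism of bialgebras. -/
def inclBialgHom : H →ₐc[K] T :=
  BialgHom.ofAlgHom (AlgHom.ofLinearMap (he.inclHom : H →ₗ[K] T) (he.inclHom_one hone)
      (he.inclHom_mul hH hM))
    (AlgHom.toLinearMap_injective (CoalgHomClass.counit_comp he.inclHom))
    (AlgHom.toLinearMap_injective (CoalgHomClass.map_comp_comul he.inclHom))

/-- The identity agrees with `i ∘ p` on the degree zero part, which is `H`. The nilpotency is kept
as a separate result because sub-bialgebras inherit it. -/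
theorem locally_nilpotent (x : T) : ∃ N, ∀ k, N ≤ k →
    ((1 - toConv (LinearMap.id : T →ₗ[K] T) * convAlongInv he.projHom
      (he.inclBialgHom hone hH hM : H →ₐ[K] T)) ^ k : WithConv (T →ₗ[K] T)) x = 0 := by
  refine he.isCoalgFiltration.locally_nilpotent (convAlong_mul_inv (p := he.projHom)
    (f := (he.inclBialgHom hone hH hM : H →ₐ[K] T))) (fun c hc => ?_) x
  apply e.injective
  refine Eq.trans (b := ((e c).1, 0)) ?_ (e.apply_symm_apply _).symm
  refine Prod.ext rfl (DFinsupp.ext fun n => ?_)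
  exact hc n (Nat.zero_le n)

include he hone hH hM in
theorem isUnit_id : IsUnit (toConv (LinearMap.id : T →ₗ[K] T)) :=
  isUnit_of_locally_nilpotent (convAlong_mul_inv (p := he.projHom)
    (f := (he.inclBialgHom hone hH hM : H →ₐ[K] T))) (convAlongInv_mul (p := he.projHom)
    (f := (he.inclBialgHom hone hH hM : H →ₐ[K] T))) (he.locally_nilpotent hone hH hM)

/-- The antipode of the cotensor Hopf algebra. -/
@[reducible]
def hopfAlgebra : HopfAlgebra K T :=
  HopfAlgebra.ofConvInverse
    (↑(he.isUnit_id hone hH hM).unit⁻¹ : WithConv (T →ₗ[K] T)).ofConv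
    (IsUnit.val_inv_mul (he.isUnit_id hone hH hM)) (IsUnit.mul_val_inv (he.isUnit_id hone hH hM))

end Bialgebra

end IsCotensorCoalgebra

theorem cotensorEquiv_one : X.cotensorEquiv 1 = (1, 0) := rfl

instance : HopfAlgebra K X.CotensorAlgebra :=
  X.isCotensorCoalgebra.hopfAlgebra cotensorEquiv_one projH_cotMul projM_cotMul

variable (X) in
/-- The cotensor Hopf algebra exists. -/
theorem isCotensorHopfAlgebra : X.IsCotensorHopfAlgebra X.cotensorEquiv :=
  ⟨X.isCotensorCoalgebra.comul, X.isCotensorCoalgebra.counit, cotensorEquiv_one, projH_cotMul,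
    projM_cotMul⟩

theorem IsCotensorHopfAlgebra.isCotensorCoalgebra {T : Type*} [Ring T] [HopfAlgebra K T]
    {e : T ≃ₗ[K] X.Cotensor} (h : X.IsCotensorHopfAlgebra e) : X.IsCotensorCoalgebra e :=
  ⟨h.comul, h.counit⟩

end HopfBimodule

end YangBaxter

namespace YangBaxter

open WithConv

/-! ### Sub-bialgebras and the sub-Hopf algebra generated by `H` and `M` -/

section Sub

variable {K : Type*} [Field K]

section Coalgebra

variable {S T : Type*} [AddCommGroup S] [Module K S] [AddCommGroup T] [Module K T] [Coalgebra K T]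

/-- The coalgebra structure on a subspace that is closed under the coproduct. -/
@[reducible]
def coalgebraOfInjective {j : S →ₗ[K] T} (hj : Function.Injective j)
    {Δ : S →ₗ[K] S ⊗[K] S} (hΔ : TensorProduct.map j j ∘ₗ Δ = Coalgebra.comul ∘ₗ j) :
    Coalgebra K S where
  comul := Δ
  counit := Coalgebra.counit ∘ₗ j
  coassoc := by
    have hΔ' : ∀ s, TensorProduct.map j j (Δ s) = Coalgebra.comul (j s) := LinearMap.congr_fun hΔ
    ext s
    apply map_injective hj (map_injective hj hj)
    have h1 : ∀ z : S ⊗[K] S, TensorProduct.map j (TensorProduct.map j j)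
        (TensorProduct.assoc K S S S (Δ.rTensor S z)) =
        TensorProduct.assoc K T T T (Coalgebra.comul.rTensor T (TensorProduct.map j j z)) := by
      intro z
      induction z using TensorProduct.induction_on with
      | zero => simp only [map_zero]
      | add x y hx hy => simp only [map_add, hx, hy]
      | tmul x y =>
        rw [LinearMap.rTensor_tmul, TensorProduct.map_tmul, LinearMap.rTensor_tmul, ← hΔ']
        induction Δ x using TensorProduct.induction_on with
        | zero => simp
        | add x y hx hy => simp only [map_add, TensorProduct.add_tmul, hx, hy]
        | tmul x y => simp
    have h2 : ∀ z : S ⊗[K] S, TensorProduct.map j (TensorProduct.map j j) (Δ.lTensor S z) =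
        Coalgebra.comul.lTensor T (TensorProduct.map j j z) := by
      intro z
      induction z using TensorProduct.induction_on with
      | zero => simp only [map_zero]
      | add x y hx hy => simp only [map_add, hx, hy]
      | tmul x y =>
        rw [LinearMap.lTensor_tmul, TensorProduct.map_tmul, TensorProduct.map_tmul,
          LinearMap.lTensor_tmul, ← hΔ']
    simp only [LinearMap.comp_apply, LinearEquiv.coe_coe]
    rw [h1, h2, hΔ', Coalgebra.coassoc_apply]
  rTensor_counit_comp_comul := by
    ext s
    apply (TensorProduct.lid K S).injective
    apply hj
    have h1 : ∀ z : S ⊗[K] S,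
        j (TensorProduct.lid K S ((Coalgebra.counit (R := K) ∘ₗ j).rTensor S z)) =
        TensorProduct.lid K T (Coalgebra.counit.rTensor T (TensorProduct.map j j z)) := by
      intro z
      induction z using TensorProduct.induction_on with
      | zero => simp only [map_zero]
      | add x y hx hy => simp only [map_add, hx, hy]
      | tmul x y => simp
    have h2 := LinearMap.congr_fun hΔ s
    simp only [LinearMap.comp_apply] at h2
    rw [LinearMap.comp_apply, h1, h2, Coalgebra.rTensor_counit_comul]
    simp
  lTensor_counit_comp_comul := by
    ext s
    apply (TensorProduct.rid K S).injective
    apply hj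
    have h1 : ∀ z : S ⊗[K] S,
        j (TensorProduct.rid K S ((Coalgebra.counit (R := K) ∘ₗ j).lTensor S z)) =
        TensorProduct.rid K T (Coalgebra.counit.lTensor T (TensorProduct.map j j z)) := by
      intro z
      induction z using TensorProduct.induction_on with
      | zero => simp only [map_zero]
      | add x y hx hy => simp only [map_add, hx, hy]
      | tmul x y => simp
    have h2 := LinearMap.congr_fun hΔ s
    simp only [LinearMap.comp_apply] at h2
    rw [LinearMap.comp_apply, h1, h2, Coalgebra.lTensor_counit_comul]
    simp

end Coalgebra

/-- A subalgebra that is closed under the coproduct is a bialgebra. -/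
theorem exists_subBialgebra {T : Type u} [Ring T] [Bialgebra K T] (S : Subalgebra K T)
    (h : ∀ s ∈ S, Coalgebra.comul (R := K) s ∈
      LinearMap.range (TensorProduct.map (S.val : S →ₗ[K] T) (S.val : S →ₗ[K] T))) :
    ∃ (A : Type u) (_ : Ring A) (_ : Bialgebra K A) (j : A →ₐc[K] T),
      Function.Injective j ∧ Set.range j = S := by
  have hj : Function.Injective (S.val : S →ₗ[K] T) := Subtype.val_injective
  have hjj : Function.Injective (TensorProduct.map (S.val : S →ₗ[K] T) (S.val : S →ₗ[K] T)) :=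
    map_injective hj hj
  obtain ⟨Δ, hΔ⟩ := exists_comp_eq_of_range_le hjj
    (f := Coalgebra.comul ∘ₗ (S.val : S →ₗ[K] T)) fun s => h s s.2
  have hΔ' : ∀ s, TensorProduct.map (S.val : S →ₗ[K] T) (S.val : S →ₗ[K] T) (Δ s) =
    Coalgebra.comul (S.val s) := LinearMap.congr_fun hΔ
  have hm : ∀ z w : S ⊗[K] S, TensorProduct.map (S.val : S →ₗ[K] T) (S.val : S →ₗ[K] T) (z * w) =
      TensorProduct.map (S.val : S →ₗ[K] T) (S.val : S →ₗ[K] T) z *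
        TensorProduct.map (S.val : S →ₗ[K] T) (S.val : S →ₗ[K] T) w :=
    map_mul (Algebra.TensorProduct.map S.val S.val)
  let c : Coalgebra K S := coalgebraOfInjective hj hΔ
  have hc : ∀ s : S, Coalgebra.counit (R := K) s = Coalgebra.counit (R := K) (S.val s) :=
    fun _ => rfl
  let b : Bialgebra K S := Bialgebra.mk' K S
    (by rw [hc, map_one, Bialgebra.counit_one])
    (fun {a b} => by rw [hc, map_mul, Bialgebra.counit_mul]; rfl)
    (hjj (by
      refine (hΔ' 1).trans ?_
      rw [map_one, Bialgebra.comul_one, Algebra.TensorProduct.one_def,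
        Algebra.TensorProduct.one_def, TensorProduct.map_tmul]
      simp))
    (fun {x y} => hjj (by
      refine (hΔ' _).trans ?_
      rw [map_mul, Bialgebra.comul_mul, hm, ← hΔ', ← hΔ']
      rfl))
  exact ⟨S, inferInstance, b,
    BialgHom.ofAlgHom S.val rfl (AlgHom.toLinearMap_injective hΔ), hj, Subtype.range_val⟩

variable {S T : Type*} [Ring S] [Ring T]

/-- A homomorphism of bialgebras corestricts to a sub-bialgebra that contains its image. -/
theorem exists_bialgHom_lift {H : Type*} [Ring H] [Bialgebra K H] [Bialgebra K S] [Bialgebra K T]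
    {j : S →ₐc[K] T} (hj : Function.Injective j) {i : H →ₐc[K] T}
    (h : ∀ x, i x ∈ Set.range j) : ∃ i' : H →ₐc[K] S, ∀ x, j (i' x) = i x := by
  choose f hf using h
  have hfA : ∃ f' : H →ₐ[K] S, ∀ x, j (f' x) = i x :=
    ⟨AlgHom.ofLinearMap
      { toFun := f
        map_add' := fun x y => hj (by rw [map_add, hf, hf, hf, map_add])
        map_smul' := fun a x => hj (by rw [RingHom.id_apply, map_smul, hf, hf, map_smul]) }
      (hj (by rw [LinearMap.coe_mk, AddHom.coe_mk, hf, map_one, map_one]))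
      (fun x y => hj (by
        rw [LinearMap.coe_mk, AddHom.coe_mk, map_mul, hf, hf, hf, map_mul])), hf⟩
  obtain ⟨f', hf'⟩ := hfA
  have hjf : (j : S →ₗ[K] T) ∘ₗ (f' : H →ₗ[K] S) = (i : H →ₗ[K] T) := LinearMap.ext hf'
  refine ⟨BialgHom.ofAlgHom f' (AlgHom.toLinearMap_injective (LinearMap.ext fun x => ?_))
    (AlgHom.toLinearMap_injective (LinearMap.ext fun x => ?_)), hf'⟩
  · have h1 := LinearMap.congr_fun (CoalgHomClass.counit_comp j) (f' x)
    have h2 := LinearMap.congr_fun (CoalgHomClass.counit_comp i) x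
    refine h1.symm.trans (Eq.trans ?_ h2)
    exact congrArg _ (hf' x)
  · have hjj : Function.Injective (TensorProduct.map (j : S →ₗ[K] T) (j : S →ₗ[K] T)) :=
      map_injective hj hj
    apply hjj
    have h1 := CoalgHomClass.map_comp_comul_apply j (f' x)
    have h2 := CoalgHomClass.map_comp_comul_apply i x
    have h3 : TensorProduct.map (j : S →ₗ[K] T) (j : S →ₗ[K] T)
        (TensorProduct.map (f' : H →ₗ[K] S) (f' : H →ₗ[K] S) (Coalgebra.comul (R := K) x)) =
        TensorProduct.map (i : H →ₗ[K] T) (i : H →ₗ[K] T) (Coalgebra.comul (R := K) x) := by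
      rw [← LinearMap.comp_apply, ← TensorProduct.map_comp, hjf]
    exact h3.trans (h2.trans ((congrArg _ (hf' x).symm).trans h1.symm))

/-- If `T` is a Hopf algebra by Takeuchi's criterion, then so is every sub-bialgebra that contains
the image of `H`. -/
theorem isUnit_id_of_injective {H : Type*} [Ring H] [HopfAlgebra K H] [Bialgebra K S]
    [Bialgebra K T] {j : S →ₐc[K] T} (hj : Function.Injective j) {i : H →ₐ[K] T} {p : T →ₗc[K] H}
    {i' : H →ₐ[K] S} (hi' : ∀ x, j (i' x) = i x)
    (hN : ∀ x : T, ∃ N, ∀ k, N ≤ k →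
      ((1 - toConv (LinearMap.id : T →ₗ[K] T) * convAlongInv p i) ^ k : WithConv (T →ₗ[K] T)) x =
        0) :
    IsUnit (toConv (LinearMap.id : S →ₗ[K] S)) := by
  -- Convolution on `S` is compatible along `j` with convolution on `T`. So the element `1 - id * (i
  -- ∘ S ∘ p)` of `S` and all its powers are restrictions of those of `T`, and local nilpotency is
  -- inherited without a filtration of `S`.
  have hmul : ∀ {f g : WithConv (S →ₗ[K] S)} {f' g' : WithConv (T →ₗ[K] T)},
      (∀ s, j (f s) = f' (j s)) → (∀ s, j (g s) = g' (j s)) →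
      ∀ s, j ((f * g : WithConv (S →ₗ[K] S)) s) = (f' * g' : WithConv (T →ₗ[K] T)) (j s) := by
    intro f g f' g' hf hg s
    rw [LinearMap.convMul_apply, LinearMap.convMul_apply,
      ← CoalgHomClass.map_comp_comul_apply j s]
    induction Coalgebra.comul (R := K) s using TensorProduct.induction_on with
    | zero => simp
    | tmul x y => simp [hf, hg]
    | add x y hx hy => simp only [map_add, hx, hy]
  have hone : ∀ s, j ((1 : WithConv (S →ₗ[K] S)) s) = (1 : WithConv (T →ₗ[K] T)) (j s) := by
    intro s
    have h := LinearMap.congr_fun (CoalgHomClass.counit_comp j) s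
    have h' : Coalgebra.counit (R := K) (j s) = Coalgebra.counit (R := K) s := h
    rw [LinearMap.convOne_apply, LinearMap.convOne_apply, h']
    exact AlgHomClass.commutes j _
  have hγ : ∀ s, j ((1 - toConv (LinearMap.id : S →ₗ[K] S) *
      convAlongInv (p.comp (j : S →ₗc[K] T)) i' : WithConv (S →ₗ[K] S)) s) =
      (1 - toConv (LinearMap.id : T →ₗ[K] T) * convAlongInv p i : WithConv (T →ₗ[K] T)) (j s) := by
    intro s
    have h := hmul (f := toConv LinearMap.id) (f' := toConv LinearMap.id)
      (g := convAlongInv (p.comp (j : S →ₗc[K] T)) i') (g' := convAlongInv p i) (fun s => rfl)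
      (fun s => hi' _) s
    refine (map_sub j _ _).trans ?_
    exact congrArg₂ (· - ·) (hone s) h
  refine isUnit_of_locally_nilpotent (convAlong_mul_inv (p := p.comp (j : S →ₗc[K] T)) (f := i'))
    (convAlongInv_mul (p := p.comp (j : S →ₗc[K] T)) (f := i')) fun s => ?_
  obtain ⟨N, hN'⟩ := hN (j s)
  refine ⟨N, fun k hk => hj ?_⟩
  have hpow : ∀ (k : ℕ) s, j (((1 - toConv (LinearMap.id : S →ₗ[K] S) *
      convAlongInv (p.comp (j : S →ₗc[K] T)) i') ^ k : WithConv (S →ₗ[K] S)) s) =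
      ((1 - toConv (LinearMap.id : T →ₗ[K] T) * convAlongInv p i) ^ k : WithConv (T →ₗ[K] T))
        (j s) := by
    intro k
    induction k with
    | zero => simpa only [pow_zero] using hone
    | succ k ih =>
      rw [pow_succ, pow_succ]
      exact hmul ih hγ
  rw [hpow, hN' k hk, map_zero]

end Sub

end YangBaxter

namespace YangBaxter

open WithConv

namespace HopfBimodule

variable {K H M : Type*} [Field K] [Ring H] [HopfAlgebra K H] [AddCommGroup M] [Module K M]
  [Module H M] [IsScalarTower K H M] [Module Hᵐᵒᵖ M] [IsScalarTower K Hᵐᵒᵖ M]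
  [SMulCommClass H Hᵐᵒᵖ M] {X : HopfBimodule K H M}

/-- A word of one letter has no inner cuts, so only the two coactions remain. -/
theorem IsCotensorCoalgebra.comul_ofM {T : Type*} [AddCommGroup T] [Module K T] [Coalgebra K T]
    {e : T ≃ₗ[K] X.Cotensor} (he : X.IsCotensorCoalgebra e) (m : M) :
    Coalgebra.comul (R := K) (e.symm (X.ofM m)) =
      TensorProduct.map (e.symm.toLinearMap ∘ₗ LinearMap.inl K H X.CotPos)
        (e.symm.toLinearMap ∘ₗ X.ofM) (X.δL m) +
      TensorProduct.map (e.symm.toLinearMap ∘ₗ X.ofM)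
        (e.symm.toLinearMap ∘ₗ LinearMap.inl K H X.CotPos) (X.δR m) := by
  have hi : Function.Injective
      (TensorProduct.map (X.incl ∘ₗ e.toLinearMap) (X.incl ∘ₗ e.toLinearMap)) :=
    map_injective (X.incl_injective.comp e.injective) (X.incl_injective.comp e.injective)
  have hM : X.incl ∘ₗ X.ofM = X.ambInr ∘ₗ PosTensor.ι K M := by
    rw [← X.posIncl_comp_cotι]
    rfl
  apply hi
  rw [map_add, map_incl_map_symm, map_incl_map_symm, he.comul, LinearEquiv.apply_symm_apply,
    ← LinearMap.comp_apply X.incl, hM, LinearMap.comp_apply, deconcat_inr, posDeconcat_ι,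
    posCoact_ι, ← LinearMap.comp_apply (TensorProduct.map X.incl X.incl), ← TensorProduct.map_comp,
    ← LinearMap.comp_apply (TensorProduct.map X.incl X.incl), ← TensorProduct.map_comp, hM,
    incl_comp_inl, ← LinearMap.comp_apply (LinearMap.lTensor _ _), LinearMap.lTensor_comp_map,
    ← LinearMap.comp_apply (TensorProduct.map X.ambInr X.ambInl), LinearMap.map_comp_rTensor]

/-- Tensors of maps with values in a subalgebra have values in the tensor square of it. -/
theorem map_mem_range_map_val {T P Q : Type*} [Ring T] [Algebra K T] {A : Subalgebra K T}
    [AddCommGroup P] [Module K P] [AddCommGroup Q] [Module K Q] {f : P →ₗ[K] T} {g : Q →ₗ[K] T}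
    (hf : ∀ x, f x ∈ A) (hg : ∀ x, g x ∈ A) (z : P ⊗[K] Q) :
    TensorProduct.map f g z ∈ (Algebra.TensorProduct.map A.val A.val).range := by
  induction z using TensorProduct.induction_on with
  | zero => rw [map_zero]; exact zero_mem _
  | tmul x y => exact ⟨⟨f x, hf x⟩ ⊗ₜ ⟨g y, hg y⟩, rfl⟩
  | add x y hx hy => rw [map_add]; exact add_mem hx hy

namespace IsCotensorHopfAlgebra

variable {T : Type*} [Ring T] [HopfAlgebra K T] {e : T ≃ₗ[K] X.Cotensor}
  (h : X.IsCotensorHopfAlgebra e)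

/-- The inclusion of `H` in the cotensor Hopf algebra. -/
def i : H →ₐc[K] T := h.isCotensorCoalgebra.inclBialgHom h.one h.mul_fst h.mul_degOne

/-- The projection of the cotensor Hopf algebra onto `H`. -/
def p : T →ₐc[K] H := h.isCotensorCoalgebra.projBialgHom h.one h.mul_fst

theorem i_apply (x : H) : h.i x = e.symm (x, 0) := rfl

theorem p_apply (x : T) : h.p x = (e x).1 := rfl

theorem p_i (x : H) : h.p (h.i x) = x := by rw [p_apply, i_apply, LinearEquiv.apply_symm_apply]

theorem i_mem_generatedSubalgebra (x : H) : h.i x ∈ X.generatedSubalgebra e :=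
  Algebra.subset_adjoin (Or.inl ⟨x, rfl⟩)

include h

/-- The elements whose coproduct comes from the tensor square of the subalgebra form a subalgebra,
because the coproduct is multiplicative. It is therefore enough to look at `H`, with coproduct in `H
⊗ H`, and at `M`, with coproduct in `H ⊗ M + M ⊗ H`. -/
theorem comul_mem_generatedSubalgebra {s : T} (hs : s ∈ X.generatedSubalgebra e) :
    Coalgebra.comul (R := K) s ∈ LinearMap.range (TensorProduct.map
      ((X.generatedSubalgebra e).val : X.generatedSubalgebra e →ₗ[K] T)
      ((X.generatedSubalgebra e).val : X.generatedSubalgebra e →ₗ[K] T)) := by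
  have hH : ∀ x : H, e.symm (x, 0) ∈ X.generatedSubalgebra e :=
    fun x => Algebra.subset_adjoin (Or.inl ⟨x, rfl⟩)
  have hM : ∀ m : M, e.symm (X.ofM m) ∈ X.generatedSubalgebra e :=
    fun m => Algebra.subset_adjoin (Or.inr ⟨m, rfl⟩)
  have hle : X.generatedSubalgebra e ≤ (Algebra.TensorProduct.map (X.generatedSubalgebra e).val
      (X.generatedSubalgebra e).val).range.comap (Bialgebra.comulAlgHom K T) := by
    refine Algebra.adjoin_le ?_
    rintro _ (⟨x, rfl⟩ | ⟨m, rfl⟩)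
    · change Coalgebra.comul (R := K) _ ∈ AlgHom.range _
      refine (congrArg (· ∈ AlgHom.range _) (h.isCotensorCoalgebra.comul_inl x)).mpr ?_
      exact map_mem_range_map_val hH hH _
    · change Coalgebra.comul (R := K) _ ∈ AlgHom.range _
      refine (congrArg (· ∈ AlgHom.range _) (h.isCotensorCoalgebra.comul_ofM m)).mpr ?_
      exact add_mem (map_mem_range_map_val hH hM _) (map_mem_range_map_val hM hH _)
  exact hle hs

theorem exists_lift {S : Type*} [Ring S] [Bialgebra K S] {j : S →ₐc[K] T}
    (hj : Function.Injective j) (hr : Set.range j = (X.generatedSubalgebra e : Set T)) :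
    ∃ i' : H →ₐc[K] S, ∀ x, j (i' x) = h.i x :=
  exists_bialgHom_lift hj fun x => by
    rw [hr]
    exact h.i_mem_generatedSubalgebra x

end IsCotensorHopfAlgebra

/-- The sub-Hopf algebra generated by `H` and `M` exists. -/
theorem IsCotensorHopfAlgebra.exists_generatedHopfAlgebra {T : Type u} [Ring T] [HopfAlgebra K T]
    {e : T ≃ₗ[K] X.Cotensor} (h : X.IsCotensorHopfAlgebra e) :
    ∃ (S : Type u) (_ : Ring S) (_ : HopfAlgebra K S) (j : S →ₐc[K] T),
      X.IsGeneratedHopfAlgebra e j := by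
  obtain ⟨S, _, _, j, hj, hr⟩ := exists_subBialgebra (X.generatedSubalgebra e)
    fun s hs => h.comul_mem_generatedSubalgebra hs
  obtain ⟨i', hi'⟩ := h.exists_lift hj hr
  have hu : IsUnit (toConv (LinearMap.id : S →ₗ[K] S)) :=
    isUnit_id_of_injective hj (i := (h.i : H →ₐ[K] T)) (p := h.isCotensorCoalgebra.projHom)
      (i' := (i' : H →ₐ[K] S)) hi'
      (h.isCotensorCoalgebra.locally_nilpotent h.one h.mul_fst h.mul_degOne)
  exact ⟨S, inferInstance, HopfAlgebra.ofConvInverse (↑hu.unit⁻¹ : WithConv (S →ₗ[K] S)).ofConv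
    hu.val_inv_mul hu.mul_val_inv, j, hj, hr⟩

end HopfBimodule

end YangBaxter

end

/-! ### The theorem -/

theorem theorem3p5 {K : Type u} [Field K] {H : Type v} [Ring H] [HopfAlgebra K H]
    {M : Type w} [AddCommGroup M] [Module K M] [Module H M] [IsScalarTower K H M]
    [Module Hᵐᵒᵖ M] [IsScalarTower K Hᵐᵒᵖ M] [SMulCommClass H Hᵐᵒᵖ M]
    (X : YangBaxter.HopfBimodule K H M)
    (hS : Function.Bijective (HopfAlgebra.antipode K : H →ₗ[K] H)) :
    (∃ (T : Type (max v w)) (_ : Ring T) (_ : HopfAlgebra K T) (e : T ≃ₗ[K] X.Cotensor),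
      X.IsCotensorHopfAlgebra e) ∧
    ∀ (T : Type (max v w)) [Ring T] [HopfAlgebra K T] (e : T ≃ₗ[K] X.Cotensor),
      X.IsCotensorHopfAlgebra e →
      ∃ (i : H →ₐc[K] T) (p : T →ₐc[K] H),
        (∀ h : H, i h = e.symm (h, 0)) ∧ (∀ x : T, p x = (e x).1) ∧
        YangBaxter.IsBiproductYB (i : H →ₗ[K] T) (p : T →ₗ[K] H) ∧
        (∃ (S : Type (max v w)) (_ : Ring S) (_ : HopfAlgebra K S) (j : S →ₐc[K] T),
          X.IsGeneratedHopfAlgebra e j) ∧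
        ∀ (S : Type (max v w)) [Ring S] [HopfAlgebra K S] (j : S →ₐc[K] T),
          X.IsGeneratedHopfAlgebra e j →
          ∃ (i' : H →ₐc[K] S) (p' : S →ₐc[K] H),
            (∀ h : H, j (i' h) = i h) ∧ (∀ s : S, p' s = p (j s)) ∧
            YangBaxter.IsBiproductYB (i' : H →ₗ[K] S) (p' : S →ₗ[K] H) := by
  refine ⟨⟨X.CotensorAlgebra, inferInstance, inferInstance, X.cotensorEquiv,
    X.isCotensorHopfAlgebra⟩, fun T _ _ e h => ⟨h.i, h.p, h.i_apply, h.p_apply,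
    YangBaxter.isBiproductYB h.p_i hS, h.exists_generatedHopfAlgebra, fun S _ _ j hj => ?_⟩⟩
  obtain ⟨i', hi'⟩ := h.exists_lift hj.1 hj.2
  -- The projection of `S` is the restriction of that of `T`, so it splits `i'` because `p` splits
  -- `i`; the structure theorem then applies to `S` unchanged.
  refine ⟨i', h.p.comp j, hi', fun _ => rfl, YangBaxter.isBiproductYB (fun x => ?_) hS⟩
  rw [BialgHom.comp_apply, hi', h.p_i]
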